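/- Conventions. $[V]=\{0,\dots,V-1\}$, $\lg=\log_2$, and $\mathrm{rank}_S(x)=|\{y\in S: y\le x\}|$. Fix an integer $\kappa\ge 2$ (the fineness parameter). A (fractional-length) binary string is a pair $(M,K)$ with $M\in\{0,1\}^{\ell}$ and $K\in[R]$, where either $\ell=0$ and $1\le R<2^{\kappa}$, or $\ell\ge 0$ and $2^\kappa\le R<2^{\kappa+1}$; its length is $\ell+\lg R$ bits. A data structure for sets of size $m$ in $[V]$ is such a string whose shape $(\ell,R)$ depends only on $\kappa$, $V$ and $m$, and not on the set. Algorithms for queries run on a word RAM with $w$-bit words, at most $2^w$ memory words and the usual unit-cost operations (loading and storing a word, $+,-,\times$, integer division, bitwise operations, shifts, comparisons). Lemma. Let $c\ge 2$ and $\epsilon>0$ be constants. There are a preprocessing algorithm $\mathtt{prepRankS}$, a query algorithm $\mathtt{qAlgRankS}$ (one program that does not depend on $\kappa,w,V,m$), and lookup tables $\mathtt{tableRankS}_{V,m}$ (one for each $\kappa,V,m$, independent of the set) of $O(2^{\epsilon\kappa})$ bits, such that the following holds for all integers $\kappa\ge2$, $0\le V\le 2^\kappa$ and $0\le m\le V$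 with $m\le c\,\kappa/\lg\kappa$. Given a set $S\subseteq[V]$ of size $m$, $\mathtt{prepRankS}$ preprocesses $S$ into a data structure of length at most $$\lg\binom{V}{m}+2^{-\kappa/2}$$ bits. Given any $x\in[V]$, $\mathtt{qAlgRankS}$ computes $\mathrm{rank}_S(x)$ in constant time in the worst case on a word RAM with word size $w\ge\Omega(\kappa)$, by accessing only the data structure and $\mathtt{tableRankS}_{V,m}$. The constants hidden in the time bound, in $O(2^{\epsilon\kappa})$ and in $\Omega(\kappa)$ depend only on $c$ and $\epsilon$. -/

import Mathlib

/-! ## Word RAM with word size `w` -/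

namespace WordRAM

/-- The word operations: arithmetic on `w`-bit integers, bitwise operators and shifts. -/
inductive BinOp where
  | add | sub | mul | div | mod | and | or | xor | shl | shr

/-- Arithmetic is on unsigned `w`-bit integers, modulo `2 ^ w`; `div` rounds down and returns `0`
for the divisor `0`; a shift by `w` or more returns `0`. -/
def BinOp.eval {w : ℕ} : BinOp → BitVec w → BitVec w → BitVec w
  | .add, a, b => a + b
  | .sub, a, b => a - b
  | .mul, a, b => a * b
  | .div, a, b => a / b
  | .mod, a, b => a % b
  | .and, a, b => a &&& b
  | .or, a, b => a ||| b
  | .xor, a, b => a ^^^ b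
  | .shl, a, b => a <<< b
  | .shr, a, b => a >>> b

/-- Instructions; `d`, `a`, `b` are register numbers and `l` is a line number of the program. -/
inductive Instr where
  /-- register `d` := the constant `n` (modulo `2 ^ w`) -/
  | const (d n : ℕ)
  /-- register `d` := `o` applied to the registers `a` and `b` -/
  | op (o : BinOp) (d a b : ℕ)
  /-- register `d` := the memory word whose address is in register `a` -/
  | load (d a : ℕ)
  /-- the memory word whose address is in register `a` := register `b` -/
  | store (a b : ℕ)
  /-- go to line `l` -/
  | jump (l : ℕ)
  /-- go to line `l` if register `a` is smaller than register `b` -/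
  | jumpLt (a b l : ℕ)
  /-- go to line `l` if the registers `a` and `b` are equal -/
  | jumpEq (a b l : ℕ)

/-- A program is a finite list of instructions; it does not depend on the word size, and it
mentions only finitely many registers. -/
abbrev Program := List Instr

/-- The memory has `2 ^ w` words of `w` bits, addressed by words. -/
structure State (w : ℕ) where
  pc : ℕ
  reg : ℕ → BitVec w
  mem : BitVec w → BitVec w

def Instr.exec {w : ℕ} (s : State w) : Instr → State w
  | .const d n => { s with pc := s.pc + 1, reg := Function.update s.reg d (BitVec.ofNat w n) }
  | .op o d a b =>
      { s with pc := s.pc + 1, reg := Function.update s.reg d (o.eval (s.reg a) (s.reg b)) }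
  | .load d a => { s with pc := s.pc + 1, reg := Function.update s.reg d (s.mem (s.reg a)) }
  | .store a b => { s with pc := s.pc + 1, mem := Function.update s.mem (s.reg a) (s.reg b) }
  | .jump l => { s with pc := l }
  | .jumpLt a b l => { s with pc := if s.reg a < s.reg b then l else s.pc + 1 }
  | .jumpEq a b l => { s with pc := if s.reg a = s.reg b then l else s.pc + 1 }

/-- The machine has halted when the program counter points at no instruction. -/
def Halted {w : ℕ} (P : Program) (s : State w) : Prop := P.length ≤ s.pc

/-- One time step executes one instruction; a halted machine stays as it is. -/
def step {w : ℕ} (P : Program) (s : State w) : State w :=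
  match P[s.pc]? with
  | some i => i.exec s
  | none => s

/-- Started in `s`, the program halts after at most `T` steps with the number `v` in register `0`. -/
def OutputsWithin {w : ℕ} (P : Program) (T : ℕ) (s : State w) (v : ℕ) : Prop :=
  Halted P ((step P)^[T] s) ∧ (((step P)^[T] s).reg 0).toNat = v

/-- A bit string cut into `⌈length / w⌉` words of `w` bits: bit `i` of word `j` (least significant
bit first) is bit `j * w + i` of the string, and the last word is padded with zeros. -/
def packWords (w : ℕ) (bits : List Bool) : List (BitVec w) :=
  List.ofFn fun j : Fin (bits.length ⌈/⌉ w) =>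
    (BitVec.ofBoolListLE ((bits.drop (j * w)).take w)).setWidth w

end WordRAM

/-! ## Binary strings of fractional length -/

/-- The pair `(|M|, R)` that fixes the set `{0,1}^|M| × {0, …, R - 1}` of the strings `(M, K)`. -/
structure FracShape where
  bits : ℕ
  range : ℕ

/-- The shapes allowed for the fineness parameter `κ`. -/
def FracShape.Valid (κ : ℕ) (s : FracShape) : Prop :=
  (s.bits = 0 ∧ 1 ≤ s.range ∧ s.range < 2 ^ κ) ∨ (2 ^ κ ≤ s.range ∧ s.range < 2 ^ (κ + 1))

/-- The length `|M| + lg R`, in bits. -/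
noncomputable def FracShape.length (s : FracShape) : ℝ := s.bits + Real.logb 2 s.range

/-- A pair `(M, K)`. -/
abbrev FracString := List Bool × ℕ

def FracString.HasShape (D : FracString) (s : FracShape) : Prop :=
  D.1.length = s.bits ∧ D.2 < s.range

/-! ## Rank queries -/

/-- The number of elements of `S` that are at most `x`. -/
def rank (S : Finset ℕ) (x : ℕ) : ℕ := (S.filter (· ≤ x)).card

/-- The memory at the start of a query: the words of the lookup table, from address `0`; then the
data structure `(M, K)`, as one word for `K` followed by the words of `M`; then zeros. -/
def queryMemory (w : ℕ) (table : List Bool) (D : FracString) : BitVec w → BitVec w := fun a =>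
  (WordRAM.packWords w table ++ BitVec.ofNat w D.2 :: WordRAM.packWords w D.1).getD a.toNat 0

/-- The registers at the start of a query: the query `x`, the parameters `V`, `m`, `κ`, the word
size `w`, and the address of the first word of the data structure. -/
def queryRegisters (w κ V m x : ℕ) (table : List Bool) : ℕ → BitVec w
  | 0 => BitVec.ofNat w x
  | 1 => BitVec.ofNat w V
  | 2 => BitVec.ofNat w m
  | 3 => BitVec.ofNat w κ
  | 4 => BitVec.ofNat w w
  | 5 => BitVec.ofNat w (WordRAM.packWords w table).length
  | _ => 0

def queryState (w κ V m x : ℕ) (table : List Bool) (D : FracString) : WordRAM.State w where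
  pc := 0
  reg := queryRegisters w κ V m x table
  mem := queryMemory w table D

/-! ## Branch-free query expressions and their compilation to the word RAM -/

namespace RankDS

open WordRAM

/-! Write the set as `s 0 < s 1 < ... < s (m-1)`, put `s m = V`, and let `d i` be the top bit in
which `s i` and `s (i+1)` differ. The condition that two numbers split at a given bit is affine over
the field with two elements. Hence the sequences with prescribed positions `d i` form an affine
class (`isXorClass_splitClass`), in which the low bits of every element are free. Such a class is
indexed by a payload: a body that holds the free bits verbatim, and a header of `O(κ)` bits on which
every element depends linearly (`IsXorClass.exists_payload`). A constant number of table lookups,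
one per header digit of `q = κ / N` bits, followed by exclusive or with a window of the body,
recovers any element.

The type of a set is the list of savings `r - d i`, where `V` has `r` bits, cut once the sum reaches
`S = D * κ`. Counting lists of bounded sum shows that there are at most `2 ^ (q / 4)` types when `κ`
is large. Classes of uncut types inject together into the `m`-subsets of `[V]`, so they waste
nothing. A cut type saves at least `S` bits against `m * r`; all cut types together therefore have
at most `C(V, m) / 2 ^ κ` sequences, even after arbitrary auxiliary words of `G * q` bits have been
added to each.

Every type receives an interval of values of the spill `K`, and the payload fills `M` and the rest
of `K` (`exists_shape`). Rounding costs at most one unit of `K` per type, so the relative excess is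
about (number of types) / `2 ^ κ`, well below `2 ^ (-κ / 2)`.

Queries use the idea behind fusion trees. The elements fall into `G` groups of consecutive ones, so
small that the positions `d i` of a group fit into a code of `q` bits. The bits of `x` at these
positions form a sketch, which is linear in `x` and hence again obtained by lookups. Code and sketch
select one candidate element. After comparison with that element alone, the first bit of
disagreement and the order determine the rank within the group (`exists_leadsTo`, `localRank_eq`).
The codes are further components of the payload: fixed by an uncut type, arbitrary words in a cut
one.

The query is a fixed expression without branches (`Expr.rankQuery`), compiled to straight-line code;
its value is established in `eval_rankQuery`. Whether a shape, a table and a string answer all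
queries is a primitive recursive condition, so the preprocessing may search for them, and every
construction only has to prove existence. For bounded `κ` the table lists all sets. -/

inductive ArithOp where
  | add | sub | mul | div | mod | xor

def ArithOp.toBinOp : ArithOp → BinOp
  | .add => .add
  | .sub => .sub
  | .mul => .mul
  | .div => .div
  | .mod => .mod
  | .xor => .xor

/-- The value if it is below the bound `B`. -/
def cap (B v : ℕ) : Option ℕ := if v < B then some v else none

/-- The exact result of an operation on natural numbers, undefined when it leaves `[0, B)`. -/
def ArithOp.eval (B : ℕ) : ArithOp → ℕ → ℕ → Option ℕ
  | .add, u, v => cap B (u + v)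
  | .sub, u, v => if v ≤ u then cap B (u - v) else none
  | .mul, u, v => cap B (u * v)
  | .div, u, v => cap B (u / v)
  | .mod, u, v => cap B (u % v)
  | .xor, u, v => cap B (u ^^^ v)

/-- Expressions over the query, the spill `K`, entries of the table and windows of `M`. -/
inductive Expr where
  | num (n : ℕ)
  | query
  | spill
  | bin (o : ArithOp) (a b : Expr)
  | look (a : Expr)
  | window (a : Expr)

/-- The value of an expression, for table entries and windows of `W` bits; `M` is given as the
number with these bits. -/
def Expr.eval (B W : ℕ) (tab : List ℕ) (M K x : ℕ) : Expr → Option ℕ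
  | .num n => cap B n
  | .query => cap B x
  | .spill => cap B K
  | .bin o a b => (a.eval B W tab M K x).bind fun u => (b.eval B W tab M K x).bind fun v => o.eval B u v
  | .look a => (a.eval B W tab M K x).bind fun u =>
      if u < tab.length then cap B (tab.getD u 0 % 2 ^ W) else none
  | .window a => (a.eval B W tab M K x).bind fun u => cap B (M / 2 ^ u % 2 ^ W)

/-- Replace register `d`, a bit offset, by the `u * κ` bits at that offset from the word whose
address is in register `d + 4`. -/
def fetch (u d : ℕ) : Program :=
  [.op .div (d + 1) d 4, .op .add (d + 1) (d + 1) (d + 4), .op .mod d d 4, .load (d + 2) (d + 1),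
   .op .shr (d + 2) (d + 2) d, .const (d + 3) 1, .op .add (d + 1) (d + 1) (d + 3),
   .load (d + 1) (d + 1), .op .sub (d + 3) 4 d, .op .shl (d + 1) (d + 1) (d + 3),
   .op .or (d + 1) (d + 1) (d + 2), .const d u, .op .mul d d 3, .op .sub d 4 d,
   .op .shl (d + 1) (d + 1) d, .op .shr d (d + 1) d]

/-- Code that computes an expression in register `d`, without touching the registers below. -/
def Expr.compile (u : ℕ) : Expr → ℕ → Program
  | .num n, d => [.const d n]
  | .query, d => [.op .or d 0 0]
  | .spill, d => [.load d 5]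
  | .bin o a b, d => a.compile u d ++ b.compile u (d + 1) ++ [.op o.toBinOp d d (d + 1)]
  | .look a, d => a.compile u d ++
      [.const (d + 1) u, .op .mul (d + 1) (d + 1) 3, .op .mul d d (d + 1), .const (d + 4) 0] ++
      fetch u d
  | .window a, d => a.compile u d ++ [.const (d + 4) 1, .op .add (d + 4) (d + 4) 5] ++ fetch u d

def Expr.program (u : ℕ) (e : Expr) : Program := e.compile u 6 ++ [.op .or 0 6 6]

/-- Run straight-line code. -/
def run {w : ℕ} (L : Program) (s : State w) : State w := L.foldl (fun s i => i.exec s) s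

theorem run_append {w : ℕ} (L L' : Program) (s : State w) : run (L ++ L') s = run L' (run L s) := by
  simp [run, List.foldl_append]

/-- Without jumps the running time is the length of the program, which is a constant. -/
def Straight (i : Instr) : Prop := ∀ (w : ℕ) (s : State w), (i.exec s).pc = s.pc + 1

theorem straight_const (d n : ℕ) : Straight (.const d n) := fun _ _ => rfl
theorem straight_op (o : BinOp) (d a b : ℕ) : Straight (.op o d a b) := fun _ _ => rfl
theorem straight_load (d a : ℕ) : Straight (.load d a) := fun _ _ => rfl

theorem straight_fetch (u d : ℕ) : ∀ i ∈ fetch u d, Straight i := by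
  intro i hi
  simp only [fetch, List.mem_cons, List.not_mem_nil, or_false] at hi
  rcases hi with h | h | h | h | h | h | h | h | h | h | h | h | h | h | h | h <;> subst h <;>
    intro w s <;> rfl

theorem Expr.straight_compile (u : ℕ) (e : Expr) : ∀ d, ∀ i ∈ e.compile u d, Straight i := by
  induction e with
  | num n => intro d i hi; simp [compile] at hi; subst hi; exact straight_const _ _
  | query => intro d i hi; simp [compile] at hi; subst hi; exact straight_op _ _ _ _
  | spill => intro d i hi; simp [compile] at hi; subst hi; exact straight_load _ _
  | bin o a b iha ihb =>
    intro d i hi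
    simp only [compile, List.mem_append, List.mem_singleton] at hi
    rcases hi with (h | h) | h
    · exact iha _ _ h
    · exact ihb _ _ h
    · subst h; exact straight_op _ _ _ _
  | look a iha =>
    intro d i hi
    simp only [compile, List.mem_append, List.mem_cons, List.not_mem_nil, or_false] at hi
    rcases hi with (h | h | h | h | h) | h
    · exact iha _ _ h
    · subst h; exact straight_const _ _
    · subst h; exact straight_op _ _ _ _
    · subst h; exact straight_op _ _ _ _
    · subst h; exact straight_const _ _
    · exact straight_fetch _ _ _ h
  | window a iha =>
    intro d i hi
    simp only [compile, List.mem_append, List.mem_cons, List.not_mem_nil, or_false] at hi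
    rcases hi with (h | h | h) | h
    · exact iha _ _ h
    · subst h; exact straight_const _ _
    · subst h; exact straight_op _ _ _ _
    · exact straight_fetch _ _ _ h

theorem step_iterate_straight {w : ℕ} (P : Program) (hP : ∀ i ∈ P, Straight i) (s : State w)
    (hs : s.pc = 0) :
    ∀ n ≤ P.length, (step P)^[n] s = run (P.take n) s ∧ ((step P)^[n] s).pc = n := by
  intro n
  induction n with
  | zero => intro _; simp [run, hs]
  | succ n ih =>
    intro hn
    obtain ⟨h1, h2⟩ := ih (by omega)
    have key : ∀ s' : State w, s'.pc = n → step P s' = (P[n]'(by omega)).exec s' := by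
      intro s' h
      simp only [step, h, List.getElem?_eq_getElem (show n < P.length by omega)]
    have hstep := key _ h2
    rw [Function.iterate_succ_apply', hstep]
    constructor
    · rw [List.take_succ_eq_append_getElem (by omega), run_append, ← h1]
      rfl
    · rw [hP _ (List.getElem_mem _), h2]

theorem step_iterate_length {w : ℕ} (P : Program) (hP : ∀ i ∈ P, Straight i) (s : State w)
    (hs : s.pc = 0) : (step P)^[P.length] s = run P s ∧ ((step P)^[P.length] s).pc = P.length := by
  simpa using step_iterate_straight P hP s hs P.length le_rfl

theorem run_fetch_mem {w : ℕ} (u d : ℕ) (s : State w) :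
    (run (fetch u (d + 6)) s).mem = s.mem ∧
      ∀ r < d + 6, (run (fetch u (d + 6)) s).reg r = s.reg r := by
  constructor
  · simp [run, fetch, Instr.exec]
  · intro r hr
    simp only [run, fetch, Instr.exec, List.foldl_cons, List.foldl_nil]
    repeat rw [Function.update_of_ne (by omega)]

theorem run_fetch_reg {w : ℕ} (u d : ℕ) (s : State w) :
    (run (fetch u (d + 6)) s).reg (d + 6) =
      let off := s.reg (d + 6)
      let a := off / s.reg 4 + s.reg (d + 10)
      let sh := off % s.reg 4
      let c := s.reg 4 - BitVec.ofNat w u * s.reg 3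
      (((s.mem (a + BitVec.ofNat w 1) <<< (s.reg 4 - sh)) ||| (s.mem a >>> sh)) <<< c) >>> c := by
  simp [run, fetch, Instr.exec, BinOp.eval, Function.update]

/-- A window of at most `w` bits meets at most two consecutive words. Two shifts join the pieces,
and the final shifts left and right by `w - u * κ` clear the bits beyond the window. The hypothesis
`hbits` leaves open whether the bits come from the table or from `M`. -/
theorem toNat_fetch {w u κ : ℕ} (d : ℕ) (s : State w) (off a Y : ℕ)
    (hw : 1 ≤ w) (h3 : (s.reg 3).toNat = κ) (h4 : (s.reg 4).toNat = w) (hW : u * κ ≤ w)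
    (hoff : (s.reg (d + 6)).toNat = off) (ha : (s.reg (d + 10)).toNat = a)
    (hY : Y < 2 ^ (u * κ))
    (hbits : ∀ k < u * κ,
      (s.mem (BitVec.ofNat w (a + (off + k) / w))).getLsbD ((off + k) % w) = Y.testBit k) :
    ((run (fetch u (d + 6)) s).reg (d + 6)).toNat = Y := by
  have hww : w < 2 ^ w := Nat.lt_two_pow_self
  rw [run_fetch_reg]
  have hc : (s.reg 4 - BitVec.ofNat w u * s.reg 3).toNat = w - u * κ := by
    have h1 : (BitVec.ofNat w u * s.reg 3).toNat = u * κ := by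
      rw [BitVec.toNat_mul, BitVec.toNat_ofNat, h3, Nat.mod_mul_mod, Nat.mod_eq_of_lt (by omega)]
    rw [BitVec.toNat_sub_of_le (by rw [BitVec.le_def, h1, h4]; exact hW), h1, h4]
  have hsh : (s.reg (d + 6) % s.reg 4).toNat = off % w := by
    rw [BitVec.toNat_umod, hoff, h4]
  have hmod : off % w < w := Nat.mod_lt _ hw
  have hsh' : (s.reg 4 - s.reg (d + 6) % s.reg 4).toNat = w - off % w := by
    rw [BitVec.toNat_sub_of_le (by rw [BitVec.le_def, hsh, h4]; omega), hsh, h4]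
  have ha0 : s.reg (d + 6) / s.reg 4 + s.reg (d + 10) = BitVec.ofNat w (a + off / w) := by
    apply BitVec.eq_of_toNat_eq
    rw [BitVec.toNat_add, BitVec.toNat_udiv, hoff, h4, ha, BitVec.toNat_ofNat, Nat.add_comm]
  have ha1 : s.reg (d + 6) / s.reg 4 + s.reg (d + 10) + BitVec.ofNat w 1 =
      BitVec.ofNat w (a + off / w + 1) := by
    rw [ha0, ← BitVec.ofNat_add]
  simp only [BitVec.shiftLeft_eq', BitVec.ushiftRight_eq', hc, hsh, hsh', ha1]
  rw [ha0]
  apply Nat.eq_of_testBit_eq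
  intro k
  rw [BitVec.testBit_toNat, BitVec.getLsbD_ushiftRight, BitVec.getLsbD_shiftLeft]
  by_cases hk : k < u * κ
  · have e1 : w - u * κ + k < w := by omega
    have e2 : ¬ w - u * κ + k < w - u * κ := by omega
    have e3 : w - u * κ + k - (w - u * κ) = k := by omega
    simp only [e1, e2, e3, decide_true, decide_false, Bool.not_false, Bool.true_and]
    rw [BitVec.getLsbD_or, BitVec.getLsbD_shiftLeft, BitVec.getLsbD_ushiftRight, ← hbits k hk]
    have hdm := Nat.div_add_mod off w
    by_cases hlt : off % w + k < w
    · have e4 : (off + k) / w = off / w := by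
        rw [← hdm, Nat.add_assoc, Nat.mul_add_div hw, Nat.div_eq_of_lt hlt, Nat.mul_add_div hw,
          Nat.div_eq_of_lt hmod]
      have e5 : (off + k) % w = off % w + k := by
        rw [← Nat.mod_add_mod, Nat.mod_eq_of_lt hlt]
      have e6 : k < w - off % w := by omega
      simp [e4, e5, e6]
    · have h7 : off % w + k - w < w := by omega
      have e4 : (off + k) / w = off / w + 1 := by
        have : off + k = w * (off / w + 1) + (off % w + k - w) := by
          rw [Nat.mul_add]; omega
        rw [this, Nat.mul_add_div hw, Nat.div_eq_of_lt h7, Nat.add_zero]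
      have e5 : (off + k) % w = off % w + k - w := by
        have : off + k = w * (off / w + 1) + (off % w + k - w) := by
          rw [Nat.mul_add]; omega
        rw [this, Nat.mul_add_mod, Nat.mod_eq_of_lt h7]
      have e6 : ¬ k < w - off % w := by omega
      have e7 : k - (w - off % w) = off % w + k - w := by omega
      have e8 : k < w := by omega
      have e9 : (s.mem (BitVec.ofNat w (a + off / w))).getLsbD (off % w + k) = false :=
        BitVec.getLsbD_of_ge _ _ (by omega)
      simp [e4, e5, e6, e7, e8, e9, Nat.add_assoc]
  · have e1 : ¬ w - u * κ + k < w := by omega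
    simp only [e1, decide_false, Bool.false_and]
    exact (Nat.testBit_lt_two_pow (lt_of_lt_of_le hY (Nat.pow_le_pow_right (by omega) (by omega)))).symm

/-- The `n` least significant bits of a number, lowest first. -/
def bitList (n v : ℕ) : List Bool := (List.range n).map fun i => v.testBit i

@[simp] theorem length_bitList (n v : ℕ) : (bitList n v).length = n := by simp [bitList]

theorem getD_bitList {n v : ℕ} (hv : v < 2 ^ n) (k : ℕ) : (bitList n v).getD k false = v.testBit k := by
  by_cases hk : k < n
  · simp [bitList, hk]
  · rw [List.getD_eq_default _ _ (by simpa using hk), Nat.testBit_lt_two_pow]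
    exact lt_of_lt_of_le hv (Nat.pow_le_pow_right (by omega) (by omega))

/-- The bits of a table of `W`-bit entries. -/
def tableBits (W : ℕ) (tab : List ℕ) : List Bool := tab.flatMap (bitList W)

theorem length_tableBits (W : ℕ) (tab : List ℕ) : (tableBits W tab).length = tab.length * W := by
  simp [tableBits, List.length_flatMap]

theorem getD_tableBits (W : ℕ) (tab : List ℕ) :
    ∀ j k, j < tab.length → k < W →
      (tableBits W tab).getD (j * W + k) false = (tab.getD j 0).testBit k := by
  induction tab with
  | nil => intro j k hj; simp at hj
  | cons e tab ih =>
    intro j k hj hk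
    rw [tableBits, List.flatMap_cons]
    cases j with
    | zero =>
      rw [List.getD_append _ _ _ _ (by simpa using hk)]
      simp [bitList, hk]
    | succ j =>
      rw [List.getD_append_right _ _ _ _ (by simp; nlinarith), length_bitList,
        show (j + 1) * W + k - W = j * W + k by rw [Nat.add_mul]; omega]
      simpa [tableBits] using ih j k (by simpa using hj) hk

/-! ### Bits of the initial memory -/

theorem length_packWords (w : ℕ) (bits : List Bool) :
    (packWords w bits).length = bits.length ⌈/⌉ w := by simp [packWords]

theorem lt_ceilDiv_iff {a w j : ℕ} (hw : 0 < w) : j < a ⌈/⌉ w ↔ j * w < a := by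
  rw [← not_le, ceilDiv_le_iff_le_mul hw, not_le, Nat.mul_comm]

theorem getLsbD_packWords {w : ℕ} (bits : List Bool) (hw : 0 < w) (j i : ℕ) (hi : i < w) :
    ((packWords w bits).getD j 0).getLsbD i = bits.getD (j * w + i) false := by
  by_cases hj : j < bits.length ⌈/⌉ w
  · have : (packWords w bits).getD j 0 =
        (BitVec.ofBoolListLE ((bits.drop (j * w)).take w)).setWidth w := by
      rw [List.getD_eq_getElem _ _ (by rw [length_packWords]; exact hj)]
      simp [packWords]
    rw [this, BitVec.getLsbD_setWidth, BitVec.getLsbD_ofBoolListLE]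
    simp [hi, List.getD_eq_getElem?_getD, List.getElem?_drop]
  · rw [List.getD_eq_default _ _ (by rw [length_packWords]; omega)]
    rw [lt_ceilDiv_iff hw] at hj
    rw [List.getD_eq_default _ _ (by omega)]
    simp

theorem ceilDiv_le_self {a w : ℕ} (hw : 0 < w) : a ⌈/⌉ w ≤ a := by
  rw [ceilDiv_le_iff_le_mul hw]
  exact Nat.le_mul_of_pos_left a hw

section Memory

variable {w : ℕ} (table : List Bool) (D : FracString)

theorem queryMemory_table (hw : 0 < w) (hlen : table.length < 2 ^ w) (n : ℕ)
    (hn : n < table.length) :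
    (queryMemory w table D (BitVec.ofNat w (0 + n / w))).getLsbD (n % w) =
      table.getD n false := by
  have h1 : n / w < 2 ^ w := lt_of_le_of_lt (Nat.div_le_self _ _) (hn.trans hlen)
  have h2 : n / w < (packWords w table).length := by
    rw [length_packWords, lt_ceilDiv_iff hw]
    exact lt_of_le_of_lt (Nat.div_mul_le_self _ _) hn
  rw [queryMemory, BitVec.toNat_ofNat, Nat.zero_add, Nat.mod_eq_of_lt h1,
    List.getD_append _ _ _ _ h2, getLsbD_packWords table hw _ _ (Nat.mod_lt _ hw),
    Nat.mul_comm, Nat.div_add_mod]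

theorem queryMemory_spill (hw : 0 < w) (hlen : table.length < 2 ^ w) :
    queryMemory w table D (BitVec.ofNat w (packWords w table).length) = BitVec.ofNat w D.2 := by
  have h1 : (packWords w table).length < 2 ^ w := by
    rw [length_packWords]; exact lt_of_le_of_lt (ceilDiv_le_self hw) hlen
  rw [queryMemory, BitVec.toNat_ofNat, Nat.mod_eq_of_lt h1, List.getD_append_right _ _ _ _ le_rfl]
  simp

theorem queryMemory_bits (hw : 0 < w) (n : ℕ)
    (hn : (packWords w table).length + 1 + n / w < 2 ^ w) :
    (queryMemory w table D
      (BitVec.ofNat w ((packWords w table).length + 1 + n / w))).getLsbD (n % w) =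
      D.1.getD n false := by
  have h1 : ∀ a j : ℕ, a ≤ a + 1 + j ∧ a + 1 + j - a = j + 1 := by omega
  rw [queryMemory, BitVec.toNat_ofNat, Nat.mod_eq_of_lt hn,
    List.getD_append_right _ _ _ _ (h1 _ _).1, (h1 _ _).2,
    List.getD_cons_succ, getLsbD_packWords D.1 hw _ _ (Nat.mod_lt _ hw),
    Nat.mul_comm, Nat.div_add_mod]

end Memory

theorem cap_eq_some {B v r : ℕ} : cap B v = some r ↔ v < B ∧ v = r := by
  unfold cap; split_ifs with h <;> simp [h]

theorem ArithOp.toNat_eval {w B : ℕ} (hB : B ≤ 2 ^ w) (o : ArithOp) (a b : BitVec w) {r : ℕ}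
    (h : o.eval B a.toNat b.toNat = some r) : (o.toBinOp.eval a b).toNat = r ∧ r < B := by
  cases o <;> simp only [ArithOp.eval, cap_eq_some] at h
  · obtain ⟨h1, rfl⟩ := h
    exact ⟨by simp [toBinOp, BinOp.eval, Nat.mod_eq_of_lt (h1.trans_le hB)], h1⟩
  · split_ifs at h with hle
    obtain ⟨h1, rfl⟩ := cap_eq_some.1 h
    exact ⟨BitVec.toNat_sub_of_le (BitVec.le_def.2 hle), h1⟩
  · obtain ⟨h1, rfl⟩ := h
    exact ⟨by simp [toBinOp, BinOp.eval, Nat.mod_eq_of_lt (h1.trans_le hB)], h1⟩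
  · obtain ⟨h1, rfl⟩ := h
    exact ⟨by simp [toBinOp, BinOp.eval], h1⟩
  · obtain ⟨h1, rfl⟩ := h
    exact ⟨by simp [toBinOp, BinOp.eval], h1⟩
  · obtain ⟨h1, rfl⟩ := h
    exact ⟨by simp [toBinOp, BinOp.eval], h1⟩

/-! ### Correctness of the compiled code -/

section Correct

variable {w u κ B ℓ M K x : ℕ} {tab : List ℕ}

/-- The registers from `d + 6` on act as a stack: the induction needs that all lower registers
survive, which protects the parameters in registers `0` to `5` and the intermediate values. Since
values stay below `B` and `4 * B ≤ 2 ^ w`, arithmetic modulo `2 ^ w` agrees with exact arithmetic.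
-/
theorem Expr.run_compile (hκ : 1 ≤ κ) (hu : 1 ≤ u) (hW : u * κ ≤ w) (hB : 4 * B ≤ 2 ^ w)
    (htab : tab.length * (u * κ) < B) (hM : M < 2 ^ ℓ) (e : Expr) :
    ∀ (d : ℕ) (s : State w) (v : ℕ), e.eval B (u * κ) tab M K x = some v →
      (s.reg 0).toNat = x → (s.reg 3).toNat = κ → (s.reg 4).toNat = w →
      s.reg 5 = BitVec.ofNat w (packWords w (tableBits (u * κ) tab)).length →
      s.mem = queryMemory w (tableBits (u * κ) tab) (bitList ℓ M, K) →
      (run (e.compile u (d + 6)) s).mem = s.mem ∧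
      (∀ r < d + 6, (run (e.compile u (d + 6)) s).reg r = s.reg r) ∧
      ((run (e.compile u (d + 6)) s).reg (d + 6)).toNat = v ∧ v < B := by
  have hw : 0 < w := lt_of_lt_of_le (Nat.mul_pos hu hκ) hW
  have hww : w < 2 ^ w := Nat.lt_two_pow_self
  have hκw : κ ≤ w := le_trans (Nat.le_mul_of_pos_left κ hu) hW
  have hlen : (tableBits (u * κ) tab).length < B := by rwa [length_tableBits]
  have hu' : u < 2 ^ w := by
    have : u ≤ u * κ := Nat.le_mul_of_pos_right u hκ
    omega
  induction e with
  | num n =>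
    intro d s v hv _ _ _ _ _
    obtain ⟨h1, rfl⟩ := cap_eq_some.1 hv
    refine ⟨rfl, fun r hr => ?_, ?_, h1⟩
    · simp only [compile, run, List.foldl_cons, List.foldl_nil, Instr.exec]
      rw [Function.update_of_ne (by omega)]
    · simp only [compile, run, List.foldl_cons, List.foldl_nil, Instr.exec, Function.update_self]
      rw [BitVec.toNat_ofNat, Nat.mod_eq_of_lt (by omega)]
  | query =>
    intro d s v hv h0 _ _ _ _
    obtain ⟨h1, rfl⟩ := cap_eq_some.1 hv
    refine ⟨rfl, fun r hr => ?_, ?_, h1⟩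
    · simp only [compile, run, List.foldl_cons, List.foldl_nil, Instr.exec]
      rw [Function.update_of_ne (by omega)]
    · simp [compile, run, Instr.exec, BinOp.eval, h0]
  | spill =>
    intro d s v hv _ _ _ h5 hm
    obtain ⟨h1, rfl⟩ := cap_eq_some.1 hv
    refine ⟨rfl, fun r hr => ?_, ?_, h1⟩
    · simp only [compile, run, List.foldl_cons, List.foldl_nil, Instr.exec]
      rw [Function.update_of_ne (by omega)]
    · simp only [compile, run, List.foldl_cons, List.foldl_nil, Instr.exec, Function.update_self]
      rw [h5, hm, queryMemory_spill _ _ hw (by omega), BitVec.toNat_ofNat,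
        Nat.mod_eq_of_lt (by omega)]
  | bin o a b iha ihb =>
    intro d s v hv h0 h3 h4 h5 hm
    simp only [eval, Option.bind_eq_some_iff] at hv
    obtain ⟨va, hva, vb, hvb, hv⟩ := hv
    obtain ⟨a1, a2, a3, -⟩ := iha d s va hva h0 h3 h4 h5 hm
    set s1 := run (a.compile u (d + 6)) s with hs1
    obtain ⟨b1, b2, b3, -⟩ := ihb (d + 1) s1 vb hvb (by rw [a2 0 (by omega), h0])
      (by rw [a2 3 (by omega), h3]) (by rw [a2 4 (by omega), h4]) (by rw [a2 5 (by omega), h5])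
      (by rw [a1, hm])
    have hcomp : run (Expr.compile u (.bin o a b) (d + 6)) s =
        (Instr.op o.toBinOp (d + 6) (d + 6) (d + 6 + 1)).exec
          (run (b.compile u (d + 1 + 6)) s1) := by
      simp only [compile, run_append, ← hs1]
      rfl
    rw [hcomp]
    set s2 := run (b.compile u (d + 1 + 6)) s1
    have hd : (s2.reg (d + 6)).toNat = va := by rw [b2 _ (by omega), a3]
    have hd1 : (s2.reg (d + 6 + 1)).toNat = vb := by
      rw [← b3]
    have key := ArithOp.toNat_eval (show B ≤ 2 ^ w by omega) o (s2.reg (d + 6)) (s2.reg (d + 6 + 1))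
      (by rw [hd, hd1]; exact hv)
    refine ⟨by simp [Instr.exec, b1, a1], fun r hr => ?_, ?_, key.2⟩
    · simp only [Instr.exec]
      rw [Function.update_of_ne (by omega), b2 r (by omega), a2 r hr]
    · simpa [Instr.exec] using key.1
  | look a iha =>
    intro d s v hv h0 h3 h4 h5 hm
    simp only [eval, Option.bind_eq_some_iff] at hv
    obtain ⟨va, hva, hv⟩ := hv
    split_ifs at hv with hlt
    obtain ⟨hvB, rfl⟩ := cap_eq_some.1 hv
    obtain ⟨a1, a2, a3, -⟩ := iha d s va hva h0 h3 h4 h5 hm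
    set s1 := run (a.compile u (d + 6)) s with hs1
    set s2 := run [.const (d + 6 + 1) u, .op .mul (d + 6 + 1) (d + 6 + 1) 3,
      .op .mul (d + 6) (d + 6) (d + 6 + 1), .const (d + 6 + 4) 0] s1 with hs2
    have hcomp : run (Expr.compile u (.look a) (d + 6)) s = run (fetch u (d + 6)) s2 := by
      simp only [compile, run_append, ← hs1, ← hs2]
    have hm2 : s2.mem = s.mem := by rw [← a1]; rfl
    have hr2 : ∀ r < d + 6, s2.reg r = s.reg r := by
      intro r hr
      rw [← a2 r hr]
      simp only [hs2, run, List.foldl_cons, List.foldl_nil, Instr.exec]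
      repeat rw [Function.update_of_ne (by omega)]
    have hle : va * (u * κ) + u * κ ≤ tab.length * (u * κ) := by
      rw [← Nat.succ_mul]; exact Nat.mul_le_mul_right _ hlt
    have hd : (s2.reg (d + 6)).toNat = va * (u * κ) := by
      have : s2.reg (d + 6) = s1.reg (d + 6) * (BitVec.ofNat w u * s1.reg 3) := by
        simp [hs2, run, Instr.exec, BinOp.eval, Function.update]
      rw [this, BitVec.toNat_mul, BitVec.toNat_mul, BitVec.toNat_ofNat, a3, a2 3 (by omega), h3,
        Nat.mod_mul_mod, Nat.mod_eq_of_lt (show u * κ < 2 ^ w by omega), Nat.mod_eq_of_lt (by omega)]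
    have hd4 : (s2.reg (d + 10)).toNat = 0 := by
      simp [hs2, run, Instr.exec]
    rw [hcomp]
    refine ⟨by rw [(run_fetch_mem u d s2).1, hm2],
      fun r hr => by rw [(run_fetch_mem u d s2).2 r hr, hr2 r hr], ?_, hvB⟩
    refine toNat_fetch d s2 _ 0 _ hw (by rw [hr2 3 (by omega), h3]) (by rw [hr2 4 (by omega), h4])
      hW hd hd4 (Nat.mod_lt _ (by positivity)) fun k hk => ?_
    rw [hm2, hm, queryMemory_table _ _ hw (by omega) _ (by rw [length_tableBits]; omega),
      getD_tableBits _ _ _ _ hlt hk, Nat.testBit_mod_two_pow]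
    simp [hk]
  | window a iha =>
    intro d s v hv h0 h3 h4 h5 hm
    simp only [eval, Option.bind_eq_some_iff] at hv
    obtain ⟨va, hva, hv⟩ := hv
    obtain ⟨hvB, rfl⟩ := cap_eq_some.1 hv
    obtain ⟨a1, a2, a3, a4⟩ := iha d s va hva h0 h3 h4 h5 hm
    set s1 := run (a.compile u (d + 6)) s with hs1
    set s2 := run [.const (d + 6 + 4) 1, .op .add (d + 6 + 4) (d + 6 + 4) 5] s1 with hs2
    have hcomp : run (Expr.compile u (.window a) (d + 6)) s = run (fetch u (d + 6)) s2 := by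
      simp only [compile, run_append, ← hs1, ← hs2]
    have hm2 : s2.mem = s.mem := by rw [← a1]; rfl
    have hr2 : ∀ r < d + 6 + 1, s2.reg r = s1.reg r := by
      intro r hr
      simp only [hs2, run, List.foldl_cons, List.foldl_nil, Instr.exec]
      repeat rw [Function.update_of_ne (by omega)]
    have hr3 : ∀ r < d + 6, s2.reg r = s.reg r := fun r hr => by rw [hr2 r (by omega), a2 r hr]
    set base := (packWords w (tableBits (u * κ) tab)).length with hbase
    have hbB : base < B := by
      rw [hbase, length_packWords]; exact lt_of_le_of_lt (ceilDiv_le_self hw) hlen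
    have hd : (s2.reg (d + 6)).toNat = va := by rw [hr2 _ (by omega), a3]
    have hd4 : (s2.reg (d + 10)).toNat = base + 1 := by
      have : s2.reg (d + 10) = BitVec.ofNat w 1 + s1.reg 5 := by
        simp [hs2, run, Instr.exec, BinOp.eval, Function.update]
      rw [this, a2 5 (by omega), h5, ← BitVec.ofNat_add, BitVec.toNat_ofNat,
        Nat.mod_eq_of_lt (by omega), Nat.add_comm]
    rw [hcomp]
    refine ⟨by rw [(run_fetch_mem u d s2).1, hm2],
      fun r hr => by rw [(run_fetch_mem u d s2).2 r hr, hr3 r hr], ?_, hvB⟩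
    refine toNat_fetch d s2 _ (base + 1) _ hw (by rw [hr3 3 (by omega), h3])
      (by rw [hr3 4 (by omega), h4]) hW hd hd4 (Nat.mod_lt _ (by positivity)) fun k hk => ?_
    -- A crude bound is enough: `base` and `va` are below `B`, so the address stays below `4 * B`.
    -- Beyond the end of `M` the memory is zero, in agreement with `M / 2 ^ va`.
    have hdiv : (va + k) / w ≤ va + 1 := by
      calc (va + k) / w ≤ (va * w + w) / w := Nat.div_le_div_right (by nlinarith)
        _ = va + 1 := by rw [← Nat.succ_mul, Nat.mul_div_cancel _ hw]
    rw [hm2, hm, queryMemory_bits _ _ hw _ (by omega), getD_bitList hM, Nat.testBit_mod_two_pow,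
      Nat.testBit_div_two_pow]
    simp [hk, Nat.add_comm]

theorem Expr.outputsWithin (e : Expr) (V m v : ℕ) (hκ : 1 ≤ κ) (hu : 1 ≤ u) (hW : u * κ ≤ w)
    (hB : 4 * B ≤ 2 ^ w) (htab : tab.length * (u * κ) < B) (hM : M < 2 ^ ℓ) (hx : x < B)
    (he : e.eval B (u * κ) tab M K x = some v) :
    OutputsWithin (e.program u) (e.program u).length
      (queryState w κ V m x (tableBits (u * κ) tab) (bitList ℓ M, K)) v := by
  have hww : w < 2 ^ w := Nat.lt_two_pow_self
  have hκw : κ ≤ w := le_trans (Nat.le_mul_of_pos_left κ hu) hW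
  have hst : ∀ i ∈ e.program u, Straight i := by
    intro i hi
    simp only [program, List.mem_append, List.mem_singleton] at hi
    rcases hi with h | h
    · exact e.straight_compile u _ _ h
    · subst h; exact straight_op _ _ _ _
  obtain ⟨h1, h2⟩ := step_iterate_length (e.program u) hst
    (queryState w κ V m x (tableBits (u * κ) tab) (bitList ℓ M, K)) rfl
  obtain ⟨-, -, h3, -⟩ := e.run_compile hκ hu hW hB htab hM 0
    (queryState w κ V m x (tableBits (u * κ) tab) (bitList ℓ M, K)) v he
    (by simp [queryState, queryRegisters, Nat.mod_eq_of_lt (show x < 2 ^ w by omega)])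
    (by simp [queryState, queryRegisters, Nat.mod_eq_of_lt (show κ < 2 ^ w by omega)])
    (by simp [queryState, queryRegisters]) (by simp [queryState, queryRegisters]) rfl
  refine ⟨h2.ge, ?_⟩
  rw [h1, program, run_append]
  simp only [run, List.foldl_cons, List.foldl_nil, Instr.exec, BinOp.eval, Function.update_self,
    BitVec.or_self]
  exact h3

end Correct

end RankDS

/-! ## Computability of the preprocessing -/

namespace RankDS

open WordRAM

theorem xor_mod_two_pow_succ (a b n : ℕ) :
    (a ^^^ b) % 2 ^ (n + 1) = (a ^^^ b) % 2 ^ n + 2 ^ n * ((a / 2 ^ n + b / 2 ^ n) % 2) := by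
  rw [Nat.mod_pow_succ, Nat.xor_div_two_pow, Nat.xor_mod_two_eq]

theorem primrec_pow : Primrec₂ ((· ^ ·) : ℕ → ℕ → ℕ) := Primrec₂.unpaired'.1 Nat.Primrec.pow

/-- The result is assembled bit by bit. After `a + b` steps it is complete, because both arguments
are below `2 ^ (a + b)`. -/
theorem primrec_xor : Primrec₂ ((· ^^^ ·) : ℕ → ℕ → ℕ) := by
  have h : Primrec fun q : (ℕ × ℕ) => Nat.rec (motive := fun _ => ℕ) 0
      (fun n r => r + 2 ^ n * ((q.1 / 2 ^ n + q.2 / 2 ^ n) % 2)) (q.1 + q.2) := by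
    refine Primrec.nat_rec' (h := fun (q : ℕ × ℕ) (r : ℕ × ℕ) =>
      r.2 + 2 ^ r.1 * ((q.1 / 2 ^ r.1 + q.2 / 2 ^ r.1) % 2))
      (Primrec.nat_add.comp Primrec.fst Primrec.snd) (Primrec.const 0) ?_
    have hn : Primrec fun z : (ℕ × ℕ) × (ℕ × ℕ) => 2 ^ z.2.1 :=
      primrec_pow.comp (Primrec.const 2) (Primrec.fst.comp Primrec.snd)
    exact Primrec.nat_add.comp (Primrec.snd.comp Primrec.snd) (Primrec.nat_mul.comp hn
      (Primrec.nat_mod.comp (Primrec.nat_add.comp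
        (Primrec.nat_div.comp (Primrec.fst.comp Primrec.fst) hn)
        (Primrec.nat_div.comp (Primrec.snd.comp Primrec.fst) hn)) (Primrec.const 2)))
  refine h.of_eq fun q => ?_
  obtain ⟨a, b⟩ := q
  have key : ∀ n, Nat.rec (motive := fun _ => ℕ) 0
      (fun n r => r + 2 ^ n * ((a / 2 ^ n + b / 2 ^ n) % 2)) n = (a ^^^ b) % 2 ^ n := by
    intro n
    induction n with
    | zero => simp [Nat.mod_one]
    | succ n ih => rw [xor_mod_two_pow_succ, ← ih]
  refine (key (a + b)).trans (Nat.mod_eq_of_lt (Nat.xor_lt_two_pow ?_ ?_))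
  · exact lt_of_lt_of_le Nat.lt_two_pow_self (Nat.pow_le_pow_right (by omega) (by omega))
  · exact lt_of_lt_of_le Nat.lt_two_pow_self (Nat.pow_le_pow_right (by omega) (by omega))

theorem primrec_cap : Primrec₂ cap :=
  Primrec.ite (Primrec.nat_lt.comp Primrec.snd Primrec.fst)
    (Primrec.option_some.comp Primrec.snd) (Primrec.const none)

theorem ArithOp.primrec_eval (o : ArithOp) :
    Primrec fun q : ℕ × ℕ × ℕ => o.eval q.1 q.2.1 q.2.2 := by
  have hB : Primrec fun q : ℕ × ℕ × ℕ => q.1 := Primrec.fst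
  have hu : Primrec fun q : ℕ × ℕ × ℕ => q.2.1 := Primrec.fst.comp Primrec.snd
  have hv : Primrec fun q : ℕ × ℕ × ℕ => q.2.2 := Primrec.snd.comp Primrec.snd
  cases o
  · exact primrec_cap.comp hB (Primrec.nat_add.comp hu hv)
  · exact Primrec.ite (Primrec.nat_le.comp hv hu) (primrec_cap.comp hB (Primrec.nat_sub.comp hu hv))
      (Primrec.const none)
  · exact primrec_cap.comp hB (Primrec.nat_mul.comp hu hv)
  · exact primrec_cap.comp hB (Primrec.nat_div.comp hu hv)
  · exact primrec_cap.comp hB (Primrec.nat_mod.comp hu hv)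
  · exact primrec_cap.comp hB (primrec_xor.comp hu hv)

section

variable {α : Type} [Primcodable α]

/-- The evaluation works on natural numbers with an explicit bound and never mentions the word size;
this is what lets a search test tables and strings once for all `w`. -/
theorem Expr.primrec_eval {B W M K x : α → ℕ} {tab : α → List ℕ} (hB : Primrec B) (hW : Primrec W)
    (ht : Primrec tab) (hM : Primrec M) (hK : Primrec K) (hx : Primrec x) (e : Expr) :
    Primrec fun a => e.eval (B a) (W a) (tab a) (M a) (K a) (x a) := by
  have h2 : ∀ {β : Type} [Primcodable β] {f : β → ℕ}, Primrec f → Primrec fun a => 2 ^ f a :=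
    fun hf => primrec_pow.comp (Primrec.const 2) hf
  induction e with
  | num n => exact primrec_cap.comp hB (Primrec.const n)
  | query => exact primrec_cap.comp hB hx
  | spill => exact primrec_cap.comp hB hK
  | bin o a b iha ihb =>
    refine Primrec.option_bind iha (Primrec.option_bind (ihb.comp Primrec.fst) ?_)
    exact o.primrec_eval.comp (Primrec.pair (hB.comp (Primrec.fst.comp Primrec.fst))
      (Primrec.pair (Primrec.snd.comp Primrec.fst) Primrec.snd))
  | look a iha =>
    refine Primrec.option_bind iha ?_
    exact Primrec.ite
      (Primrec.nat_lt.comp Primrec.snd (Primrec.list_length.comp (ht.comp Primrec.fst)))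
      (primrec_cap.comp (hB.comp Primrec.fst) (Primrec.nat_mod.comp
        ((Primrec.list_getD 0).comp (ht.comp Primrec.fst) Primrec.snd) (h2 (hW.comp Primrec.fst))))
      (Primrec.const none)
  | window a iha =>
    refine Primrec.option_bind iha ?_
    exact primrec_cap.comp (hB.comp Primrec.fst) (Primrec.nat_mod.comp
      (Primrec.nat_div.comp (hM.comp Primrec.fst) (h2 Primrec.snd)) (h2 (hW.comp Primrec.fst)))

theorem primrec_testBit : Primrec₂ Nat.testBit := by
  have : PrimrecRel fun a i : ℕ => a / 2 ^ i % 2 = 1 :=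
    Primrec.eq.comp (Primrec.nat_mod.comp (Primrec.nat_div.comp Primrec.fst
      (primrec_pow.comp (Primrec.const 2) Primrec.snd)) (Primrec.const 2)) (Primrec.const 1)
  refine this.decide.of_eq fun a i => ?_
  rw [Nat.testBit_eq_decide_div_mod_eq]

theorem primrec_bitList : Primrec₂ bitList :=
  Primrec.list_map (Primrec.list_range.comp Primrec.fst)
    (primrec_testBit.comp (Primrec.snd.comp Primrec.fst) Primrec.snd)

theorem primrec_choose : Primrec₂ Nat.choose := by
  have hf : Primrec Nat.factorial := by
    refine (Primrec.nat_rec₁ 1 (f := fun n r => (n + 1) * r)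
      (Primrec.nat_mul.comp (Primrec.succ.comp Primrec.fst) Primrec.snd)).of_eq fun n => ?_
    induction n with
    | zero => rfl
    | succ n ih => rw [Nat.factorial_succ, ← ih]
  refine (Primrec.ite (Primrec.nat_le.comp Primrec.snd Primrec.fst)
    (Primrec.nat_div.comp (hf.comp Primrec.fst) (Primrec.nat_mul.comp (hf.comp Primrec.snd)
      (hf.comp (Primrec.nat_sub.comp Primrec.fst Primrec.snd)))) (Primrec.const 0)).of_eq
    fun q => ?_
  split_ifs with h
  · exact (Nat.choose_eq_factorial_div_factorial h).symm
  · exact (Nat.choose_eq_zero_of_lt (not_le.1 h)).symm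

/-- Unbounded search for the least witness of a primitive recursive relation is computable. -/
theorem exists_computable_least {P : α → ℕ → Prop} (hP : PrimrecRel P) (hex : ∀ a, ∃ n, P a n) :
    ∃ f : α → ℕ, Computable f ∧ ∀ a, P a (f a) ∧ ∀ n, P a n → f a ≤ n := by
  obtain ⟨hd, hp⟩ := hP
  have hd' : ∀ a, DecidablePred (P a) := fun a n => hd (a, n)
  refine ⟨fun a => Nat.find (hex a), ?_, fun a => ⟨Nat.find_spec (hex a), fun n h =>
    Nat.find_min' (hex a) h⟩⟩
  have hpart : Partrec₂ fun (a : α) (n : ℕ) => (Part.some (decide (P a n)) : Part Bool) := by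
    refine Computable.partrec (f := fun q : α × ℕ => decide (P q.1 q.2)) ?_
    exact hp.to_comp.of_eq fun q => by congr
  refine (Partrec.rfind hpart).of_eq_tot fun a => ?_
  refine Nat.mem_rfind.2 ⟨?_, fun hm => ?_⟩
  · simpa using Nat.find_spec (hex a)
  · simpa using Nat.find_min (hex a) hm

end

/-- The elements below `V` of the set with characteristic number `n`. -/
def setList (V n : ℕ) : List ℕ := (List.range V).filter fun i => n.testBit i

theorem primrec_setList : Primrec₂ setList := by
  have h : Primrec fun q : ℕ × ℕ => (List.range q.1).filterMap
      fun i => bif q.2.testBit i then some i else none := by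
    refine Primrec.listFilterMap (Primrec.list_range.comp Primrec.fst) ?_
    exact Primrec.cond (primrec_testBit.comp (Primrec.snd.comp Primrec.fst) Primrec.snd)
      (Primrec.option_some.comp Primrec.snd) (Primrec.const none)
  refine h.of_eq fun q => ?_
  rw [setList, ← List.filterMap_eq_filter]
  congr 1
  funext i
  rw [Option.guard, cond_eq_ite]

/-- Numbering the subsets of `[V]` by `n < 2 ^ V` turns the quantifier over sets in `Good` into a
bounded one. -/
theorem exists_setList_eq {V : ℕ} {S : Finset ℕ} (hS : S ⊆ Finset.range V) :
    ∃ n < 2 ^ V, setList V n = S.sort (· ≤ ·) := by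
  classical
  refine ⟨Nat.ofBits fun i : Fin V => decide (i.1 ∈ S), Nat.ofBits_lt_two_pow _, ?_⟩
  set l := setList V (Nat.ofBits fun i : Fin V => decide (i.1 ∈ S)) with hl
  have hsort : l.Pairwise (· ≤ ·) :=
    ((List.pairwise_lt_range).imp (fun h => le_of_lt h)).sublist List.filter_sublist
  have hnodup : l.Nodup := List.nodup_range.filter _
  have hto : l.toFinset = S := by
    ext i
    simp only [hl, setList, List.mem_toFinset, List.mem_filter, List.mem_range]
    constructor
    · rintro ⟨h1, h2⟩
      rw [Nat.testBit_ofBits_lt _ _ h1] at h2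
      simpa using h2
    · intro h
      have h1 := Finset.mem_range.1 (hS h)
      refine ⟨h1, ?_⟩
      rw [Nat.testBit_ofBits_lt _ _ h1]
      simpa using h
  rw [← hto]
  exact ((List.toFinset_sort (· ≤ ·) hnodup).2 hsort).symm

/-- The number of entries of a list that are at most `x`. -/
def listRank (L : List ℕ) (x : ℕ) : ℕ := (L.filter (· ≤ x)).length

theorem primrec_listRank : Primrec₂ listRank :=
  Primrec.list_length.comp (PrimrecRel.listFilter Primrec.nat_le)

theorem listRank_sort (S : Finset ℕ) (x : ℕ) : listRank (S.sort (· ≤ ·)) x = rank S x := by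
  classical
  have h : ((S.sort (· ≤ ·)).filter (· ≤ x)).toFinset = S.filter (· ≤ x) := by
    ext i; simp
  rw [listRank, rank, ← h, List.toFinset_card_of_nodup ((Finset.sort_nodup S _).filter _)]

/-- The string number `k` of the shape with `ℓ` bits answers all rank queries on `L`. -/
def Answers (e : Expr) (u b κ V ℓ : ℕ) (tab : List ℕ) (L : List ℕ) (k : ℕ) : Prop :=
  ∀ x < V, e.eval (2 ^ (b * κ)) (u * κ) tab (k % 2 ^ ℓ) (k / 2 ^ ℓ) x = some (listRank L x)

/-- A shape and a table that serve the sets of size `m` in `[V]`. -/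
structure Good (e : Expr) (u b A N κ V m ℓ R : ℕ) (tab : List ℕ) : Prop where
  length_le : tab.length ≤ A * 2 ^ (4 * (κ / N))
  length_lt : tab.length * (u * κ) < 2 ^ (b * κ)
  valid : (ℓ = 0 ∧ 1 ≤ R ∧ R < 2 ^ κ) ∨ (2 ^ κ ≤ R ∧ R < 2 ^ (κ + 1))
  redundancy : 9 * (R * 2 ^ ℓ - V.choose m) ^ 2 * 2 ^ κ ≤ 4 * V.choose m ^ 2
  answers : ∀ n < 2 ^ V, (setList V n).length ≠ m ∨
    ∃ k < R * 2 ^ ℓ, Answers e u b κ V ℓ tab (setList V n) k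

theorem Good.iff {e : Expr} {u b A N κ V m ℓ R : ℕ} {tab : List ℕ} :
    Good e u b A N κ V m ℓ R tab ↔
      (tab.length ≤ A * 2 ^ (4 * (κ / N)) ∧ tab.length * (u * κ) < 2 ^ (b * κ)) ∧
      ((ℓ = 0 ∧ 1 ≤ R ∧ R < 2 ^ κ) ∨ (2 ^ κ ≤ R ∧ R < 2 ^ (κ + 1))) ∧
      9 * (R * 2 ^ ℓ - V.choose m) ^ 2 * 2 ^ κ ≤ 4 * V.choose m ^ 2 ∧
      ∀ n < 2 ^ V, (setList V n).length ≠ m ∨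
        ∃ k < R * 2 ^ ℓ, Answers e u b κ V ℓ tab (setList V n) k :=
  ⟨fun h => ⟨⟨h.1, h.2⟩, h.3, h.4, h.5⟩, fun h => ⟨h.1.1, h.1.2, h.2.1, h.2.2.1, h.2.2.2⟩⟩

section

variable {α : Type} [Primcodable α]

theorem primrecPred_forall_lt {f : α → ℕ} {P : ℕ → α → Prop} (hf : Primrec f)
    (hP : PrimrecRel P) : PrimrecPred fun a => ∀ n < f a, P n a :=
  ((PrimrecRel.forall_mem_list hP).comp (Primrec.list_range.comp hf) Primrec.id).of_eq
    fun a => by simp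

theorem primrecPred_exists_lt {f : α → ℕ} {P : ℕ → α → Prop} (hf : Primrec f)
    (hP : PrimrecRel P) : PrimrecPred fun a => ∃ n < f a, P n a :=
  ((PrimrecRel.exists_mem_list hP).comp (Primrec.list_range.comp hf) Primrec.id).of_eq
    fun a => by simp

theorem primrecPred_answers (e : Expr) (u b : ℕ) {κ V ℓ k : α → ℕ} {tab L : α → List ℕ}
    (hκ : Primrec κ) (hV : Primrec V) (hℓ : Primrec ℓ) (hk : Primrec k) (ht : Primrec tab)
    (hL : Primrec L) : PrimrecPred fun a => Answers e u b (κ a) (V a) (ℓ a) (tab a) (L a) (k a) := by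
  have h2 : Primrec fun a => 2 ^ ℓ a := primrec_pow.comp (Primrec.const 2) hℓ
  refine primrecPred_forall_lt hV (P := fun x a => e.eval (2 ^ (b * κ a)) (u * κ a) (tab a)
    (k a % 2 ^ ℓ a) (k a / 2 ^ ℓ a) x = some (listRank (L a) x)) ?_
  refine Primrec.eq.comp (e.primrec_eval (α := ℕ × α)
    (primrec_pow.comp (Primrec.const 2) (Primrec.nat_mul.comp (Primrec.const b) (hκ.comp Primrec.snd)))
    (Primrec.nat_mul.comp (Primrec.const u) (hκ.comp Primrec.snd)) (ht.comp Primrec.snd)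
    ((Primrec.nat_mod.comp hk h2).comp Primrec.snd) ((Primrec.nat_div.comp hk h2).comp Primrec.snd)
    Primrec.fst) ?_
  exact Primrec.option_some.comp (primrec_listRank.comp (hL.comp Primrec.snd) Primrec.fst)

/-- All quantifiers in `Good` are bounded: over sets, over strings of the shape, and over queries.
-/
theorem primrecPred_good (e : Expr) (u b A N : ℕ) {κ V m ℓ R : α → ℕ} {tab : α → List ℕ}
    (hκ : Primrec κ) (hV : Primrec V) (hm : Primrec m) (hℓ : Primrec ℓ) (hR : Primrec R)
    (ht : Primrec tab) :
    PrimrecPred fun a => Good e u b A N (κ a) (V a) (m a) (ℓ a) (R a) (tab a) := by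
  have h2 : ∀ {β : Type} [Primcodable β] {f : β → ℕ}, Primrec f → Primrec fun a => 2 ^ f a :=
    fun hf => primrec_pow.comp (Primrec.const 2) hf
  have hlen : Primrec fun a => (tab a).length := Primrec.list_length.comp ht
  have hcap : Primrec fun a => R a * 2 ^ ℓ a := Primrec.nat_mul.comp hR (h2 hℓ)
  have hch : Primrec fun a => (V a).choose (m a) := primrec_choose.comp hV hm
  refine PrimrecPred.of_eq ?_ fun a => Good.iff.symm
  refine PrimrecPred.and (PrimrecPred.and ?_ ?_) (PrimrecPred.and ?_ (PrimrecPred.and ?_ ?_))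
  · exact Primrec.nat_le.comp hlen (Primrec.nat_mul.comp (Primrec.const A) (h2
      (Primrec.nat_mul.comp (Primrec.const 4) (Primrec.nat_div.comp hκ (Primrec.const N)))))
  · exact Primrec.nat_lt.comp (Primrec.nat_mul.comp hlen (Primrec.nat_mul.comp (Primrec.const u) hκ))
      (h2 (Primrec.nat_mul.comp (Primrec.const b) hκ))
  · exact PrimrecPred.or (PrimrecPred.and (Primrec.eq.comp hℓ (Primrec.const 0))
      (PrimrecPred.and (Primrec.nat_le.comp (Primrec.const 1) hR) (Primrec.nat_lt.comp hR (h2 hκ))))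
      (PrimrecPred.and (Primrec.nat_le.comp (h2 hκ) hR)
        (Primrec.nat_lt.comp hR (h2 (Primrec.succ.comp hκ))))
  · exact Primrec.nat_le.comp (Primrec.nat_mul.comp (Primrec.nat_mul.comp (Primrec.const 9)
      (primrec_pow.comp (Primrec.nat_sub.comp hcap hch) (Primrec.const 2))) (h2 hκ))
      (Primrec.nat_mul.comp (Primrec.const 4) (primrec_pow.comp hch (Primrec.const 2)))
  · refine primrecPred_forall_lt (h2 hV) (P := fun n a => (setList (V a) n).length ≠ m a ∨
      ∃ k < R a * 2 ^ ℓ a, Answers e u b (κ a) (V a) (ℓ a) (tab a) (setList (V a) n) k) ?_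
    have hset : Primrec fun q : ℕ × α => setList (V q.2) q.1 :=
      primrec_setList.comp (hV.comp Primrec.snd) Primrec.fst
    refine PrimrecPred.or (PrimrecPred.not (Primrec.eq.comp (Primrec.list_length.comp hset)
      (hm.comp Primrec.snd))) ?_
    refine primrecPred_exists_lt (α := ℕ × α) (hcap.comp Primrec.snd) (P := fun k q =>
      Answers e u b (κ q.2) (V q.2) (ℓ q.2) (tab q.2) (setList (V q.2) q.1) k) ?_
    have hs : Primrec fun z : ℕ × ℕ × α => z.2.2 := Primrec.snd.comp Primrec.snd
    exact primrecPred_answers e u b (hκ.comp hs) (hV.comp hs) (hℓ.comp hs) Primrec.fst (ht.comp hs)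
      (hset.comp Primrec.snd)

end

end RankDS

/-! ## From good tables to the theorem -/

namespace RankDS

open WordRAM

/-- The hypothesis says, without square roots, that the relative excess of `R * 2 ^ ℓ` over `C` is
at most `(2 / 3) * 2 ^ (-κ / 2)`; truncated subtraction makes it void when there is no excess. The
claim follows from `log (1 + y) ≤ y` and `log 2 ≥ 2 / 3`. -/
theorem length_le_of_redundancy {κ ℓ R C : ℕ} (hR : 1 ≤ R) (hC : 1 ≤ C)
    (h : 9 * (R * 2 ^ ℓ - C) ^ 2 * 2 ^ κ ≤ 4 * C ^ 2) :
    (FracShape.mk ℓ R).length ≤ Real.logb 2 C + (2 : ℝ) ^ (-(κ : ℝ) / 2) := by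
  have hCpos : (0 : ℝ) < C := by exact_mod_cast hC
  have hRpos : (0 : ℝ) < R := by exact_mod_cast hR
  have hN : (FracShape.mk ℓ R).length = Real.logb 2 ((R * 2 ^ ℓ : ℕ) : ℝ) := by
    push_cast
    rw [FracShape.length, Real.logb_mul hRpos.ne' (by positivity), Real.logb_pow,
      Real.logb_self_eq_one (by norm_num)]
    simp only
    ring
  rw [hN]
  set N := R * 2 ^ ℓ with hNdef
  have hNpos : (0 : ℝ) < N := by
    have : 0 < N := Nat.mul_pos hR (by positivity)
    exact_mod_cast this
  set r : ℝ := (2 : ℝ) ^ (-(κ : ℝ) / 2) with hr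
  have hrpos : 0 < r := by positivity
  have hr2 : r ^ 2 * 2 ^ κ = 1 := by
    rw [hr, ← Real.rpow_natCast, ← Real.rpow_mul (by norm_num), ← Real.rpow_natCast,
      ← Real.rpow_add (by norm_num)]
    simp
  rcases le_total N C with hle | hle
  · have : Real.logb 2 N ≤ Real.logb 2 C :=
      Real.logb_le_logb_of_le (by norm_num) hNpos (by exact_mod_cast hle)
    linarith
  · have hreal : 9 * ((N : ℝ) - C) ^ 2 * 2 ^ κ ≤ 4 * C ^ 2 := by
      have h' : ((9 * (N - C) ^ 2 * 2 ^ κ : ℕ) : ℝ) ≤ ((4 * C ^ 2 : ℕ) : ℝ) := by exact_mod_cast h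
      push_cast [Nat.cast_sub hle] at h'
      exact h'
    have hsq : (3 * ((N : ℝ) - C)) ^ 2 ≤ (2 * C * r) ^ 2 := by
      have h1 := mul_le_mul_of_nonneg_right hreal (sq_nonneg r)
      have h2 : 9 * ((N : ℝ) - C) ^ 2 * 2 ^ κ * r ^ 2 = (3 * ((N : ℝ) - C)) ^ 2 * (r ^ 2 * 2 ^ κ) := by
        ring
      rw [h2, hr2] at h1
      linarith [h1, show (2 * C * r) ^ 2 = 4 * C ^ 2 * r ^ 2 by ring]
    have hlin : 3 * ((N : ℝ) - C) ≤ 2 * C * r := abs_le_of_sq_le_sq' hsq (by positivity) |>.2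
    have hdiv : (N : ℝ) = C * (1 + (N - C) / C) := by field_simp; ring
    have hy0 : (0 : ℝ) ≤ (N - C) / C := div_nonneg (by
      have : (C : ℝ) ≤ N := by exact_mod_cast hle
      linarith) hCpos.le
    have hy : ((N : ℝ) - C) / C ≤ 2 / 3 * r := by
      rw [div_le_iff₀ hCpos]; nlinarith
    rw [hdiv, Real.logb_mul hCpos.ne' (by positivity)]
    have hlog2 : (2 : ℝ) / 3 ≤ Real.log 2 := by have := Real.log_two_gt_d9; linarith
    have hlog : Real.logb 2 (1 + (N - C) / C) ≤ r := by
      rw [Real.logb, div_le_iff₀ (by linarith)]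
      have h1 : Real.log (1 + ((N : ℝ) - C) / C) ≤ (N - C) / C := by
        have := Real.log_le_sub_one_of_pos (show (0 : ℝ) < 1 + (N - C) / C by linarith)
        linarith
      nlinarith
    linarith

/-- The largest `m` allowed for `κ`, as a condition on natural numbers. -/
def Admissible (c κ V m : ℕ) : Prop :=
  2 ≤ κ ∧ V ≤ 2 ^ κ ∧ m ≤ V ∧ m * Nat.log 2 κ ≤ c * κ

theorem primrec_log_two : Primrec (Nat.log 2) := by
  refine (Primrec.nat_findGreatest (f := id) (p := fun n k => 2 ^ k ≤ n) Primrec.id ?_).of_eq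
    fun n => ?_
  · exact Primrec.nat_le.comp (primrec_pow.comp (Primrec.const 2) Primrec.snd) Primrec.fst
  · rcases Nat.eq_zero_or_pos n with rfl | hn
    · simp
    · refine le_antisymm ?_ ?_
      · refine Nat.le_log_of_pow_le (by norm_num) ?_
        exact Nat.findGreatest_spec (P := fun k => 2 ^ k ≤ n) (Nat.zero_le n)
          (by rw [pow_zero]; exact hn)
      · exact Nat.le_findGreatest (Nat.log_le_self 2 n) (Nat.pow_log_le_self 2 hn.ne')

/-- The triples are enumerated until a good one appears. Inadmissible parameters accept everything,
so that the search is total. -/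
theorem exists_computable_code (e : Expr) (c u b A N : ℕ)
    (hgood : ∀ κ V m : ℕ, Admissible c κ V m →
      ∃ (ℓ R : ℕ) (tab : List ℕ), Good e u b A N κ V m ℓ R tab) :
    ∃ code : ℕ × ℕ × ℕ → ℕ × ℕ × List ℕ, Computable code ∧ ∀ p, Admissible c p.1 p.2.1 p.2.2 →
      Good e u b A N p.1 p.2.1 p.2.2 (code p).1 (code p).2.1 (code p).2.2 := by
  have hcode : Primrec (Denumerable.ofNat (ℕ × ℕ × List ℕ)) := Primrec.ofNat _
  let P : (ℕ × ℕ × ℕ) → ℕ → Prop := fun p n => ¬ Admissible c p.1 p.2.1 p.2.2 ∨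
    Good e u b A N p.1 p.2.1 p.2.2 (Denumerable.ofNat (ℕ × ℕ × List ℕ) n).1
      (Denumerable.ofNat (ℕ × ℕ × List ℕ) n).2.1 (Denumerable.ofNat (ℕ × ℕ × List ℕ) n).2.2
  have hP : PrimrecRel P := by
    have k1 : Primrec fun q : (ℕ × ℕ × ℕ) × ℕ => q.1.1 := Primrec.fst.comp Primrec.fst
    have k2 : Primrec fun q : (ℕ × ℕ × ℕ) × ℕ => q.1.2.1 :=
      Primrec.fst.comp (Primrec.snd.comp Primrec.fst)
    have k3 : Primrec fun q : (ℕ × ℕ × ℕ) × ℕ => q.1.2.2 :=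
      Primrec.snd.comp (Primrec.snd.comp Primrec.fst)
    have k4 : Primrec fun q : (ℕ × ℕ × ℕ) × ℕ => Denumerable.ofNat (ℕ × ℕ × List ℕ) q.2 :=
      hcode.comp Primrec.snd
    have hlog := primrec_log_two
    refine PrimrecPred.or (PrimrecPred.not (PrimrecPred.and (Primrec.nat_le.comp (Primrec.const 2) k1)
      (PrimrecPred.and (Primrec.nat_le.comp k2 (primrec_pow.comp (Primrec.const 2) k1))
      (PrimrecPred.and (Primrec.nat_le.comp k3 k2) (Primrec.nat_le.comp
        (Primrec.nat_mul.comp k3 (hlog.comp k1)) (Primrec.nat_mul.comp (Primrec.const c) k1)))))) ?_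
    exact primrecPred_good e u b A N k1 k2 k3 (Primrec.fst.comp k4)
      (Primrec.fst.comp (Primrec.snd.comp k4)) (Primrec.snd.comp (Primrec.snd.comp k4))
  have hex : ∀ p, ∃ n, P p n := by
    intro p
    by_cases h : Admissible c p.1 p.2.1 p.2.2
    · obtain ⟨ℓ, R, tab, hg⟩ := hgood _ _ _ h
      refine ⟨Encodable.encode (ℓ, R, tab), Or.inr ?_⟩
      rw [Denumerable.ofNat_encode]
      exact hg
    · exact ⟨0, Or.inl h⟩
  obtain ⟨f, hf, hf'⟩ := exists_computable_least hP hex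
  refine ⟨fun p => Denumerable.ofNat _ (f p), hcode.to_comp.comp hf, fun p hp => ?_⟩
  exact (hf' p).1.resolve_left fun h => h hp

/-- The preprocessing takes the least string that answers all rank queries on the given list. It
need not be the string built in the existence proof; any correct one serves. -/
theorem exists_computable_prep (e : Expr) (u b : ℕ) {code : ℕ × ℕ × ℕ → ℕ × ℕ × List ℕ}
    (hcode : Computable code) :
    ∃ prep : ℕ × ℕ × ℕ × List ℕ → FracString, Computable prep ∧
      ∀ κ V m L, (∃ k < (code (κ, V, m)).2.1 * 2 ^ (code (κ, V, m)).1,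
          Answers e u b κ V (code (κ, V, m)).1 (code (κ, V, m)).2.2 L k) →
        ∃ k < (code (κ, V, m)).2.1 * 2 ^ (code (κ, V, m)).1,
          prep (κ, V, m, L) =
            (bitList (code (κ, V, m)).1 (k % 2 ^ (code (κ, V, m)).1), k / 2 ^ (code (κ, V, m)).1) ∧
          Answers e u b κ V (code (κ, V, m)).1 (code (κ, V, m)).2.2 L k := by
  -- Accepting every number outside the shape makes the search total. It does not affect the result
  -- when a correct string exists, since that one is smaller.
  let P : ((ℕ × ℕ × ℕ × List ℕ) × (ℕ × ℕ × List ℕ)) → ℕ → Prop := fun q k =>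
    q.2.2.1 * 2 ^ q.2.1 ≤ k ∨ Answers e u b q.1.1 q.1.2.1 q.2.1 q.2.2.2 q.1.2.2.2 k
  have hP : PrimrecRel P := by
    have j1 : Primrec fun z : ((ℕ × ℕ × ℕ × List ℕ) × (ℕ × ℕ × List ℕ)) × ℕ => z.1.1 :=
      Primrec.fst.comp Primrec.fst
    have j2 : Primrec fun z : ((ℕ × ℕ × ℕ × List ℕ) × (ℕ × ℕ × List ℕ)) × ℕ => z.1.2 :=
      Primrec.snd.comp Primrec.fst
    have jl : Primrec fun z : ((ℕ × ℕ × ℕ × List ℕ) × (ℕ × ℕ × List ℕ)) × ℕ => z.1.2.1 :=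
      Primrec.fst.comp j2
    refine PrimrecPred.or (Primrec.nat_le.comp (Primrec.nat_mul.comp
      (Primrec.fst.comp (Primrec.snd.comp j2)) (primrec_pow.comp (Primrec.const 2) jl)) Primrec.snd) ?_
    exact primrecPred_answers e u b (Primrec.fst.comp j1) (Primrec.fst.comp (Primrec.snd.comp j1))
      jl Primrec.snd (Primrec.snd.comp (Primrec.snd.comp j2))
      (Primrec.snd.comp (Primrec.snd.comp (Primrec.snd.comp j1)))
  obtain ⟨f, hf, hf'⟩ := exists_computable_least hP fun q => ⟨_, Or.inl le_rfl⟩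
  have hc : Computable fun p : ℕ × ℕ × ℕ × List ℕ => code (p.1, p.2.1, p.2.2.1) := by
    refine hcode.comp (Primrec.to_comp ?_)
    exact Primrec.pair Primrec.fst (Primrec.pair (Primrec.fst.comp Primrec.snd)
      (Primrec.fst.comp (Primrec.snd.comp Primrec.snd)))
  have hnum : Computable fun p : ℕ × ℕ × ℕ × List ℕ => f (p, code (p.1, p.2.1, p.2.2.1)) :=
    hf.comp (Computable.pair Computable.id hc)
  have hfin : Primrec fun z : ℕ × ℕ => (bitList z.1 (z.2 % 2 ^ z.1), z.2 / 2 ^ z.1) := by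
    have h2 : Primrec fun z : ℕ × ℕ => 2 ^ z.1 := primrec_pow.comp (Primrec.const 2) Primrec.fst
    exact Primrec.pair (primrec_bitList.comp Primrec.fst (Primrec.nat_mod.comp Primrec.snd h2))
      (Primrec.nat_div.comp Primrec.snd h2)
  refine ⟨_, hfin.to_comp.comp (Computable.pair (Computable.fst.comp hc) hnum), ?_⟩
  rintro κ V m L ⟨k, hk, hans⟩
  have hlt : f ((κ, V, m, L), code (κ, V, m)) < (code (κ, V, m)).2.1 * 2 ^ (code (κ, V, m)).1 :=
    lt_of_le_of_lt ((hf' ((κ, V, m, L), code (κ, V, m))).2 k (Or.inr hans)) hk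
  exact ⟨_, hlt, rfl, (hf' ((κ, V, m, L), code (κ, V, m))).1.resolve_left (not_le.2 hlt)⟩

theorem main_of_good {c ε : ℝ} (hε : 0 < ε) (cn N : ℕ) (hc : c ≤ cn) (hN : 1 ≤ N)
    (hNε : 8 ≤ ε * N) (e : Expr) (u b A : ℕ) (hu : 1 ≤ u) (hub : u ≤ b)
    (hgood : ∀ κ V m : ℕ, Admissible cn κ V m →
      ∃ (ℓ R : ℕ) (tab : List ℕ), Good e u b A N κ V m ℓ R tab) :
    ∃ (T b A : ℕ) (qAlgRankS : WordRAM.Program)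
      (prepRankS : ℕ × ℕ × ℕ × List ℕ → FracString)
      (shape : ℕ → ℕ → ℕ → FracShape)
      (tableRankS : ℕ → ℕ → ℕ → List Bool),
      Computable prepRankS ∧
      ∀ κ V m : ℕ, 2 ≤ κ → V ≤ 2 ^ κ → m ≤ V → (m : ℝ) ≤ c * κ / Real.logb 2 κ →
        ((tableRankS κ V m).length : ℝ) ≤ A * (2 : ℝ) ^ (ε * κ) ∧
        (shape κ V m).Valid κ ∧
        (shape κ V m).length ≤ Real.logb 2 (V.choose m) + (2 : ℝ) ^ (-(κ : ℝ) / 2) ∧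
        ∀ S : Finset ℕ, S ⊆ Finset.range V → S.card = m →
          FracString.HasShape (prepRankS (κ, V, m, S.sort (· ≤ ·))) (shape κ V m) ∧
          ∀ w x : ℕ, b * κ ≤ w → x < V →
            WordRAM.OutputsWithin qAlgRankS T
              (queryState w κ V m x (tableRankS κ V m) (prepRankS (κ, V, m, S.sort (· ≤ ·))))
              (rank S x) := by
  obtain ⟨code, hcode, hcode'⟩ := exists_computable_code e cn u b A N hgood
  obtain ⟨prep, hprep, hprep'⟩ := exists_computable_prep e u b hcode
  set D : ℝ := 2 / (ε * Real.log 2) with hD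
  have hlog2 : 0 < Real.log 2 := Real.log_pos (by norm_num)
  have hDpos : 0 < D := by positivity
  -- The summand `2` gives two spare bits: `b * κ + 2 ≤ w`, hence `4 * 2 ^ (b * κ) ≤ 2 ^ w`.
  refine ⟨(e.program u).length, b + 2, ⌈A * (u * D)⌉₊, e.program u, prep,
    fun κ V m => ⟨(code (κ, V, m)).1, (code (κ, V, m)).2.1⟩,
    fun κ V m => tableBits (u * κ) (code (κ, V, m)).2.2, hprep, ?_⟩
  intro κ V m hκ hV hm hmc
  have hκpos : (0 : ℝ) < κ := by positivity
  have hmn : m * Nat.log 2 κ ≤ cn * κ := by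
    have hlk : 1 ≤ Nat.log 2 κ := Nat.log_pos (by norm_num) hκ
    have h1 : (Nat.log 2 κ : ℝ) ≤ Real.logb 2 κ := by
      have := Real.natLog_le_logb κ 2
      exact_mod_cast this
    have h2 : (1 : ℝ) ≤ Nat.log 2 κ := by exact_mod_cast hlk
    rw [le_div_iff₀ (by linarith)] at hmc
    have h3 : (m : ℝ) * Nat.log 2 κ ≤ cn * κ :=
      (mul_le_mul_of_nonneg_left h1 (Nat.cast_nonneg m)).trans
        (hmc.trans (mul_le_mul_of_nonneg_right hc hκpos.le))
    exact_mod_cast h3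
  have hg := hcode' (κ, V, m) ⟨hκ, hV, hm, hmn⟩
  simp only at hg
  set ℓ := (code (κ, V, m)).1 with hℓ
  set R := (code (κ, V, m)).2.1 with hR
  set tab := (code (κ, V, m)).2.2 with htab
  have hR1 : 1 ≤ R := by
    rcases hg.valid with h | h
    · exact h.2.1
    · exact le_trans Nat.one_le_two_pow h.1
  refine ⟨?_, hg.valid, length_le_of_redundancy hR1 (Nat.choose_pos hm) hg.redundancy, ?_⟩
  · have h1 : ((tableBits (u * κ) tab).length : ℝ) ≤ A * 2 ^ (4 * (κ / N)) * (u * κ) := by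
      rw [length_tableBits]
      exact_mod_cast Nat.mul_le_mul_right _ hg.length_le
    have h2 : (2 : ℝ) ^ (4 * (κ / N)) ≤ (2 : ℝ) ^ (ε / 2 * κ) := by
      rw [← Real.rpow_natCast]
      refine Real.rpow_le_rpow_of_exponent_le (by norm_num) ?_
      have h3 : ((κ / N : ℕ) : ℝ) ≤ κ / N := Nat.cast_div_le
      have hNpos : (0 : ℝ) < N := by exact_mod_cast hN
      have h4 : (κ : ℝ) / N ≤ ε * κ / 8 := by
        rw [div_le_iff₀ hNpos]; nlinarith
      push_cast
      linarith
    -- The number of entries uses half of the exponent `ε * κ`; the other half absorbs the width `u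
    -- * κ` of an entry.
    have h3 : (κ : ℝ) ≤ D * (2 : ℝ) ^ (ε / 2 * κ) := by
      have h4 : ε / 2 * κ * Real.log 2 ≤ (2 : ℝ) ^ (ε / 2 * κ) := by
        rw [Real.rpow_def_of_pos (by norm_num)]
        have := Real.add_one_le_exp (Real.log 2 * (ε / 2 * κ))
        linarith
      calc (κ : ℝ) = D * (ε / 2 * κ * Real.log 2) := by rw [hD]; field_simp
        _ ≤ _ := mul_le_mul_of_nonneg_left h4 hDpos.le
    have h5 : (2 : ℝ) ^ (ε / 2 * κ) * (2 : ℝ) ^ (ε / 2 * κ) = (2 : ℝ) ^ (ε * κ) := by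
      rw [← Real.rpow_add (by norm_num)]; congr 1; ring
    calc ((tableBits (u * κ) tab).length : ℝ) ≤ A * 2 ^ (4 * (κ / N)) * (u * κ) := h1
      _ ≤ A * (2 : ℝ) ^ (ε / 2 * κ) * (u * (D * (2 : ℝ) ^ (ε / 2 * κ))) := by gcongr
      _ = A * (u * D) * ((2 : ℝ) ^ (ε / 2 * κ) * (2 : ℝ) ^ (ε / 2 * κ)) := by ring
      _ = A * (u * D) * (2 : ℝ) ^ (ε * κ) := by rw [h5]
      _ ≤ ⌈A * (u * D)⌉₊ * (2 : ℝ) ^ (ε * κ) := by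
        gcongr
        exact Nat.le_ceil _
  · intro S hS hcard
    set L := S.sort (· ≤ ·) with hL
    obtain ⟨n, hn, hnL⟩ := exists_setList_eq hS
    obtain ⟨k0, hk0, hans0⟩ : ∃ k < R * 2 ^ ℓ, Answers e u b κ V ℓ tab L k := by
      rcases hg.answers n hn with h | h
      · rw [hnL] at h
        simp [hcard] at h
      · rwa [hnL] at h
    obtain ⟨k, hk, hkp, hans⟩ := hprep' κ V m L ⟨k0, hk0, hans0⟩
    rw [hkp]
    refine ⟨⟨length_bitList _ _, ?_⟩, ?_⟩
    · exact Nat.div_lt_of_lt_mul (by rw [Nat.mul_comm]; exact hk)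
    · intro w x hw hx
      have hbk : b * κ + 2 ≤ w := by nlinarith
      rw [← listRank_sort]
      have hB : 4 * 2 ^ (b * κ) ≤ 2 ^ w :=
        calc 4 * 2 ^ (b * κ) = 2 ^ (b * κ + 2) := by rw [pow_add]; ring
          _ ≤ 2 ^ w := Nat.pow_le_pow_right (by norm_num) hbk
      have hκb : κ ≤ b * κ := Nat.le_mul_of_pos_left κ (by omega)
      exact e.outputsWithin V m _ (by omega) hu ((Nat.mul_le_mul_right κ hub).trans (by omega)) hB
        hg.length_lt (Nat.mod_lt _ (by positivity))
        (lt_of_lt_of_le hx (hV.trans (Nat.pow_le_pow_right (by norm_num) hκb))) (hans x hx)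

end RankDS

/-! ## Ranks from the positions where consecutive elements differ -/

namespace RankDS

/-- `a < b`, and `d` is the most significant bit in which they differ. -/
def SplitAt (a b d : ℕ) : Prop :=
  a.testBit d = false ∧ b.testBit d = true ∧ ∀ e, d < e → a.testBit e = b.testBit e

theorem SplitAt.lt {a b d : ℕ} (h : SplitAt a b d) : a < b :=
  Nat.lt_of_testBit d h.1 h.2.1 h.2.2

theorem testBit_eq_false_of_size_le {n i : ℕ} (h : n.size ≤ i) : n.testBit i = false :=
  Nat.testBit_lt_two_pow (Nat.size_le.1 h)

theorem size_eq_of_testBit {n d : ℕ} (h1 : n.testBit d = true)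
    (h2 : ∀ e, d < e → n.testBit e = false) : n.size = d + 1 := by
  refine le_antisymm (Nat.size_le.2 (Nat.lt_pow_two_of_testBit _ fun i hi => h2 i hi)) ?_
  by_contra h
  rw [testBit_eq_false_of_size_le (by omega)] at h1
  exact Bool.noConfusion h1

theorem SplitAt.size {a b d : ℕ} (h : SplitAt a b d) : (a ^^^ b).size = d + 1 := by
  refine size_eq_of_testBit ?_ fun e he => ?_
  · simp [Nat.testBit_xor, h.1, h.2.1]
  · simp [Nat.testBit_xor, h.2.2 e he]

theorem testBit_size_pred {n : ℕ} (h : n ≠ 0) : n.testBit (n.size - 1) = true := by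
  obtain ⟨i, hi, hi'⟩ := Nat.exists_most_significant_bit h
  rw [size_eq_of_testBit hi hi']
  exact hi

theorem xor_ne_zero {a b : ℕ} (h : a ≠ b) : a ^^^ b ≠ 0 := by
  intro h0
  exact h (Nat.xor_eq_zero_iff.1 h0)

theorem testBit_eq_of_size_xor_le {a b e : ℕ} (h : (a ^^^ b).size ≤ e) :
    a.testBit e = b.testBit e := by
  have := testBit_eq_false_of_size_le h
  rw [Nat.testBit_xor] at this
  simpa using this

theorem splitAt_of_lt {a b : ℕ} (h : a < b) : SplitAt a b ((a ^^^ b).size - 1) := by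
  have hne := xor_ne_zero h.ne
  have h1 := testBit_size_pred hne
  have hpos : 0 < (a ^^^ b).size := Nat.size_pos.2 (Nat.pos_of_ne_zero hne)
  have h2 : ∀ e, (a ^^^ b).size - 1 < e → a.testBit e = b.testBit e :=
    fun e he => testBit_eq_of_size_xor_le (by omega)
  rw [Nat.testBit_xor] at h1
  set d := (a ^^^ b).size - 1
  cases ha : a.testBit d <;> cases hb : b.testBit d <;> simp [ha, hb] at h1
  · exact ⟨ha, hb, h2⟩
  · exact absurd (Nat.lt_of_testBit d hb ha fun e he => (h2 e he).symm) (not_lt.2 h.le)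

/-- The two splitting positions differ, because `b` has the bit `1` at the first and `0` at the
second. The higher one then decides between `a` and `c`. -/
theorem size_xor_of_lt_of_lt {a b c : ℕ} (hab : a < b) (hbc : b < c) :
    (a ^^^ c).size = max (a ^^^ b).size (b ^^^ c).size := by
  have h1 := splitAt_of_lt hab
  have h2 := splitAt_of_lt hbc
  have e1 := h1.size
  have e2 := h2.size
  set d := (a ^^^ b).size - 1
  set d' := (b ^^^ c).size - 1
  rcases lt_trichotomy d d' with h | h | h
  · rw [e1, e2, max_eq_right (by omega)]
    exact SplitAt.size ⟨by rw [h1.2.2 _ h, h2.1], h2.2.1,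
      fun e he => by rw [h1.2.2 e (by omega), h2.2.2 e he]⟩
  · have := h1.2.1
    rw [h, h2.1] at this
    exact Bool.noConfusion this
  · rw [e1, e2, max_eq_left (by omega)]
    exact SplitAt.size ⟨h1.1, by rw [← h2.2.2 _ h, h1.2.1],
      fun e he => by rw [h1.2.2 e he, h2.2.2 e (by omega)]⟩

theorem xor_lt_of_splitAt {a b d x : ℕ} (hd : ∀ e, d < e → a.testBit e = b.testBit e)
    (hne : a.testBit d ≠ b.testBit d) (hx : x.testBit d = b.testBit d) : x ^^^ b < x ^^^ a := by
  refine Nat.lt_of_testBit d ?_ ?_ fun e he => ?_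
  · simp [hx]
  · rw [Nat.testBit_xor, hx]
    cases h1 : a.testBit d <;> cases h2 : b.testBit d <;> simp_all
  · simp [hd e he]

section Blind

variable (D : ℕ → ℕ)

/-- The largest of the values `D l` for `l` between `i` and `k`. -/
def maxBetween (i k : ℕ) : ℕ := (Finset.Ico (min i k) (max i k)).sup D

/-- The sketch `sk`, whose bit `l - lo` tells which way to go at position `D l - 1`, leads to the
element number `i`. -/
def LeadsTo (lo hi sk i : ℕ) : Prop :=
  ∀ k ∈ Finset.Ico lo hi, k ≠ i → ∀ l ∈ Finset.Ico (min i k) (max i k),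
    D l = maxBetween D i k → sk.testBit (l - lo) = decide (k < i)

/-- The rank of a query among the elements `lo, …, hi - 1`, when it differs from the element `i`
in bit `e - 1` first (not at all if `e = 0`), and `lt` tells whether it is smaller. -/
def localRank (lo hi i e : ℕ) (lt : Bool) : ℕ :=
  ((Finset.Ico lo hi).filter fun k =>
    if k ≠ i ∧ e < maxBetween D i k then k < i else lt = false).card

end Blind

section

variable {s D : ℕ → ℕ} {lo hi : ℕ}

theorem maxBetween_eq (hs : ∀ l, lo ≤ l → l + 1 < hi → s l < s (l + 1))
    (hD : ∀ l, lo ≤ l → l + 1 < hi → D l = (s l ^^^ s (l + 1)).size) {i k : ℕ} (hi' : lo ≤ i)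
    (hik : i < k) (hk : k < hi) : s i < s k ∧ (Finset.Ico i k).sup D = (s i ^^^ s k).size := by
  induction k, hik using Nat.le_induction with
  | base => exact ⟨hs i hi' hk, by rw [← hD i hi' hk]; simp⟩
  | succ k hik ih =>
    obtain ⟨h1, h2⟩ := ih (by omega)
    have h3 := hs k (by omega) hk
    refine ⟨h1.trans h3, ?_⟩
    have : Finset.Ico i (k + 1) = insert k (Finset.Ico i k) := by
      ext j; simp only [Finset.mem_Ico, Finset.mem_insert]; omega
    rw [this, Finset.sup_insert, h2, hD k (by omega) hk, size_xor_of_lt_of_lt h1 h3]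
    exact max_comm _ _

theorem maxBetween_spec (hs : ∀ l, lo ≤ l → l + 1 < hi → s l < s (l + 1))
    (hD : ∀ l, lo ≤ l → l + 1 < hi → D l = (s l ^^^ s (l + 1)).size) {i k : ℕ}
    (hi' : i ∈ Finset.Ico lo hi) (hk : k ∈ Finset.Ico lo hi) (hne : k ≠ i) :
    ∃ d, maxBetween D i k = d + 1 ∧ (s i).testBit d = decide (k < i) ∧
      (s k).testBit d = !decide (k < i) ∧ ∀ e, d < e → (s i).testBit e = (s k).testBit e := by
  rw [Finset.mem_Ico] at hi' hk
  rcases lt_or_gt_of_ne hne with h | h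
  · obtain ⟨h1, h2⟩ := maxBetween_eq hs hD hk.1 h hi'.2
    have h3 := splitAt_of_lt h1
    refine ⟨_, ?_, ?_, ?_, fun e he => (h3.2.2 e he).symm⟩
    · rw [maxBetween, min_eq_right h.le, max_eq_left h.le, h2]; exact h3.size
    · simpa [h] using h3.2.1
    · simpa [h] using h3.1
  · obtain ⟨h1, h2⟩ := maxBetween_eq hs hD hi'.1 h hk.2
    have h3 := splitAt_of_lt h1
    have h4 : ¬ k < i := by omega
    refine ⟨_, ?_, ?_, ?_, fun e he => h3.2.2 e he⟩
    · rw [maxBetween, min_eq_left h.le, max_eq_right h.le, h2]; exact h3.size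
    · simpa [h4] using h3.1
    · simpa [h4] using h3.2.1

/-- Take the element with the least `x ^^^ s i`. If `x` disagreed with it at the bit where it splits
from `s k`, then `s k` would be nearer by `xor_lt_of_splitAt`. -/
theorem exists_leadsTo (hs : ∀ l, lo ≤ l → l + 1 < hi → s l < s (l + 1))
    (hD : ∀ l, lo ≤ l → l + 1 < hi → D l = (s l ^^^ s (l + 1)).size) (hlt : lo < hi) {x sk : ℕ}
    (hsk : ∀ l, lo ≤ l → l + 1 < hi → sk.testBit (l - lo) = x.testBit (D l - 1)) :
    ∃ i ∈ Finset.Ico lo hi, LeadsTo D lo hi sk i := by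
  obtain ⟨i, hi', hmin⟩ := Finset.exists_min_image (Finset.Ico lo hi)
    (fun i => x ^^^ s i) ⟨lo, by simpa using hlt⟩
  refine ⟨i, hi', fun k hk hne l hl hDl => ?_⟩
  obtain ⟨d, h1, h2, h3, h4⟩ := maxBetween_spec hs hD hi' hk hne
  rw [Finset.mem_Ico] at hi' hk hl
  have hl1 : lo ≤ l ∧ l + 1 < hi := by omega
  rw [hsk l hl1.1 hl1.2, hDl, h1, Nat.add_sub_cancel, ← h2]
  by_contra hx
  have hx' : x.testBit d = (s k).testBit d := by
    rw [h3]; rw [h2] at hx; cases hxd : x.testBit d <;> simp_all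
  refine absurd (hmin k (Finset.mem_Ico.2 hk)) (not_le.2 (xor_lt_of_splitAt h4 ?_ hx'))
  rw [h2, h3]; cases decide (k < i) <;> simp

/-- Any `i` to which the sketch leads will do. Let `d` be the bit where `s i` and `s k` split. If
`x` agrees with `s i` from `d` upwards, then `s k` compares with `x` as it does with `s i`.
Otherwise `x` leaves `s i` strictly above `d`, since at `d` itself the sketch forces agreement;
there `s k` still equals `s i`, so `x` compares with both in the same way. -/
theorem localRank_eq (hs : ∀ l, lo ≤ l → l + 1 < hi → s l < s (l + 1))
    (hD : ∀ l, lo ≤ l → l + 1 < hi → D l = (s l ^^^ s (l + 1)).size) {x sk i : ℕ}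
    (hsk : ∀ l, lo ≤ l → l + 1 < hi → sk.testBit (l - lo) = x.testBit (D l - 1))
    (hi' : i ∈ Finset.Ico lo hi) (hlead : LeadsTo D lo hi sk i) :
    localRank D lo hi i (x ^^^ s i).size (decide (x < s i)) =
      ((Finset.Ico lo hi).filter fun k => s k ≤ x).card := by
  rw [localRank]
  congr 1
  refine Finset.filter_congr fun k hk => ?_
  by_cases hne : k = i
  · subst hne
    simp
  obtain ⟨d, h1, h2, h3, h4⟩ := maxBetween_spec hs hD hi' hk hne
  have hxd : x.testBit d = decide (k < i) := by
    have hnonempty : (Finset.Ico (min i k) (max i k)).Nonempty := by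
      rw [Finset.nonempty_Ico]; omega
    obtain ⟨l, hl, hDl⟩ := Finset.exists_mem_eq_sup _ hnonempty D
    have := hlead k hk hne l hl hDl.symm
    rw [Finset.mem_Ico] at hi' hk hl
    rw [hsk l (by omega) (by omega), show D l = d + 1 by rw [← hDl]; exact h1,
      Nat.add_sub_cancel] at this
    exact this
  set e := (x ^^^ s i).size with he
  by_cases hlt : e < maxBetween D i k
  · have hag : ∀ j, d < j → x.testBit j = (s k).testBit j := fun j hj => by
      rw [← h4 j hj]; exact testBit_eq_of_size_xor_le (by omega)
    simp only [ne_eq, hne, not_false_eq_true, hlt, and_self, if_true]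
    by_cases hki : k < i
    · have : s k < x := Nat.lt_of_testBit d (by simp [h3, hki]) (by simp [hxd, hki])
        fun j hj => (hag j hj).symm
      simp [hki, this.le]
    · have : x < s k := Nat.lt_of_testBit d (by simp [hxd, hki]) (by simp [h3, hki]) hag
      simp [hki, this]
  · simp only [hlt, and_false, if_false]
    have hxs : x ≠ s i := by
      rintro rfl
      simp [he] at hlt
      omega
    have hbit : x.testBit (e - 1) ≠ (s i).testBit (e - 1) := by
      have := testBit_size_pred (xor_ne_zero hxs)
      rw [Nat.testBit_xor] at this
      intro h
      rw [← he, h] at this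
      simp at this
    have hed : d < e - 1 := by
      rcases Nat.lt_or_ge d (e - 1) with h | h
      · exact h
      · have : e - 1 = d := by omega
        rw [this, hxd, h2] at hbit
        exact absurd rfl hbit
    have hag : ∀ j, e - 1 < j → x.testBit j = (s i).testBit j :=
      fun j hj => testBit_eq_of_size_xor_le (by omega)
    have hk' : ∀ j, e - 1 ≤ j → (s i).testBit j = (s k).testBit j := fun j hj => h4 j (by omega)
    rcases lt_or_gt_of_ne hxs with h | h
    · have hsp := splitAt_of_lt h
      rw [← he] at hsp
      have : x < s k := Nat.lt_of_testBit (e - 1) hsp.1 (by rw [← hk' _ le_rfl]; exact hsp.2.1)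
        fun j hj => by rw [hag j hj, hk' j hj.le]
      simp [h, this]
    · have hsp := splitAt_of_lt h
      rw [Nat.xor_comm, ← he] at hsp
      have : s k < x := Nat.lt_of_testBit (e - 1) (by rw [← hk' _ le_rfl]; exact hsp.1) hsp.2.1
        fun j hj => by rw [hag j hj, hk' j hj.le]
      simp [h.le, this.le]

end

end RankDS

/-! ## Exclusive sums over digits, digit automata, and expressions for them -/

namespace RankDS

/-- `f 0 ^^^ f 1 ^^^ ⋯ ^^^ f (n - 1)`. -/
def xorSum (f : ℕ → ℕ) : ℕ → ℕ
  | 0 => 0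
  | n + 1 => xorSum f n ^^^ f n

theorem xorSum_congr {f g : ℕ → ℕ} : ∀ {n : ℕ}, (∀ j < n, f j = g j) → xorSum f n = xorSum g n
  | 0, _ => rfl
  | n + 1, h => by
    rw [xorSum, xorSum, xorSum_congr fun j hj => h j (by omega), h n (by omega)]

theorem xorSum_lt {f : ℕ → ℕ} {b : ℕ} : ∀ {n : ℕ}, (∀ j < n, f j < 2 ^ b) → xorSum f n < 2 ^ b
  | 0, _ => by simp [xorSum]
  | n + 1, h => Nat.xor_lt_two_pow (xorSum_lt fun j hj => h j (by omega)) (h n (by omega))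

/-- Maps that commute with exclusive or. -/
def XorLinear (f : ℕ → ℕ) : Prop := ∀ a b, f (a ^^^ b) = f a ^^^ f b

theorem XorLinear.map_zero {f : ℕ → ℕ} (hf : XorLinear f) : f 0 = 0 := by
  have := hf 0 0
  simpa using this

theorem split_xor (y n : ℕ) : y = (y % 2 ^ n) ^^^ (y / 2 ^ n * 2 ^ n) := by
  apply Nat.eq_of_testBit_eq
  intro i
  rw [Nat.testBit_xor, Nat.testBit_mod_two_pow, Nat.mul_comm, Nat.testBit_two_pow_mul,
    Nat.testBit_div_two_pow]
  by_cases h : i < n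
  · simp [h, not_le.2 h]
  · simp [h, Nat.sub_add_cancel (not_lt.1 h), not_lt.1 h]

/-- A linear map is the exclusive sum of its values on the digits in base `2 ^ q`. -/
theorem XorLinear.eq_xorSum {f : ℕ → ℕ} (hf : XorLinear f) (q : ℕ) :
    ∀ (J y : ℕ), y < 2 ^ (q * J) →
      f y = xorSum (fun j => f (y / (2 ^ q) ^ j % 2 ^ q * (2 ^ q) ^ j)) J := by
  intro J
  induction J with
  | zero => intro y hy; simp at hy; subst hy; simpa [xorSum] using hf.map_zero
  | succ J ih =>
    intro y hy
    have hlt : y / 2 ^ (q * J) < 2 ^ q := by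
      rw [Nat.div_lt_iff_lt_mul (by positivity), ← pow_add]
      rwa [Nat.mul_succ, Nat.add_comm] at hy
    conv_lhs => rw [split_xor y (q * J), hf, ih _ (Nat.mod_lt _ (by positivity))]
    rw [xorSum, ← pow_mul, Nat.mod_eq_of_lt hlt]
    congr 1
    refine xorSum_congr fun j hj => ?_
    congr 2
    rw [← pow_mul]
    apply Nat.eq_of_testBit_eq
    intro i
    simp only [Nat.testBit_mod_two_pow, Nat.testBit_div_two_pow]
    by_cases hi : i < q
    · have : i + q * j < q * J := by
        have := Nat.mul_le_mul_left q hj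
        rw [Nat.mul_succ] at this
        omega
      simp [this]
    · simp [hi]

/-- Run an automaton over the digits of `y` in base `Q`, from the most significant one of `J`;
`step j st d` reads the digit `d` of index `j`. -/
def automaton (step : ℕ → ℕ → ℕ → ℕ) (Q J y init : ℕ) : ℕ → ℕ
  | 0 => init
  | n + 1 => step (J - 1 - n) (automaton step Q J y init n) (y / Q ^ (J - 1 - n) % Q)

/-- `φ j y` is a summary of the prefix `y` when `j` digits remain. The automaton computes it
whenever the summary of a prefix and the next digit determine the next summary. -/
theorem automaton_eq {φ : ℕ → ℕ → ℕ} {stepf : ℕ → ℕ → ℕ → ℕ} {Q J y init : ℕ} (hQ : 0 < Q)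
    (hy : y < Q ^ J) (hinit : init = φ J 0)
    (hstep : ∀ j y' d, d < Q → stepf j (φ (j + 1) y') d = φ j (y' * Q + d)) :
    ∀ n ≤ J, automaton stepf Q J y init n = φ (J - n) (y / Q ^ (J - n)) := by
  intro n
  induction n with
  | zero => intro _; simp [automaton, hinit, Nat.div_eq_of_lt hy]
  | succ n ih =>
    intro hn
    have e1 : J - n = J - 1 - n + 1 := by omega
    have e2 : J - (n + 1) = J - 1 - n := by omega
    rw [automaton, ih (by omega), e1, hstep _ _ _ (Nat.mod_lt _ hQ), e2, pow_succ,
      ← Nat.div_div_eq_div_mul, Nat.div_add_mod']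

/-! ### Bit lengths, digit by digit -/

section SizeAutomaton

/-- The transition of the automaton that computes the length of a number. -/
def sizeStep (q st d : ℕ) : ℕ := if st = 0 then d.size else st + q

theorem sizeStep_eq (q y d : ℕ) (hd : d < 2 ^ q) :
    sizeStep q y.size d = (y * 2 ^ q + d).size := by
  unfold sizeStep
  split_ifs with h
  · rw [Nat.size_eq_zero] at h
    simp [h]
  · have hy : y ≠ 0 := by rintro rfl; simp at h
    have hpos : 0 < y.size := Nat.pos_of_ne_zero h
    have h1 : y < 2 ^ y.size := Nat.lt_size_self y
    have h2 : 2 ^ (y.size - 1) ≤ y := Nat.lt_size.1 (by omega)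
    refine le_antisymm ?_ (Nat.size_le.2 ?_)
    · have : y.size + q - 1 < (y * 2 ^ q + d).size := by
        rw [Nat.lt_size, show y.size + q - 1 = (y.size - 1) + q by omega, pow_add]
        exact (Nat.mul_le_mul_right _ h2).trans (Nat.le_add_right _ _)
      omega
    · rw [pow_add]
      calc y * 2 ^ q + d < (y + 1) * 2 ^ q := by rw [Nat.succ_mul]; omega
        _ ≤ _ := Nat.mul_le_mul_right _ h1

end SizeAutomaton

/-! ### Predecessor search among the starts of the types -/

section Predecessor

variable (start : ℕ → ℕ) (τ Q : ℕ)

open Classical in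
/-- The state of the predecessor automaton when the digits read so far form `y` and `j` digits are
left: the number of keys with a smaller prefix, and whether some key has the prefix `y`. -/
noncomputable def predState (j y : ℕ) : ℕ :=
  2 * ((Finset.range τ).filter fun t => start t / Q ^ j < y).card +
    if ∃ t < τ, start t / Q ^ j = y then 1 else 0

-- The transition decodes the state to some prefix `y` that has it; by `predState_congr` the choice
-- of `y` is immaterial. States that do not occur are sent to `0`.
open Classical in
noncomputable def predStep (j st d : ℕ) : ℕ :=
  if h : ∃ y, predState start τ Q (j + 1) y = st then predState start τ Q j (h.choose * Q + d) else 0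

theorem predState_lt (j y : ℕ) : predState start τ Q j y < 2 * τ + 2 := by
  have := Finset.card_filter_le (Finset.range τ) fun t => start t / Q ^ j < y
  rw [Finset.card_range] at this
  unfold predState
  split_ifs <;> omega

variable {start τ Q}

/-- An odd state means that `y` is a prefix of a key, and then the number of keys with smaller
prefixes determines `y`. In an even state no key has the prefix `y`, so further digits change
neither the count nor the parity. -/
theorem predState_congr (hQ : 0 < Q) {j y y' d : ℕ} (hd : d < Q)
    (h : predState start τ Q (j + 1) y = predState start τ Q (j + 1) y') :
    predState start τ Q j (y * Q + d) = predState start τ Q j (y' * Q + d) := by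
  classical
  have hdiv : ∀ t, start t / Q ^ (j + 1) = start t / Q ^ j / Q := fun t => by
    rw [pow_succ, Nat.div_div_eq_div_mul]
  by_cases hy : ∃ t < τ, start t / Q ^ (j + 1) = y
  · have hy' : ∃ t < τ, start t / Q ^ (j + 1) = y' := by
      by_contra hy'
      simp only [predState, hy, hy', if_true, if_false] at h
      omega
    have hcard : ((Finset.range τ).filter fun t => start t / Q ^ (j + 1) < y).card =
        ((Finset.range τ).filter fun t => start t / Q ^ (j + 1) < y').card := by
      simp only [predState, hy, hy', if_true] at h
      omega
    have key : ∀ a b : ℕ, (∃ t < τ, start t / Q ^ (j + 1) = a) → a < b →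
        ((Finset.range τ).filter fun t => start t / Q ^ (j + 1) < a).card <
          ((Finset.range τ).filter fun t => start t / Q ^ (j + 1) < b).card := by
      rintro a b ⟨t, ht, hta⟩ hab
      refine Finset.card_lt_card ⟨fun r hr => ?_, fun hsub => ?_⟩
      · rw [Finset.mem_filter] at hr ⊢
        exact ⟨hr.1, hr.2.trans hab⟩
      · have := hsub (Finset.mem_filter.2 ⟨Finset.mem_range.2 ht, by rw [hta]; exact hab⟩)
        rw [Finset.mem_filter, hta] at this
        exact lt_irrefl _ this.2
    rcases lt_trichotomy y y' with hlt | heq | hlt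
    · exact absurd hcard (key _ _ hy hlt).ne
    · rw [heq]
    · exact absurd hcard (key _ _ hy' hlt).ne'
  · have hy' : ¬ ∃ t < τ, start t / Q ^ (j + 1) = y' := by
      intro hy'
      simp only [predState, hy, hy', if_true, if_false] at h
      omega
    have key : ∀ a : ℕ, (¬ ∃ t < τ, start t / Q ^ (j + 1) = a) →
        predState start τ Q j (a * Q + d) = predState start τ Q (j + 1) a := by
      intro a ha
      have h1 : ∀ t < τ, (start t / Q ^ j < a * Q + d ↔ start t / Q ^ (j + 1) < a) := by
        intro t ht
        have hne : start t / Q ^ (j + 1) ≠ a := fun h => ha ⟨t, ht, h⟩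
        rw [hdiv] at hne ⊢
        generalize start t / Q ^ j = v at hne ⊢
        have hv := Nat.div_add_mod v Q
        have hm := Nat.mod_lt v hQ
        rw [Nat.mul_comm] at hv
        constructor
        · intro hlt
          by_contra hge
          have : a + 1 ≤ v / Q := by omega
          have := Nat.mul_le_mul_right Q this
          rw [Nat.succ_mul] at this
          omega
        · intro hlt
          have := Nat.mul_le_mul_right Q (show v / Q + 1 ≤ a from hlt)
          rw [Nat.succ_mul] at this
          omega
      have h2 : ¬ ∃ t < τ, start t / Q ^ j = a * Q + d := by
        rintro ⟨t, ht, hta⟩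
        refine ha ⟨t, ht, ?_⟩
        rw [hdiv, hta, Nat.mul_comm, Nat.mul_add_div hQ, Nat.div_eq_of_lt hd, Nat.add_zero]
      simp only [predState, ha, h2, if_false]
      rw [Finset.filter_congr fun t ht => h1 t (Finset.mem_range.1 ht)]
    rw [key y hy, key y' hy', h]

theorem predStep_eq (hQ : 0 < Q) (j y d : ℕ) (hd : d < Q) :
    predStep start τ Q j (predState start τ Q (j + 1) y) d = predState start τ Q j (y * Q + d) := by
  classical
  have h : ∃ y', predState start τ Q (j + 1) y' = predState start τ Q (j + 1) y := ⟨y, rfl⟩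
  rw [predStep, dif_pos h]
  exact predState_congr hQ hd h.choose_spec

theorem predState_zero_right (hτ : 0 < τ) (h0 : start 0 = 0) (j : ℕ) :
    predState start τ Q j 0 = 1 := by
  have : ∃ t < τ, start t / Q ^ j = 0 := ⟨0, hτ, by simp [h0]⟩
  simp only [predState, this, if_true, Nat.not_lt_zero, Finset.filter_false, Finset.card_empty]

/-- Once all digits are read, half of the state plus its parity counts the keys at most `K`, and
these are the keys `0, ..., t`. -/
theorem predState_zero_left (hmono : StrictMono start) {t K : ℕ} (ht : t < τ) (h1 : start t ≤ K)
    (h2 : K < start (t + 1)) :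
    predState start τ Q 0 K / 2 + predState start τ Q 0 K % 2 - 1 = t := by
  classical
  have hle : ∀ r, start r ≤ K ↔ r ≤ t := fun r =>
    ⟨fun h => by
      by_contra hr
      exact absurd (hmono.monotone (show t + 1 ≤ r by omega)) (by omega),
     fun h => (hmono.monotone h).trans h1⟩
  by_cases heq : start t = K
  · have hex : ∃ r < τ, start r / Q ^ 0 = K := ⟨t, ht, by simpa using heq⟩
    have hcard : ((Finset.range τ).filter fun r => start r / Q ^ 0 < K).card = t := by
      rw [← Finset.card_range t]
      congr 1
      ext r
      simp only [Finset.mem_filter, Finset.mem_range, pow_zero, Nat.div_one]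
      rw [← heq, hmono.lt_iff_lt]
      omega
    simp only [predState, hex, hcard, if_true]
    omega
  · have hex : ¬ ∃ r < τ, start r / Q ^ 0 = K := by
      rintro ⟨r, -, hr⟩
      rw [pow_zero, Nat.div_one] at hr
      have h3 : r ≤ t := (hle r).1 hr.le
      have h4 := hmono.monotone h3
      omega
    have hcard : ((Finset.range τ).filter fun r => start r / Q ^ 0 < K).card = t + 1 := by
      rw [← Finset.card_range (t + 1)]
      congr 1
      ext r
      simp only [Finset.mem_filter, Finset.mem_range, pow_zero, Nat.div_one]
      have := hle r
      constructor
      · rintro ⟨-, h⟩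
        have := this.1 h.le
        omega
      · intro h
        refine ⟨by omega, lt_of_le_of_ne (this.2 (by omega)) fun h' => ?_⟩
        exact hex ⟨r, by omega, by simpa using h'⟩
    simp only [predState, hex, hcard, if_false]
    omega

end Predecessor

/-! ### Expressions -/

namespace Expr

/-- The base of the digits, which is the first table entry. -/
def base : Expr := .look (.num 0)

def snoc (a b : Expr) : Expr := .bin .add (.bin .mul a base) b

/-- The entry with four indices of the array number `a`. -/
def entry (a : ℕ) (e₁ e₂ e₃ e₄ : Expr) : Expr :=
  .look ((((Expr.num a |>.snoc e₁).snoc e₂).snoc e₃).snoc e₄)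

def shiftDigits (e : Expr) : ℕ → Expr
  | 0 => e
  | n + 1 => .bin .div (e.shiftDigits n) base

def digit (e : Expr) (j : ℕ) : Expr := .bin .mod (e.shiftDigits j) base

def gather (f : ℕ → Expr) : ℕ → Expr
  | 0 => .num 0
  | n + 1 => .bin .xor (gather f n) (f n)

def sum (f : ℕ → Expr) : ℕ → Expr
  | 0 => .num 0
  | n + 1 => .bin .add (sum f n) (f n)

/-- The state of the automaton in the array `a` after reading `n` of the `J` digits of `e`. -/
def scan (a J : ℕ) (e : Expr) (init : ℕ) : ℕ → Expr
  | 0 => .num init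
  | n + 1 => entry a (.num (J - 1 - n)) (scan a J e init n) (e.digit (J - 1 - n)) (.num 0)

/-- `1` if `a < b` and `0` otherwise. -/
def less (a b : Expr) : Expr :=
  let t : Expr := .bin .div b (.bin .add a (.num 1))
  .bin .div t t

end Expr

/-- The table with the arrays `F 0, …, F (n - 1)`. -/
def mkTable (n Q : ℕ) (F : ℕ → ℕ → ℕ → ℕ → ℕ → ℕ) : List ℕ :=
  (List.range (n * Q ^ 4)).map fun i =>
    F (i / Q / Q / Q / Q) (i / Q / Q / Q % Q) (i / Q / Q % Q) (i / Q % Q) (i % Q)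

theorem length_mkTable (n Q : ℕ) (F : ℕ → ℕ → ℕ → ℕ → ℕ → ℕ) :
    (mkTable n Q F).length = n * Q ^ 4 := by simp [mkTable]

theorem snoc_lt {a i n Q : ℕ} (ha : a < n) (hi : i < Q) : a * Q + i < n * Q := by
  have := Nat.mul_le_mul_right Q (show a + 1 ≤ n from ha)
  rw [Nat.succ_mul] at this
  omega

theorem snoc_div_mod {a i Q : ℕ} (hi : i < Q) : (a * Q + i) / Q = a ∧ (a * Q + i) % Q = i := by
  have hQ : 0 < Q := by omega
  rw [Nat.mul_comm]
  refine ⟨?_, ?_⟩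
  · rw [Nat.mul_add_div hQ, Nat.div_eq_of_lt hi, Nat.add_zero]
  · rw [Nat.mul_add_mod, Nat.mod_eq_of_lt hi]

theorem getD_mkTable {n Q : ℕ} {F : ℕ → ℕ → ℕ → ℕ → ℕ → ℕ} {a i₁ i₂ i₃ i₄ : ℕ} (ha : a < n)
    (h₁ : i₁ < Q) (h₂ : i₂ < Q) (h₃ : i₃ < Q) (h₄ : i₄ < Q) :
    (((a * Q + i₁) * Q + i₂) * Q + i₃) * Q + i₄ < n * Q ^ 4 ∧
      (mkTable n Q F).getD ((((a * Q + i₁) * Q + i₂) * Q + i₃) * Q + i₄) 0 = F a i₁ i₂ i₃ i₄ := by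
  have hlt : (((a * Q + i₁) * Q + i₂) * Q + i₃) * Q + i₄ < n * Q ^ 4 := by
    have := snoc_lt (snoc_lt (snoc_lt (snoc_lt ha h₁) h₂) h₃) h₄
    calc _ < n * Q * Q * Q * Q := this
      _ = n * Q ^ 4 := by ring
  refine ⟨hlt, ?_⟩
  rw [mkTable, List.getD_eq_getElem _ _ (by simpa using hlt)]
  simp only [List.getElem_map, List.getElem_range]
  simp only [snoc_div_mod h₁, snoc_div_mod h₂, snoc_div_mod h₃, snoc_div_mod h₄]

/-! ### Evaluation rules for expressions -/

section Eval

variable {B W M K x n Q : ℕ} {F : ℕ → ℕ → ℕ → ℕ → ℕ → ℕ} {tab : List ℕ}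

local notation "⟬" e "⟭" => Expr.eval B W tab M K x e

theorem eval_num {k : ℕ} (h : k < B) : ⟬.num k⟭ = some k := by simp [Expr.eval, cap, h]

theorem eval_add {a b : Expr} {u v : ℕ} (ha : ⟬a⟭ = some u) (hb : ⟬b⟭ = some v) (h : u + v < B) :
    ⟬.bin .add a b⟭ = some (u + v) := by simp [Expr.eval, ha, hb, ArithOp.eval, cap, h]

theorem eval_mul {a b : Expr} {u v : ℕ} (ha : ⟬a⟭ = some u) (hb : ⟬b⟭ = some v) (h : u * v < B) :
    ⟬.bin .mul a b⟭ = some (u * v) := by simp [Expr.eval, ha, hb, ArithOp.eval, cap, h]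

theorem eval_sub {a b : Expr} {u v : ℕ} (ha : ⟬a⟭ = some u) (hb : ⟬b⟭ = some v) (hle : v ≤ u)
    (h : u < B) : ⟬.bin .sub a b⟭ = some (u - v) := by
  simp [Expr.eval, ha, hb, ArithOp.eval, cap, hle, show u - v < B by omega]

theorem eval_div {a b : Expr} {u v : ℕ} (ha : ⟬a⟭ = some u) (hb : ⟬b⟭ = some v) (h : u < B) :
    ⟬.bin .div a b⟭ = some (u / v) := by
  simp [Expr.eval, ha, hb, ArithOp.eval, cap, lt_of_le_of_lt (Nat.div_le_self u v) h]

theorem eval_mod {a b : Expr} {u v : ℕ} (ha : ⟬a⟭ = some u) (hb : ⟬b⟭ = some v) (h : u < B) :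
    ⟬.bin .mod a b⟭ = some (u % v) := by
  simp [Expr.eval, ha, hb, ArithOp.eval, cap, lt_of_le_of_lt (Nat.mod_le u v) h]

theorem eval_xor {a b : Expr} {u v : ℕ} (ha : ⟬a⟭ = some u) (hb : ⟬b⟭ = some v)
    (h : u ^^^ v < B) : ⟬.bin .xor a b⟭ = some (u ^^^ v) := by
  simp [Expr.eval, ha, hb, ArithOp.eval, cap, h]

theorem eval_window {a : Expr} {u : ℕ} (ha : ⟬a⟭ = some u) (h : 2 ^ W ≤ B) :
    ⟬.window a⟭ = some (M / 2 ^ u % 2 ^ W) := by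
  simp [Expr.eval, ha, cap, lt_of_lt_of_le (Nat.mod_lt (M / 2 ^ u) (Nat.two_pow_pos W)) h]

/-- The quotient `v / (u + 1)` is positive exactly when `u < v`; dividing it by itself gives `1` or,
by the convention for division by zero, `0`. -/
theorem eval_less {a b : Expr} {u v : ℕ} (ha : ⟬a⟭ = some u) (hb : ⟬b⟭ = some v) (hu : u + 1 < B)
    (hv : v < B) : ⟬a.less b⟭ = some (if u < v then 1 else 0) := by
  have ht : ⟬.bin .div b (.bin .add a (.num 1))⟭ = some (v / (u + 1)) :=
    eval_div hb (eval_add ha (eval_num (show 1 < B by omega)) hu) hv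
  rw [Expr.less, eval_div ht ht (lt_of_le_of_lt (Nat.div_le_self _ _) hv)]
  congr 1
  split_ifs with h
  · exact Nat.div_self (Nat.div_pos h (by omega))
  · rw [Nat.div_eq_of_lt (show v < u + 1 by omega)]

theorem eval_sum {f : ℕ → Expr} {g : ℕ → ℕ} {n : ℕ} (hf : ∀ i < n, ⟬f i⟭ = some (g i))
    (h : ∑ i ∈ Finset.range n, g i < B) : ⟬Expr.sum f n⟭ = some (∑ i ∈ Finset.range n, g i) := by
  induction n with
  | zero => exact eval_num (by simpa using h)
  | succ n ih =>
    rw [Finset.sum_range_succ] at h ⊢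
    exact eval_add (ih (fun i hi => hf i (by omega)) (by omega)) (hf n (by omega)) h

theorem eval_gather {f : ℕ → Expr} {g : ℕ → ℕ} {n b : ℕ} (hf : ∀ i < n, ⟬f i⟭ = some (g i))
    (hg : ∀ i < n, g i < 2 ^ b) (hB : 2 ^ b ≤ B) : ⟬Expr.gather f n⟭ = some (xorSum g n) := by
  induction n with
  | zero => exact eval_num (lt_of_lt_of_le (Nat.two_pow_pos b) hB)
  | succ n ih =>
    exact eval_xor (ih (fun i hi => hf i (by omega)) fun i hi => hg i (by omega)) (hf n (by omega))
      (lt_of_lt_of_le (xorSum_lt (n := n + 1) hg) hB)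

end Eval

/-! ### Evaluation of table lookups and digit automata -/

section EvalTable

variable {B W M K x n Q : ℕ} {F : ℕ → ℕ → ℕ → ℕ → ℕ → ℕ}

local notation "⟬" e "⟭" => Expr.eval B W (mkTable n Q F) M K x e

theorem eval_base (hn : 0 < n) (hQ : 0 < Q) (hF : F 0 0 0 0 0 = Q) (hQW : Q < 2 ^ W)
    (hWB : 2 ^ W ≤ B) : ⟬.base⟭ = some Q := by
  obtain ⟨h1, h2⟩ := getD_mkTable (F := F) hn hQ hQ hQ hQ
  simp only [Nat.zero_mul, Nat.add_zero, hF] at h1 h2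
  rw [Expr.base, Expr.eval, eval_num (by omega)]
  simp only [Option.bind_some, length_mkTable, h1, if_true, h2]
  rw [Nat.mod_eq_of_lt hQW, cap, if_pos (by omega)]

theorem eval_snoc {a e : Expr} {u v : ℕ} (hbase : ⟬.base⟭ = some Q) (ha : ⟬a⟭ = some u)
    (he : ⟬e⟭ = some v) (h : u * Q + v < B) : ⟬a.snoc e⟭ = some (u * Q + v) :=
  eval_add (eval_mul ha hbase (by omega)) he h

theorem eval_entry {a i₁ i₂ i₃ i₄ : ℕ} {e₁ e₂ e₃ e₄ : Expr} (hbase : ⟬.base⟭ = some Q)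
    (hB : n * Q ^ 4 ≤ B) (hWB : 2 ^ W ≤ B) (ha : a < n)
    (h₁ : i₁ < Q) (h₂ : i₂ < Q) (h₃ : i₃ < Q) (h₄ : i₄ < Q)
    (he₁ : ⟬e₁⟭ = some i₁) (he₂ : ⟬e₂⟭ = some i₂) (he₃ : ⟬e₃⟭ = some i₃) (he₄ : ⟬e₄⟭ = some i₄)
    (hF : F a i₁ i₂ i₃ i₄ < 2 ^ W) : ⟬.entry a e₁ e₂ e₃ e₄⟭ = some (F a i₁ i₂ i₃ i₄) := by
  obtain ⟨h1, h2⟩ := getD_mkTable (F := F) ha h₁ h₂ h₃ h₄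
  have hQ : 1 ≤ Q := by omega
  have hle : ∀ u v : ℕ, u ≤ u * Q + v := fun u v =>
    (Nat.le_mul_of_pos_right u hQ).trans (Nat.le_add_right _ _)
  have b4 : (((a * Q + i₁) * Q + i₂) * Q + i₃) * Q + i₄ < B := lt_of_lt_of_le h1 hB
  have b3 := lt_of_le_of_lt (hle _ _) b4
  have b2 := lt_of_le_of_lt (hle _ _) b3
  have b1 := lt_of_le_of_lt (hle _ _) b2
  have b0 := lt_of_le_of_lt (hle _ _) b1
  have hidx := eval_snoc hbase (eval_snoc hbase (eval_snoc hbase (eval_snoc hbase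
    (eval_num (B := B) b0) he₁ b1) he₂ b2) he₃ b3) he₄ b4
  rw [Expr.entry, Expr.eval, hidx]
  simp only [Option.bind_some, length_mkTable, h1, if_true, h2]
  rw [Nat.mod_eq_of_lt hF, cap, if_pos (lt_of_lt_of_le hF hWB)]

theorem eval_digit {e : Expr} {y : ℕ} (hbase : ⟬.base⟭ = some Q) (he : ⟬e⟭ = some y) (hy : y < B)
    (j : ℕ) : ⟬e.digit j⟭ = some (y / Q ^ j % Q) := by
  have h : ∀ j, ⟬e.shiftDigits j⟭ = some (y / Q ^ j) ∧ y / Q ^ j < B := by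
    intro j
    have hlt : ∀ j, y / Q ^ j < B := fun j => lt_of_le_of_lt (Nat.div_le_self _ _) hy
    refine ⟨?_, hlt j⟩
    induction j with
    | zero => simpa [Expr.shiftDigits] using he
    | succ j ih =>
      rw [Expr.shiftDigits, eval_div ih hbase (hlt j), pow_succ, Nat.div_div_eq_div_mul]
  exact eval_mod (h j).1 hbase (h j).2

theorem eval_scan {a J y init : ℕ} {e : Expr} (hbase : ⟬.base⟭ = some Q)
    (hB : n * Q ^ 4 ≤ B) (hWB : 2 ^ W ≤ B) (ha : a < n) (hQW : Q < 2 ^ W) (hJ : J ≤ Q)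
    (hQ : 0 < Q) (he : ⟬e⟭ = some y) (hy : y < B)
    (hst : ∀ k ≤ J, automaton (fun j st d => F a j st d 0) Q J y init k < Q) :
    ∀ k ≤ J, ⟬.scan a J e init k⟭ = some (automaton (fun j st d => F a j st d 0) Q J y init k) := by
  intro k
  induction k with
  | zero => intro _; exact eval_num (by have := hst 0 (by omega); simp only [automaton] at this; omega)
  | succ k ih =>
    intro hk
    rw [Expr.scan, automaton]
    refine eval_entry hbase hB hWB ha (by omega) (hst k (by omega)) (Nat.mod_lt _ hQ) hQ
      (eval_num (by omega)) (ih (by omega)) (eval_digit hbase he hy _) (eval_num (by omega)) ?_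
    have := hst (k + 1) hk
    rw [automaton] at this
    omega

end EvalTable

end RankDS

/-! ## The query expression -/

namespace RankDS

/-- How the components of a set of type `t` are stored: the payload `p < c t` consists of `body t`
bits, some of which are copied to the component `i`, and of a header, whose digits contribute to
every component. -/
structure Layout (q J H Λ I ℓ τ : ℕ) (c : ℕ → ℕ) where
  body : ℕ → ℕ
  acc : ℕ → ℕ → ℕ → ℕ → ℕ
  off : ℕ → ℕ → ℕ
  width : ℕ → ℕ → ℕ
  body_le : ∀ t < τ, body t ≤ ℓ
  off_add_width_le : ∀ t < τ, ∀ i < I, off t i + width t i ≤ body t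
  width_le : ∀ t < τ, ∀ i < I, width t i ≤ Λ
  acc_lt : ∀ t < τ, ∀ i < I, ∀ j < J, ∀ d < 2 ^ q, acc t i j d < 2 ^ Λ
  count_le : ∀ t < τ, c t ≤ 2 ^ (body t + H)

/-- The component number `i` of the set with payload `p` of type `t`. -/
def Layout.comp {q J H Λ I ℓ τ : ℕ} {c : ℕ → ℕ} (L : Layout q J H Λ I ℓ τ c) (t p i : ℕ) : ℕ :=
  xorSum (fun j => L.acc t i j (p / 2 ^ L.body t / (2 ^ q) ^ j % 2 ^ q)) J ^^^
    (p / 2 ^ L.off t i % 2 ^ L.width t i)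

theorem Layout.comp_lt {q J H Λ I ℓ τ : ℕ} {c : ℕ → ℕ} (L : Layout q J H Λ I ℓ τ c) {t i : ℕ}
    (ht : t < τ) (hi : i < I) (p : ℕ) : L.comp t p i < 2 ^ Λ := by
  refine Nat.xor_lt_two_pow (xorSum_lt fun j hj => ?_) ?_
  · exact L.acc_lt t ht i hi j hj _ (Nat.mod_lt _ (Nat.two_pow_pos q))
  · exact lt_of_lt_of_le (Nat.mod_lt _ (Nat.two_pow_pos _))
      (Nat.pow_le_pow_right (by norm_num) (L.width_le t ht i hi))

/-- The digit number `k` of `g` in base `2 ^ z`. -/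
def codeDigit (z g k : ℕ) : ℕ := g / 2 ^ (z * k) % 2 ^ z

/-- `g` codes the positions where the consecutive elements number `lo, …, hi - 1` differ. -/
def IsGroupCode (z lo hi : ℕ) (s : ℕ → ℕ) (g : ℕ) : Prop :=
  ∀ l, lo ≤ l → l + 1 < hi → codeDigit z g (l - lo) = (s l ^^^ s (l + 1)).size

/-- The bits of `y` at the positions coded by `g`. -/
def sketch (z b g y : ℕ) : ℕ := Nat.ofBits fun k : Fin b => y.testBit (codeDigit z g k - 1)

theorem testBit_sketch {z b g y k : ℕ} (hk : k < b) :
    (sketch z b g y).testBit k = y.testBit (codeDigit z g k - 1) := by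
  rw [sketch, Nat.testBit_ofBits_lt _ _ hk]

theorem sketch_lt (z b g y : ℕ) : sketch z b g y < 2 ^ b := Nat.ofBits_lt_two_pow _

/-- For a fixed code the sketch reads fixed positions, hence it is linear in `y`. It can therefore
be assembled from one lookup per digit of the query, with the code as a further index. -/
theorem xorLinear_sketch (z b g : ℕ) : XorLinear (sketch z b g) := by
  intro x y
  apply Nat.eq_of_testBit_eq
  intro k
  by_cases hk : k < b
  · rw [Nat.testBit_xor, testBit_sketch hk, testBit_sketch hk, testBit_sketch hk, Nat.testBit_xor]
  · have h : ∀ x, (sketch z b g x).testBit k = false := fun x =>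
      Nat.testBit_lt_two_pow ((sketch_lt z b g x).trans_le
        (Nat.pow_le_pow_right (by norm_num) (not_lt.1 hk)))
    rw [Nat.testBit_xor, h, h, h]
    rfl

open Classical in
/-- An element number to which the sketch leads, if there is one. -/
noncomputable def candidate (D : ℕ → ℕ) (lo hi sk : ℕ) : ℕ :=
  if h : ∃ i ∈ Finset.Ico lo hi, LeadsTo D lo hi sk i then h.choose else 0

theorem candidate_le (D : ℕ → ℕ) (lo hi sk : ℕ) : candidate D lo hi sk ≤ hi := by
  classical
  unfold candidate
  split_ifs with h
  · have := h.choose_spec.1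
    rw [Finset.mem_Ico] at this
    exact this.2.le
  · exact Nat.zero_le _

/-- The candidate depends only on the code and the sketch, so it can be tabulated. For an empty
group both sides are `0`, whatever the candidate. -/
theorem localRank_candidate {s : ℕ → ℕ} {lo hi z b g x : ℕ}
    (hs : ∀ l, lo ≤ l → l + 1 < hi → s l < s (l + 1)) (hg : IsGroupCode z lo hi s g)
    (hb : hi ≤ lo + b) :
    localRank (fun l => codeDigit z g (l - lo)) lo hi
      (candidate (fun l => codeDigit z g (l - lo)) lo hi (sketch z b g x))
      (x ^^^ s (candidate (fun l => codeDigit z g (l - lo)) lo hi (sketch z b g x))).size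
      (decide (x < s (candidate (fun l => codeDigit z g (l - lo)) lo hi (sketch z b g x)))) =
      ((Finset.Ico lo hi).filter fun k => s k ≤ x).card := by
  classical
  rcases Nat.lt_or_ge lo hi with h | h
  · have hsk : ∀ l, lo ≤ l → l + 1 < hi →
        (sketch z b g x).testBit (l - lo) = x.testBit (codeDigit z g (l - lo) - 1) :=
      fun l h1 h2 => testBit_sketch (by omega)
    have hex := exists_leadsTo (D := fun l => codeDigit z g (l - lo)) hs hg h hsk
    have hc : candidate (fun l => codeDigit z g (l - lo)) lo hi (sketch z b g x) = hex.choose := by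
      rw [candidate, dif_pos hex]
    rw [hc]
    exact localRank_eq hs hg hsk hex.choose_spec.1 hex.choose_spec.2
  · rw [localRank, Finset.Ico_eq_empty (by omega)]
    simp

namespace Expr

def ofType (J : ℕ) : Expr := entry 2 (scan 1 J .spill 1 J) (.num 0) (.num 0) (.num 0)

def typeEntry (a J : ℕ) (i : Expr) : Expr := entry a (ofType J) i (.num 0) (.num 0)

/-- The header is `p / 2 ^ body`. Its low part lies in `M` above the body, and its high part is `K -
start t`, moved into place by the factor from array `5`. -/
def header (J : ℕ) : Expr :=
  .bin .add (.window (typeEntry 4 J (.num 0)))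
    (.bin .mul (.bin .sub .spill (typeEntry 3 J (.num 0))) (typeEntry 5 J (.num 0)))

/-- The header acts by an exclusive sum over its digits. The body bits are cut out of a window by
reducing modulo `2 ^ width`, which is stored in array `8`. -/
def component (J : ℕ) (i : Expr) : Expr :=
  .bin .xor (gather (fun j => entry 6 (ofType J) i (.num j) ((header J).digit j)) J)
    (.bin .mod (.window (typeEntry 7 J i)) (typeEntry 8 J i))

def groupCode (J γ : ℕ) : Expr :=
  component J (entry 13 (.num γ) (.num 0) (.num 0) (.num 0))

def groupSketch (J γ : ℕ) : Expr :=
  gather (fun j => entry 10 (groupCode J γ) (.num j) (Expr.query.digit j) (.num 0)) J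

def groupCandidate (J γ : ℕ) : Expr :=
  entry 11 (.num γ) (groupCode J γ) (groupSketch J γ) (.num 0)

def groupElement (J γ : ℕ) : Expr := component J (groupCandidate J γ)

/-- The last index packs the outcome of the comparison with the candidate: twice the length of the
exclusive or, plus one if the query is smaller. -/
def groupRank (J γ : ℕ) : Expr :=
  entry 12 (.num γ) (groupCode J γ) (groupCandidate J γ)
    (.bin .add (.bin .mul (.num 2) (scan 9 J (.bin .xor .query (groupElement J γ)) 0 J))
      (less .query (groupElement J γ)))

def rankQuery (J G : ℕ) : Expr := sum (groupRank J) G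

end Expr

section Query

variable {q J H Λ m G ℓ τ z b : ℕ} {c : ℕ → ℕ}

/-- The arrays that `Expr.rankQuery` uses. -/
noncomputable def rankTable (z b m : ℕ) (start : ℕ → ℕ) (L : Layout q J H Λ (m + G) ℓ τ c) :
    ℕ → ℕ → ℕ → ℕ → ℕ → ℕ
  | 0, _, _, _, _ => 2 ^ q
  | 1, j, st, d, _ => predStep start τ (2 ^ q) j st d
  | 2, st, _, _, _ => st / 2 + st % 2 - 1
  | 3, t, _, _, _ => start t
  | 4, t, _, _, _ => L.body t
  | 5, t, _, _, _ => if ℓ < L.body t + H then 2 ^ (ℓ - L.body t) else 0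
  | 6, t, i, j, d => L.acc t i j d
  | 7, t, i, _, _ => L.off t i
  | 8, t, i, _, _ => 2 ^ L.width t i
  | 9, _, st, d, _ => sizeStep q st d
  | 10, g, j, d, _ => sketch z b g (d * (2 ^ q) ^ j)
  | 11, γ, g, sk, _ =>
    candidate (fun l => codeDigit z g (l - γ * b)) (γ * b) (min m ((γ + 1) * b)) sk
  | 12, γ, g, i, e =>
    localRank (fun l => codeDigit z g (l - γ * b)) (γ * b) (min m ((γ + 1) * b)) i (e / 2)
      (decide (e % 2 = 1))
  | _, γ, _, _, _ => m + γ

theorem mod_two_pow_div_mod (p ℓ o b : ℕ) (h : o + b ≤ ℓ) :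
    p % 2 ^ ℓ / 2 ^ o % 2 ^ b = p / 2 ^ o % 2 ^ b := by
  apply Nat.eq_of_testBit_eq
  intro i
  simp only [Nat.testBit_mod_two_pow, Nat.testBit_div_two_pow]
  by_cases hi : i < b
  · have : i + o < ℓ := by omega
    simp [this]
  · simp [hi]

theorem div_two_pow_eq (p ℓ β : ℕ) (h : β ≤ ℓ) :
    p / 2 ^ β = p % 2 ^ ℓ / 2 ^ β + p / 2 ^ ℓ * 2 ^ (ℓ - β) := by
  have h1 : 2 ^ ℓ = 2 ^ (ℓ - β) * 2 ^ β := by rw [← pow_add, Nat.sub_add_cancel h]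
  conv_lhs => rw [← Nat.mod_add_div p (2 ^ ℓ)]
  rw [h1, Nat.mul_comm (2 ^ (ℓ - β)) (2 ^ β), Nat.mul_assoc,
    Nat.add_mul_div_left _ _ (Nat.two_pow_pos β), Nat.mul_comm (2 ^ (ℓ - β))]

/-- Beyond the meaning of the arrays, the proof checks that every index is below the base `2 ^ q`,
that every entry fits into `W` bits, and that no intermediate value reaches `B`. -/
theorem eval_rankQuery {B W κ V K x t p : ℕ} {start s : ℕ → ℕ}
    (L : Layout q J H Λ (m + G) ℓ τ c)
    (hBW : 2 ^ W ≤ B) (hBt : 14 * (2 ^ q) ^ 4 ≤ B)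
    (hqW : q < W) (hHW : H ≤ W) (hΛW : Λ < W) (hκW : κ + 1 < W)
    (hκq : κ + 1 ≤ q * J) (hΛq : Λ ≤ q * J) (hJ : J ≤ 2 ^ q)
    (hI : m + G < 2 ^ q) (hτ : 2 * τ + 2 ≤ 2 ^ q) (hΛ : 2 * Λ + 2 ≤ 2 ^ q) (hκΛ : κ ≤ Λ)
    (hG : 0 < G)
    (hbody : ∀ t < τ, L.body t < 2 ^ W) (hV : V ≤ 2 ^ κ) (hb : b ≤ q) (hmb : m ≤ G * b)
    (hstart0 : start 0 = 0) (hstart : StrictMono start) (hstartτ : start τ ≤ 2 ^ (κ + 1))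
    (hs : ∀ l, l + 1 < m → s l < s (l + 1)) (ht : t < τ) (hp : p < c t)
    (hpt : start t + p / 2 ^ ℓ < start (t + 1)) (hx : x < V)
    (hcomp : ∀ i < m, L.comp t p i = s i)
    (hcode : ∀ γ < G, L.comp t p (m + γ) < 2 ^ q ∧
      IsGroupCode z (γ * b) (min m ((γ + 1) * b)) s (L.comp t p (m + γ)))
    (hK : K = start t + p / 2 ^ ℓ) :
    (Expr.rankQuery J G).eval B W (mkTable 14 (2 ^ q) (rankTable z b m start L)) (p % 2 ^ ℓ) K x =
      some ((Finset.range m).filter fun k => s k ≤ x).card := by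
  classical
  set Q := 2 ^ q with hQdef
  have hQ : 0 < Q := Nat.two_pow_pos q
  have hpℓ := Nat.zero_le (p / 2 ^ ℓ)
  have hQ2 : 2 ≤ Q := by omega
  have hQW : Q < 2 ^ W := Nat.pow_lt_pow_right (by norm_num) hqW
  set F := rankTable z b m start L with hF
  have hbase : Expr.eval B W (mkTable 14 Q F) (p % 2 ^ ℓ) K x .base = some Q :=
    eval_base (by norm_num) hQ rfl hQW hBW
  have hsmall : ∀ k < Q, Expr.eval B W (mkTable 14 Q F) (p % 2 ^ ℓ) K x (.num k) = some k :=
    fun k hk => eval_num (by omega)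
  have h0 := hsmall 0 hQ
  have hκW' : 2 ^ (κ + 1) < 2 ^ W := Nat.pow_lt_pow_right (by norm_num) hκW
  have hΛW' : 2 ^ Λ < 2 ^ W := Nat.pow_lt_pow_right (by norm_num) hΛW
  have hstartle : ∀ r ≤ τ, start r ≤ 2 ^ (κ + 1) := fun r hr => (hstart.monotone hr).trans hstartτ
  have hKlt : K < 2 ^ (κ + 1) := by
    have := hstartle (t + 1) ht
    omega
  have hQJ : ∀ n, n ≤ q * J → 2 ^ n ≤ Q ^ J := fun n hn => by
    rw [hQdef, ← pow_mul]; exact Nat.pow_le_pow_right (by norm_num) hn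
  have hτQ : τ < Q := by omega
  have htQ : t < Q := by omega
  have htrans : ∀ a i₁ i₂ i₃ i₄ : ℕ, ∀ e₁ e₂ e₃ e₄ : Expr, a < 14 → i₁ < Q → i₂ < Q → i₃ < Q →
      i₄ < Q → e₁.eval B W (mkTable 14 Q F) (p % 2 ^ ℓ) K x = some i₁ →
      e₂.eval B W (mkTable 14 Q F) (p % 2 ^ ℓ) K x = some i₂ →
      e₃.eval B W (mkTable 14 Q F) (p % 2 ^ ℓ) K x = some i₃ →
      e₄.eval B W (mkTable 14 Q F) (p % 2 ^ ℓ) K x = some i₄ → F a i₁ i₂ i₃ i₄ < 2 ^ W →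
      (Expr.entry a e₁ e₂ e₃ e₄).eval B W (mkTable 14 Q F) (p % 2 ^ ℓ) K x =
        some (F a i₁ i₂ i₃ i₄) :=
    fun a i₁ i₂ i₃ i₄ e₁ e₂ e₃ e₄ ha h₁ h₂ h₃ h₄ he₁ he₂ he₃ he₄ hFa =>
      eval_entry hbase hBt hBW ha h₁ h₂ h₃ h₄ he₁ he₂ he₃ he₄ hFa
  have htype : (Expr.ofType J).eval B W (mkTable 14 Q F) (p % 2 ^ ℓ) K x = some t := by
    have hauto : ∀ k ≤ J, automaton (fun j st d => F 1 j st d 0) Q J K 1 k =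
        predState start τ Q (J - k) (K / Q ^ (J - k)) := by
      refine automaton_eq (φ := predState start τ Q) hQ (hKlt.trans_le (hQJ _ hκq)) ?_ ?_
      · exact (predState_zero_right (by omega) hstart0 _).symm
      · intro j y d hd
        exact predStep_eq hQ j y d hd
    have hscan := eval_scan (F := F) (n := 14) (a := 1) (J := J) (y := K) (init := 1) (e := .spill)
      hbase hBt hBW (by norm_num) hQW hJ hQ (by simp [Expr.eval, cap, show K < B by omega])
      (by omega) (fun k hk => by
        rw [hauto k hk]; exact lt_of_lt_of_le (predState_lt _ _ _ _ _) hτ) J le_rfl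
    rw [hauto J le_rfl, Nat.sub_self, pow_zero, Nat.div_one] at hscan
    have hst := predState_lt start τ Q 0 K
    have hfin := predState_zero_left (Q := Q) hstart ht (show start t ≤ K by omega)
      (show K < start (t + 1) by omega)
    have := htrans 2 _ 0 0 0 _ _ _ _ (by norm_num) (by omega) hQ hQ hQ hscan h0 h0 h0 (by
      rw [show F 2 (predState start τ Q 0 K) 0 0 0 =
        predState start τ Q 0 K / 2 + predState start τ Q 0 K % 2 - 1 from rfl, hfin]; omega)
    rw [show F 2 (predState start τ Q 0 K) 0 0 0 =
      predState start τ Q 0 K / 2 + predState start τ Q 0 K % 2 - 1 from rfl, hfin] at this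
    exact this
  have hte : ∀ a i (e : Expr), a < 14 → i < Q →
      e.eval B W (mkTable 14 Q F) (p % 2 ^ ℓ) K x = some i → F a t i 0 0 < 2 ^ W →
      (Expr.typeEntry a J e).eval B W (mkTable 14 Q F) (p % 2 ^ ℓ) K x = some (F a t i 0 0) :=
    fun a i e ha hi he hFa => htrans a t i 0 0 _ _ _ _ ha htQ hi hQ hQ htype he h0 h0 hFa
  have hβ := L.body_le t ht
  have hhdr : p / 2 ^ L.body t < 2 ^ H := by
    rw [Nat.div_lt_iff_lt_mul (Nat.two_pow_pos _), ← pow_add, Nat.add_comm]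
    exact lt_of_lt_of_le hp (L.count_le t ht)
  have hHW' : 2 ^ H ≤ 2 ^ W := Nat.pow_le_pow_right (by norm_num) hHW
  have hheader : (Expr.header J).eval B W (mkTable 14 Q F) (p % 2 ^ ℓ) K x =
      some (p / 2 ^ L.body t) := by
    have hsplit := div_two_pow_eq p ℓ _ hβ
    have hlow := Nat.zero_le (p % 2 ^ ℓ / 2 ^ L.body t)
    have e1 : (Expr.window (.typeEntry 4 J (.num 0))).eval B W (mkTable 14 Q F) (p % 2 ^ ℓ) K x =
        some (p % 2 ^ ℓ / 2 ^ L.body t) := by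
      rw [eval_window (hte 4 0 _ (by norm_num) hQ h0 (hbody t ht)) hBW]
      congr 1
      exact Nat.mod_eq_of_lt (by show p % 2 ^ ℓ / 2 ^ L.body t < _; omega)
    have e2 : (Expr.typeEntry 3 J (.num 0)).eval B W (mkTable 14 Q F) (p % 2 ^ ℓ) K x =
        some (start t) := hte 3 0 _ (by norm_num) hQ h0 (by
          have := hstartle t ht.le
          exact lt_of_le_of_lt this hκW')
    have e3 : (Expr.bin .sub .spill (.typeEntry 3 J (.num 0))).eval B W (mkTable 14 Q F)
        (p % 2 ^ ℓ) K x = some (p / 2 ^ ℓ) := by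
      rw [eval_sub (u := K) (by simp [Expr.eval, cap, show K < B by omega]) e2 (by omega) (by omega)]
      congr 1
      omega
    -- In the second case the whole payload fits into `M`, the part in `K` is `0` and any factor is
    -- right. The entry is `0` there because `2 ^ (ℓ - body)` could be too large for the table.
    by_cases hlt : ℓ < L.body t + H
    · have hsh : F 5 t 0 0 0 = 2 ^ (ℓ - L.body t) := by
        show (if ℓ < L.body t + H then 2 ^ (ℓ - L.body t) else 0) = _
        rw [if_pos hlt]
      have hlt' : 2 ^ (ℓ - L.body t) < 2 ^ W := Nat.pow_lt_pow_right (by norm_num) (by omega)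
      have e4 := hte 5 0 _ (by norm_num) hQ h0 (by rw [hsh]; exact hlt')
      rw [hsh] at e4
      rw [Expr.header, eval_add e1 (eval_mul e3 e4 (by omega)) (by omega), ← hsplit]
    · have hsh : F 5 t 0 0 0 = 0 := by
        show (if ℓ < L.body t + H then 2 ^ (ℓ - L.body t) else 0) = _
        rw [if_neg hlt]
      have e4 := hte 5 0 _ (by norm_num) hQ h0 (by rw [hsh]; omega)
      rw [hsh] at e4
      have hpl : p / 2 ^ ℓ = 0 := Nat.div_eq_of_lt (lt_of_lt_of_le hp
        ((L.count_le t ht).trans (Nat.pow_le_pow_right (by norm_num) (by omega))))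
      rw [hpl, Nat.zero_mul, Nat.add_zero] at hsplit
      rw [hpl] at e3
      rw [Expr.header, eval_add e1 (eval_mul e3 e4 (by omega)) (by omega), Nat.zero_mul,
        Nat.add_zero, ← hsplit]
  have hcompE : ∀ i (e : Expr), i < m + G →
      e.eval B W (mkTable 14 Q F) (p % 2 ^ ℓ) K x = some i →
      (Expr.component J e).eval B W (mkTable 14 Q F) (p % 2 ^ ℓ) K x = some (L.comp t p i) := by
    intro i e hi he
    have hiQ : i < Q := by omega
    have hoff := L.off_add_width_le t ht i hi
    have hbt := hbody t ht
    have hw := L.width_le t ht i hi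
    have hacc : ∀ j < J, L.acc t i j (p / 2 ^ L.body t / Q ^ j % Q) < 2 ^ Λ := fun j hj =>
      L.acc_lt t ht i hi j hj _ (Nat.mod_lt _ hQ)
    refine eval_xor (eval_gather (b := Λ) (fun j hj => ?_) hacc (by omega)) (v :=
      p / 2 ^ L.off t i % 2 ^ L.width t i) ?_ ?_
    · exact htrans 6 t i j _ _ _ _ _ (by norm_num) htQ hiQ (by omega) (Nat.mod_lt _ hQ) htype he
        (hsmall j (by omega)) (eval_digit hbase hheader (by omega) j)
        (lt_trans (hacc j hj) hΛW')
    · have e1 := hte 7 i e (by norm_num) hiQ he (show L.off t i < 2 ^ W by omega)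
      have e2 := hte 8 i e (by norm_num) hiQ he
        (show 2 ^ L.width t i < 2 ^ W from Nat.pow_lt_pow_right (by norm_num) (by omega))
      rw [eval_mod (eval_window e1 hBW) e2
        (lt_of_lt_of_le (Nat.mod_lt _ (Nat.two_pow_pos W)) hBW)]
      congr 1
      show p % 2 ^ ℓ / 2 ^ L.off t i % 2 ^ W % 2 ^ L.width t i = _
      rw [Nat.mod_mod_of_dvd _ (pow_dvd_pow 2 (by omega)), mod_two_pow_div_mod _ _ _ _ (by omega)]
    · have := L.comp_lt ht hi p
      rw [Layout.comp] at this
      omega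
  have hxB : x < 2 ^ κ := lt_of_lt_of_le hx hV
  have hκκ : 2 ^ κ < 2 ^ (κ + 1) := Nat.pow_lt_pow_right (by norm_num) (by omega)
  have hκΛ' : 2 ^ κ ≤ 2 ^ Λ := Nat.pow_le_pow_right (by norm_num) hκΛ
  have hqx : Expr.query.eval B W (mkTable 14 Q F) (p % 2 ^ ℓ) K x = some x := by
    simp [Expr.eval, cap, show x < B by omega]
  have hgroup : ∀ γ < G, (Expr.groupRank J γ).eval B W (mkTable 14 Q F) (p % 2 ^ ℓ) K x =
      some ((Finset.Ico (γ * b) (min m ((γ + 1) * b))).filter fun k => s k ≤ x).card := by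
    intro γ hγ
    have hγQ : γ < Q := by omega
    obtain ⟨hgQ, hg⟩ := hcode γ hγ
    set g := L.comp t p (m + γ) with hgdef
    have ecode : (Expr.groupCode J γ).eval B W (mkTable 14 Q F) (p % 2 ^ ℓ) K x = some g := by
      refine hcompE _ _ (by omega) ?_
      exact htrans 13 γ 0 0 0 _ _ _ _ (by norm_num) hγQ hQ hQ hQ (hsmall γ hγQ) h0 h0 h0
        (show m + γ < 2 ^ W by omega)
    have hbQ : 2 ^ b ≤ Q := Nat.pow_le_pow_right (by norm_num) hb
    have esk : (Expr.groupSketch J γ).eval B W (mkTable 14 Q F) (p % 2 ^ ℓ) K x =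
        some (sketch z b g x) := by
      have h := eval_gather (B := B) (W := W) (M := p % 2 ^ ℓ) (K := K) (x := x)
        (tab := mkTable 14 Q F) (n := J) (b := b)
        (f := fun j => Expr.entry 10 (Expr.groupCode J γ) (.num j) (Expr.query.digit j) (.num 0))
        (g := fun j => sketch z b g (x / Q ^ j % Q * Q ^ j))
        (fun j hj => htrans 10 g j (x / Q ^ j % Q) 0 _ _ _ _ (by norm_num) hgQ (by omega)
          (Nat.mod_lt _ hQ) hQ ecode (hsmall j (by omega)) (eval_digit hbase hqx (by omega) j) h0
          (lt_of_lt_of_le (sketch_lt z b g _) (by omega)))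
        (fun j _ => sketch_lt z b g _) (by omega)
      rw [Expr.groupSketch, h, ← (xorLinear_sketch z b g).eq_xorSum q J x]
      exact hxB.trans_le (Nat.pow_le_pow_right (by norm_num) (by omega))
    have hskQ : sketch z b g x < Q := lt_of_lt_of_le (sketch_lt z b g x) hbQ
    have hrank := localRank_candidate (z := z) (b := b) (x := x)
      (fun l _ h2 => hs l (by omega)) hg (by rw [Nat.succ_mul]; omega)
    have hcle := candidate_le (fun l => codeDigit z g (l - γ * b)) (γ * b) (min m ((γ + 1) * b))
      (sketch z b g x)
    set i := candidate (fun l => codeDigit z g (l - γ * b)) (γ * b) (min m ((γ + 1) * b))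
      (sketch z b g x) with hi
    have ecand : (Expr.groupCandidate J γ).eval B W (mkTable 14 Q F) (p % 2 ^ ℓ) K x = some i :=
      htrans 11 γ g _ 0 _ _ _ _ (by norm_num) hγQ hgQ hskQ hQ (hsmall γ hγQ) ecode esk h0
        (show i < 2 ^ W by omega)
    have eelem := hcompE i _ (by omega) ecand
    have hvlt := L.comp_lt ht (show i < m + G by omega) p
    set v := L.comp t p i with hv
    have hxv : x ^^^ v < 2 ^ Λ := Nat.xor_lt_two_pow (by omega) hvlt
    have exor := eval_xor hqx eelem (show x ^^^ v < B by omega)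
    have hsize : (x ^^^ v).size ≤ Λ := Nat.size_le.2 hxv
    have esize : (Expr.scan 9 J (.bin .xor .query (Expr.groupElement J γ)) 0 J).eval B W
        (mkTable 14 Q F) (p % 2 ^ ℓ) K x = some (x ^^^ v).size := by
      have hauto : ∀ k ≤ J, automaton (fun j st d => F 9 j st d 0) Q J (x ^^^ v) 0 k =
          ((x ^^^ v) / Q ^ (J - k)).size := by
        refine automaton_eq (φ := fun _ y => y.size) hQ (hxv.trans_le (hQJ _ hΛq)) (by simp) ?_
        intro j y d hd
        exact sizeStep_eq q y d hd
      have hscan := eval_scan (F := F) (n := 14) (a := 9) (J := J) (y := x ^^^ v) (init := 0)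
        hbase hBt hBW (by norm_num) hQW hJ hQ exor (by omega) (fun k hk => by
          rw [hauto k hk]
          have : ((x ^^^ v) / Q ^ (J - k)).size ≤ Λ :=
            Nat.size_le.2 (lt_of_le_of_lt (Nat.div_le_self _ _) hxv)
          omega) J le_rfl
      rw [hauto J le_rfl, Nat.sub_self, pow_zero, Nat.div_one] at hscan
      exact hscan
    have eless := eval_less hqx eelem (show x + 1 < B by omega) (show v < B by omega)
    have eidx := eval_add (eval_mul (hsmall 2 (by omega)) esize (by omega)) eless
      (by split_ifs <;> omega)
    set e := 2 * (x ^^^ v).size + (if x < v then 1 else 0) with he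
    have heQ : e < Q := by rw [he]; split_ifs <;> omega
    have hFval : F 12 γ g i e =
        ((Finset.Ico (γ * b) (min m ((γ + 1) * b))).filter fun k => s k ≤ x).card := by
      show localRank (fun l => codeDigit z g (l - γ * b)) (γ * b) (min m ((γ + 1) * b)) i (e / 2)
        (decide (e % 2 = 1)) = _
      have h1 : e / 2 = (x ^^^ v).size := by rw [he]; split_ifs <;> omega
      have h2 : decide (e % 2 = 1) = decide (x < v) := by
        rw [he]; split_ifs with h <;> simp [h]
      rw [h1, h2]
      -- A candidate number outside the sequence can occur only for an empty group. Then the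
      -- component read is no element, but the local rank is `0` anyway.
      by_cases him : i < m
      · rw [hv, hcomp i him]; exact hrank
      · have hempty : min m ((γ + 1) * b) ≤ γ * b := by
          by_contra hne
          have hex := exists_leadsTo (D := fun l => codeDigit z g (l - γ * b)) (x := x)
            (sk := sketch z b g x) (lo := γ * b) (hi := min m ((γ + 1) * b))
            (fun l _ h2 => hs l (by omega)) hg (by omega)
            (fun l h1 h2 => testBit_sketch (by rw [Nat.succ_mul] at h2; omega))
          rw [candidate, dif_pos hex] at hi
          have := (Finset.mem_Ico.1 hex.choose_spec.1).2
          omega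
        rw [localRank, Finset.Ico_eq_empty (by omega)]
        simp
    have hcard : ((Finset.Ico (γ * b) (min m ((γ + 1) * b))).filter fun k => s k ≤ x).card ≤ m :=
      (Finset.card_filter_le _ _).trans (by rw [Nat.card_Ico]; omega)
    have := htrans 12 γ g i e _ _ _ _ (by norm_num) hγQ hgQ (by omega) heQ (hsmall γ hγQ) ecode
      ecand eidx (by rw [hFval]; omega)
    rw [hFval] at this
    exact this
  have htotal : ∑ γ ∈ Finset.range G,
      ((Finset.Ico (γ * b) (min m ((γ + 1) * b))).filter fun k => s k ≤ x).card =
      ((Finset.range m).filter fun k => s k ≤ x).card := by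
    have key : ∀ n, ∑ γ ∈ Finset.range n,
        ((Finset.Ico (γ * b) (min m ((γ + 1) * b))).filter fun k => s k ≤ x).card =
        ((Finset.range (min m (n * b))).filter fun k => s k ≤ x).card := by
      intro n
      induction n with
      | zero => simp
      | succ n ih =>
        rw [Finset.sum_range_succ, ih, ← Finset.card_union_of_disjoint]
        · rw [← Finset.filter_union]
          congr 2
          ext k
          simp only [Finset.mem_union, Finset.mem_range, Finset.mem_Ico]
          rw [Nat.succ_mul]
          omega
        · refine Finset.disjoint_filter_filter ?_
          rw [Finset.disjoint_left]
          intro k hk hk'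
          rw [Finset.mem_range] at hk
          rw [Finset.mem_Ico] at hk'
          omega
    rw [key G, min_eq_left hmb]
  have hcardm : ((Finset.range m).filter fun k => s k ≤ x).card ≤ m :=
    (Finset.card_filter_le _ _).trans (by simp)
  rw [Expr.rankQuery, eval_sum hgroup (by rw [htotal]; omega), htotal]

end Query

end RankDS

/-! ## Storing an affine class of packed sequences -/

namespace RankDS

/-- The total width of the first `n` fields. -/
def offset (b : ℕ → ℕ) (n : ℕ) : ℕ := ∑ i ∈ Finset.range n, b i

/-- The field number `i` of `N`, where the field `i` has `b i` bits. -/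
def field (b : ℕ → ℕ) (N i : ℕ) : ℕ := N / 2 ^ offset b i % 2 ^ b i

theorem offset_succ (b : ℕ → ℕ) (n : ℕ) : offset b (n + 1) = offset b n + b n :=
  Finset.sum_range_succ _ _

theorem offset_mono (b : ℕ → ℕ) {i n : ℕ} (h : i ≤ n) : offset b i ≤ offset b n :=
  Finset.sum_le_sum_of_subset (Finset.range_subset_range.2 h)

theorem offset_add_le (b : ℕ → ℕ) {i n : ℕ} (h : i < n) : offset b i + b i ≤ offset b n := by
  rw [← offset_succ]; exact offset_mono b h

theorem field_lt (b : ℕ → ℕ) (N i : ℕ) : field b N i < 2 ^ b i := Nat.mod_lt _ (Nat.two_pow_pos _)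

theorem field_mod {b : ℕ → ℕ} {N i n : ℕ} (h : i < n) :
    field b (N % 2 ^ offset b n) i = field b N i :=
  mod_two_pow_div_mod _ _ _ _ (offset_add_le b h)

theorem field_xor (b : ℕ → ℕ) (x y i : ℕ) : field b (x ^^^ y) i = field b x i ^^^ field b y i := by
  apply Nat.eq_of_testBit_eq
  intro k
  simp only [field, Nat.testBit_xor, Nat.testBit_mod_two_pow, Nat.testBit_div_two_pow]
  by_cases hk : k < b i <;> simp [hk]

theorem exists_field_eq (b v : ℕ → ℕ) (n : ℕ) (h : ∀ i < n, v i < 2 ^ b i) :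
    ∃ N < 2 ^ offset b n, ∀ i < n, field b N i = v i := by
  induction n with
  | zero => exact ⟨0, by simp, by simp⟩
  | succ n ih =>
    obtain ⟨N, hN, hv⟩ := ih fun i hi => h i (by omega)
    have hn := h n (by omega)
    refine ⟨N + 2 ^ offset b n * v n, ?_, fun i hi => ?_⟩
    · rw [offset_succ, pow_add]
      calc N + 2 ^ offset b n * v n < 2 ^ offset b n + 2 ^ offset b n * v n := by omega
        _ = 2 ^ offset b n * (v n + 1) := by ring
        _ ≤ 2 ^ offset b n * 2 ^ b n := Nat.mul_le_mul_left _ hn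
    · rcases Nat.lt_succ_iff_lt_or_eq.1 hi with hi | rfl
      · rw [← field_mod hi, Nat.add_mul_mod_self_left, field_mod hi, hv i hi]
      · rw [field, Nat.add_mul_div_left _ _ (Nat.two_pow_pos _), Nat.div_eq_of_lt hN, Nat.zero_add,
          Nat.mod_eq_of_lt hn]

theorem eq_of_field_eq {b : ℕ → ℕ} {n N N' : ℕ} (hN : N < 2 ^ offset b n)
    (hN' : N' < 2 ^ offset b n) (h : ∀ i < n, field b N i = field b N' i) : N = N' := by
  induction n generalizing N N' with
  | zero => simp [offset] at hN hN'; omega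
  | succ n ih =>
    have hmod : N % 2 ^ offset b n = N' % 2 ^ offset b n := by
      refine ih (Nat.mod_lt _ (Nat.two_pow_pos _)) (Nat.mod_lt _ (Nat.two_pow_pos _)) fun i hi => ?_
      rw [field_mod hi, field_mod hi, h i (by omega)]
    have hdiv : ∀ x < 2 ^ offset b (n + 1), x / 2 ^ offset b n = field b x n := by
      intro x hx
      rw [offset_succ, pow_add] at hx
      rw [field, Nat.mod_eq_of_lt (Nat.div_lt_of_lt_mul hx)]
    rw [← Nat.mod_add_div N (2 ^ offset b n), ← Nat.mod_add_div N' (2 ^ offset b n), hmod,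
      hdiv N hN, hdiv N' hN', h n (by omega)]

/-- Used to make the free bits fit into the `ℓ` bits of `M`: the fields are kept until the memory is
full, one may be shortened, and the later ones become empty. -/
theorem exists_truncation (b : ℕ → ℕ) (ℓ : ℕ) :
    ∃ b' : ℕ → ℕ, (∀ i, b' i ≤ b i) ∧ ∀ n, offset b' n = min (offset b n) ℓ := by
  refine ⟨fun i => min (offset b (i + 1)) ℓ - min (offset b i) ℓ, fun i => ?_, fun n => ?_⟩
  · have := offset_succ b i
    show min (offset b (i + 1)) ℓ - min (offset b i) ℓ ≤ b i
    omega
  · induction n with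
    | zero => simp [offset]
    | succ n ih =>
      rw [offset_succ, ih]
      have := offset_succ b n
      omega

theorem card_le_of_field_mod {b e : ℕ → ℕ} {n : ℕ} {A : Finset ℕ}
    (hA : ∀ a ∈ A, a < 2 ^ offset b n)
    (h : ∀ a ∈ A, ∀ a' ∈ A, (∀ i < n, field b a i % 2 ^ e i = field b a' i % 2 ^ e i) →
      ∀ i < n, field b a i = field b a' i) : A.card ≤ 2 ^ offset e n := by
  choose F hF hFv using fun a => exists_field_eq e (fun i => field b a i % 2 ^ e i) n
    fun i _ => Nat.mod_lt _ (Nat.two_pow_pos _)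
  have hle := Finset.card_le_card_of_injOn (s := A) (t := Finset.range (2 ^ offset e n)) F
    (fun a _ => Finset.mem_coe.2 (Finset.mem_range.2 (hF a))) (fun a ha a' ha' haa => by
      refine eq_of_field_eq (hA a ha) (hA a' ha') (h a ha a' ha' fun i hi => ?_)
      rw [← hFv a i hi, ← hFv a' i hi, haa])
  simpa using hle

/-- A linear complement of the subspace `Y` in `W`, with coordinates in `n` bits. As long as `Y` is
not all of `W`, a vector `v` outside `Y` doubles it and contributes one coordinate; the induction is
on the number of missing elements. -/
theorem exists_xorComplement {W : Finset ℕ} (hW : ∀ a ∈ W, ∀ b ∈ W, a ^^^ b ∈ W) (d : ℕ) :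
    ∀ Y : Finset ℕ, W.card - Y.card ≤ d → Y ⊆ W → 0 ∈ Y → (∀ a ∈ Y, ∀ b ∈ Y, a ^^^ b ∈ Y) →
      ∃ n f, XorLinear f ∧ 2 ^ n * Y.card = W.card ∧
        ∀ w ∈ W, ∃ h < 2 ^ n, ∃ y ∈ Y, w = f h ^^^ y := by
  classical
  induction d with
  | zero =>
    intro Y hd hYW _ _
    have hEq : Y = W := Finset.eq_of_subset_of_card_le hYW (by omega)
    subst hEq
    exact ⟨0, fun _ => 0, fun _ _ => by simp, by simp, fun w hw => ⟨0, by simp, w, hw, by simp⟩⟩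
  | succ d ih =>
    intro Y hd hYW h0 hY
    by_cases hEq : W ⊆ Y
    · have hEq : Y = W := Finset.Subset.antisymm hYW hEq
      subst hEq
      exact ⟨0, fun _ => 0, fun _ _ => by simp, by simp, fun w hw => ⟨0, by simp, w, hw, by simp⟩⟩
    obtain ⟨v, hvW, hvY⟩ := Finset.not_subset.1 hEq
    have hdisj : Disjoint Y (Y.image (v ^^^ ·)) := by
      rw [Finset.disjoint_left]
      intro a ha ha'
      obtain ⟨y, hy, rfl⟩ := Finset.mem_image.1 ha'
      have := hY _ ha _ hy
      rw [Nat.xor_assoc, Nat.xor_self, Nat.xor_zero] at this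
      exact hvY this
    have hcard : (Y ∪ Y.image (v ^^^ ·)).card = 2 * Y.card := by
      rw [Finset.card_union_of_disjoint hdisj, Finset.card_image_of_injective _
        (fun a b hab => Nat.xor_right_injective hab), two_mul]
    have hpos : 0 < Y.card := Finset.card_pos.2 ⟨0, h0⟩
    have hmem : ∀ a, a ∈ Y ∪ Y.image (v ^^^ ·) ↔ a ∈ Y ∨ v ^^^ a ∈ Y := by
      intro a
      rw [Finset.mem_union, Finset.mem_image]
      refine or_congr_right ⟨?_, fun h => ⟨_, h, by rw [← Nat.xor_assoc, Nat.xor_self, Nat.zero_xor]⟩⟩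
      rintro ⟨y, hy, rfl⟩
      rwa [← Nat.xor_assoc, Nat.xor_self, Nat.zero_xor]
    obtain ⟨n, f, hf, hn, hcov⟩ := ih (Y ∪ Y.image (v ^^^ ·)) (by omega)
      (by
        refine Finset.union_subset hYW fun a ha => ?_
        obtain ⟨y, hy, rfl⟩ := Finset.mem_image.1 ha
        exact hW _ hvW _ (hYW hy))
      (Finset.mem_union_left _ h0)
      (by
        intro a ha b hb
        rw [hmem] at *
        rcases ha with ha | ha <;> rcases hb with hb | hb
        · exact Or.inl (hY _ ha _ hb)
        · right
          rw [show v ^^^ (a ^^^ b) = a ^^^ (v ^^^ b) by ac_rfl]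
          exact hY _ ha _ hb
        · right
          rw [← Nat.xor_assoc]
          exact hY _ ha _ hb
        · left
          have := hY _ ha _ hb
          rwa [Nat.xor_comm v a, Nat.xor_assoc, ← Nat.xor_assoc v v, Nat.xor_self,
            Nat.zero_xor] at this)
    refine ⟨n + 1, fun h => f (h / 2) ^^^ (if h.testBit 0 then v else 0), ?_, ?_, ?_⟩
    · intro x y
      have key : ∀ c d : Bool, (if (c ^^ d) then v else 0) =
          (if c then v else 0) ^^^ (if d then v else 0) := by
        intro c d; cases c <;> cases d <;> simp
      beta_reduce
      rw [show (x ^^^ y) / 2 = x / 2 ^^^ y / 2 from Nat.xor_div_two, hf, Nat.testBit_xor, key]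
      ac_rfl
    · rw [← hn, hcard]; ring
    · intro w hw
      obtain ⟨h, hh, y, hy, rfl⟩ := hcov w hw
      rw [hmem] at hy
      rcases hy with hy | hy
      · refine ⟨2 * h, by rw [pow_succ]; omega, y, hy, ?_⟩
        simp [Nat.testBit_zero]
      · refine ⟨2 * h + 1, by rw [pow_succ]; omega, _, hy, ?_⟩
        have h1 : (2 * h + 1) / 2 = h := by omega
        have h2 : (2 * h + 1).testBit 0 = true := by simp [Nat.testBit_zero]
        simp only [h1, h2, if_true]
        rw [Nat.xor_assoc, ← Nat.xor_assoc v v, Nat.xor_self, Nat.zero_xor]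

/-- A set of sequences of `I` numbers of `Λ` bits, packed into single numbers, that is affine over
the field with two elements and in which the low `b i` bits of the element number `i` are free. -/
structure IsXorClass (Λ I H : ℕ) (A : Finset ℕ) (b : ℕ → ℕ) : Prop where
  nonempty : A.Nonempty
  lt : ∀ a ∈ A, a < 2 ^ offset (fun _ => Λ) I
  xor_mem : ∀ a₁ ∈ A, ∀ a₂ ∈ A, ∀ a₃ ∈ A, a₁ ^^^ a₂ ^^^ a₃ ∈ A
  free : ∀ a ∈ A, ∀ y < 2 ^ offset (fun _ => Λ) I,
    (∀ i < I, field (fun _ => Λ) y i < 2 ^ b i) → a ^^^ y ∈ A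
  width_le : ∀ i < I, b i ≤ Λ
  card_le : A.card ≤ 2 ^ (offset b I + H)

theorem xorSum_xor (f g : ℕ → ℕ) (n : ℕ) :
    xorSum (fun j => f j ^^^ g j) n = xorSum f n ^^^ xorSum g n := by
  induction n with
  | zero => simp [xorSum]
  | succ n ih =>
    simp only [xorSum] at *
    rw [ih]
    ac_rfl

theorem xorSum_single (v : ℕ) (n : ℕ) : xorSum (fun j => if j = 0 then v else 0) (n + 1) = v := by
  induction n with
  | zero => simp [xorSum]
  | succ n ih => rw [xorSum, ih]; simp

/-- Translating the class by one member `a₀` gives a linear space that contains the space `Y` of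
free low bits. A member is `a₀`, plus a vector of a complement of `Y`, plus a vector of `Y`. The
coordinates of the second are the header and the bits of the third are the body; comparing
cardinalities bounds the header by `H` bits. -/
theorem IsXorClass.exists_payload {Λ I H q J : ℕ} {A : Finset ℕ} {b : ℕ → ℕ}
    (h : IsXorClass Λ I H A b) (hHJ : H ≤ q * J) (hJ : 1 ≤ J) :
    ∃ acc : ℕ → ℕ → ℕ → ℕ, (∀ i j d, acc i j d < 2 ^ Λ) ∧ ∀ a ∈ A, ∃ p < A.card, ∀ i < I,
      xorSum (fun j => acc i j (p / 2 ^ offset b I / (2 ^ q) ^ j % 2 ^ q)) J ^^^ field b p i =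
        field (fun _ => Λ) a i := by
  classical
  obtain ⟨a₀, ha₀⟩ := h.nonempty
  set S := 2 ^ offset (fun _ => Λ) I with hS
  set Y := (Finset.range S).filter fun y => ∀ i < I, field (fun _ => Λ) y i < 2 ^ b i with hY
  have hYmem : ∀ y, y ∈ Y ↔ y < S ∧ ∀ i < I, field (fun _ => Λ) y i < 2 ^ b i := fun y => by
    rw [hY, Finset.mem_filter, Finset.mem_range]
  have hA' : ∀ a, a ∈ A.image (a₀ ^^^ ·) ↔ a₀ ^^^ a ∈ A := by
    intro a
    rw [Finset.mem_image]
    refine ⟨?_, fun h => ⟨_, h, by rw [← Nat.xor_assoc, Nat.xor_self, Nat.zero_xor]⟩⟩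
    rintro ⟨y, hy, rfl⟩
    rwa [← Nat.xor_assoc, Nat.xor_self, Nat.zero_xor]
  obtain ⟨n, f, hf, hn, hcov⟩ := exists_xorComplement (W := A.image (a₀ ^^^ ·))
    (by
      intro a ha c hc
      rw [hA'] at *
      have := h.xor_mem _ ha _ ha₀ _ hc
      rwa [show a₀ ^^^ a ^^^ a₀ ^^^ (a₀ ^^^ c) = a₀ ^^^ (a ^^^ c) ^^^ (a₀ ^^^ a₀) by ac_rfl,
        Nat.xor_self, Nat.xor_zero] at this) _ Y le_rfl
    (by
      intro y hy
      rw [hYmem] at hy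
      rw [hA']
      exact h.free _ ha₀ _ hy.1 hy.2)
    (by
      rw [hYmem]
      exact ⟨Nat.two_pow_pos _, fun i _ => by simp [field]⟩)
    (by
      intro x hx y hy
      rw [hYmem] at *
      refine ⟨Nat.xor_lt_two_pow hx.1 hy.1, fun i hi => ?_⟩
      rw [field_xor]
      exact Nat.xor_lt_two_pow (hx.2 i hi) (hy.2 i hi))
  rw [Finset.card_image_of_injective _ (fun a b hab => Nat.xor_right_injective hab)] at hn
  have hYcard : 2 ^ offset b I ≤ Y.card := by
    choose F hF hFv using fun N => exists_field_eq (fun _ => Λ) (fun i => if i < I then field b N i else 0) I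
      fun i hi => by
        rw [if_pos hi]
        exact lt_of_lt_of_le (field_lt b N i) (Nat.pow_le_pow_right (by norm_num) (h.width_le i hi))
    have := Finset.card_le_card_of_injOn (s := Finset.range (2 ^ offset b I)) (t := Y) F
      (fun N _ => Finset.mem_coe.2 ((hYmem _).2 ⟨hF N, fun i hi => by
        rw [hFv N i hi, if_pos hi]; exact field_lt b N i⟩))
      (fun N hN N' hN' hNN => by
        rw [Finset.mem_coe, Finset.mem_range] at hN hN'
        refine eq_of_field_eq hN hN' fun i hi => ?_
        have h1 := hFv N i hi
        rw [hNN, hFv N' i hi, if_pos hi, if_pos hi] at h1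
        exact h1.symm)
    simpa using this
  have hnI : 2 ^ (offset b I + n) ≤ A.card := by
    rw [← hn, pow_add, Nat.mul_comm]; exact Nat.mul_le_mul_left _ hYcard
  have hnH : n ≤ H := by
    have := (Nat.pow_le_pow_iff_right (by norm_num : 1 < 2)).1 (hnI.trans h.card_le)
    omega
  -- The translation by `a₀` is charged to the digit number `0`, so the exclusive sum over the
  -- digits includes it exactly once; this uses `1 ≤ J`.
  refine ⟨fun i j d => field (fun _ => Λ) (f (d * (2 ^ q) ^ j)) i ^^^
    (if j = 0 then field (fun _ => Λ) a₀ i else 0), fun i j d => ?_, fun a ha => ?_⟩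
  · refine Nat.xor_lt_two_pow (field_lt _ _ i) ?_
    split_ifs
    · exact field_lt _ _ i
    · exact Nat.two_pow_pos _
  obtain ⟨k, hk, y, hy, hky⟩ := hcov (a₀ ^^^ a) (by
    rw [hA', ← Nat.xor_assoc, Nat.xor_self, Nat.zero_xor]; exact ha)
  have ha' : a = a₀ ^^^ (f k ^^^ y) := by
    rw [← hky, ← Nat.xor_assoc, Nat.xor_self, Nat.zero_xor]
  rw [hYmem] at hy
  obtain ⟨N, hN, hNv⟩ := exists_field_eq b (fun i => field (fun _ => Λ) y i) I hy.2
  have hp : (N + 2 ^ offset b I * k) / 2 ^ offset b I = k := by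
    rw [Nat.add_mul_div_left _ _ (Nat.two_pow_pos _), Nat.div_eq_of_lt hN, Nat.zero_add]
  refine ⟨N + 2 ^ offset b I * k, lt_of_lt_of_le ?_ hnI, fun i hi => ?_⟩
  · rw [pow_add]
    calc N + 2 ^ offset b I * k < 2 ^ offset b I + 2 ^ offset b I * k := by omega
      _ = 2 ^ offset b I * (k + 1) := by ring
      _ ≤ 2 ^ offset b I * 2 ^ n := Nat.mul_le_mul_left _ hk
  · rw [hp, xorSum_xor, ← field_mod (b := b) hi, Nat.add_mul_mod_self_left, field_mod hi, hNv i hi,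
      ha', field_xor, field_xor]
    obtain ⟨J, rfl⟩ : ∃ J', J = J' + 1 := ⟨J - 1, by omega⟩
    have hlin : XorLinear fun k => field (fun _ => Λ) (f k) i := fun x y => by
      beta_reduce
      rw [hf, field_xor]
    rw [xorSum_single, ← hlin.eq_xorSum q (J + 1) k (by
      exact hk.trans_le (Nat.pow_le_pow_right (by norm_num) (by omega)))]
    ac_rfl

/-- Cutting the free bits down to `ℓ` keeps the body inside `M`. The header bound survives, because
a class has at most `2 ^ (ℓ + κ + 1)` members and `κ + 1 ≤ H`. -/
theorem exists_layout {q J H Λ I ℓ τ κ : ℕ} {A : ℕ → Finset ℕ} {b : ℕ → ℕ → ℕ}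
    (h : ∀ t < τ, IsXorClass Λ I H (A t) (b t)) (hHJ : H ≤ q * J) (hJ : 1 ≤ J) (hκ : κ + 1 ≤ H)
    (hℓ : ∀ t < τ, (A t).card ≤ 2 ^ (ℓ + κ + 1)) :
    ∃ L : Layout q J H Λ I ℓ τ fun t => (A t).card, ∀ t < τ, ∀ a ∈ A t, ∃ p < (A t).card, ∀ i < I,
      L.comp t p i = field (fun _ => Λ) a i := by
  choose b' hb' hoff using fun t => exists_truncation (b t) ℓ
  have hclass : ∀ t < τ, IsXorClass Λ I H (A t) (b' t) := by
    intro t ht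
    have := h t ht
    refine ⟨this.nonempty, this.lt, this.xor_mem, fun a ha y hy hyb => this.free a ha y hy
      fun i hi => lt_of_lt_of_le (hyb i hi) (Nat.pow_le_pow_right (by norm_num) (hb' t i)),
      fun i hi => (hb' t i).trans (this.width_le i hi), ?_⟩
    rw [hoff]
    rcases le_total (offset (b t) I) ℓ with hle | hle
    · rw [min_eq_left hle]; exact this.card_le
    · rw [min_eq_right hle]
      exact (hℓ t ht).trans (Nat.pow_le_pow_right (by norm_num) (by omega))
  have hpay : ∀ t, ∃ acc : ℕ → ℕ → ℕ → ℕ, t < τ → (∀ i j d, acc i j d < 2 ^ Λ) ∧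
      ∀ a ∈ A t, ∃ p < (A t).card, ∀ i < I,
        xorSum (fun j => acc i j (p / 2 ^ offset (b' t) I / (2 ^ q) ^ j % 2 ^ q)) J ^^^
          field (b' t) p i = field (fun _ => Λ) a i := by
    intro t
    by_cases ht : t < τ
    · obtain ⟨acc, h1⟩ := (hclass t ht).exists_payload hHJ hJ
      exact ⟨acc, fun _ => h1⟩
    · exact ⟨fun _ _ _ => 0, fun h => absurd h ht⟩
  choose acc hacc using hpay
  exact ⟨{
    body := fun t => offset (b' t) I
    acc := acc
    off := fun t => offset (b' t)
    width := b'
    body_le := fun t _ => by rw [hoff]; exact min_le_right _ _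
    off_add_width_le := fun t _ i hi => offset_add_le _ hi
    width_le := fun t ht => (hclass t ht).width_le
    acc_lt := fun t ht i _ j _ d _ => (hacc t ht).1 i j d
    count_le := fun t ht => (hclass t ht).card_le }, fun t ht => (hacc t ht).2⟩

end RankDS

/-! ## The class of the sequences with prescribed splitting positions -/

namespace RankDS

/-- Splitting at `d` fixes two bits and equates pairs of bits, so it is an affine condition: it
passes to sums of three solutions. -/
theorem SplitAt.xor_xor {a₁ a₂ a₃ b₁ b₂ b₃ d : ℕ} (h₁ : SplitAt a₁ b₁ d) (h₂ : SplitAt a₂ b₂ d)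
    (h₃ : SplitAt a₃ b₃ d) : SplitAt (a₁ ^^^ a₂ ^^^ a₃) (b₁ ^^^ b₂ ^^^ b₃) d := by
  refine ⟨?_, ?_, fun e he => ?_⟩
  · simp [h₁.1, h₂.1, h₃.1]
  · simp [h₁.2.1, h₂.2.1, h₃.2.1]
  · simp [h₁.2.2 e he, h₂.2.2 e he, h₃.2.2 e he]

theorem SplitAt.xor_low {a b d u v : ℕ} (h : SplitAt a b d) (hu : u < 2 ^ d) (hv : v < 2 ^ d) :
    SplitAt (a ^^^ u) (b ^^^ v) d := by
  have hbit : ∀ {u e : ℕ}, u < 2 ^ d → d ≤ e → u.testBit e = false := fun hu he =>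
    Nat.testBit_lt_two_pow (hu.trans_le (Nat.pow_le_pow_right (by norm_num) he))
  refine ⟨?_, ?_, fun e he => ?_⟩
  · simp [h.1, hbit hu le_rfl]
  · simp [h.2.1, hbit hv le_rfl]
  · simp [h.2.2 e he, hbit hu he.le, hbit hv he.le]

theorem SplitAt.eq_of_mod_eq {a a' b d : ℕ} (h : SplitAt a b d) (h' : SplitAt a' b d)
    (hmod : a % 2 ^ d = a' % 2 ^ d) : a = a' := by
  apply Nat.eq_of_testBit_eq
  intro e
  rcases lt_trichotomy e d with he | rfl | he
  · have := congrArg (fun x => x.testBit e) hmod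
    simpa [Nat.testBit_mod_two_pow, he] using this
  · rw [h.1, h'.1]
  · rw [h.2.2 e he, h'.2.2 e he]

theorem xor_div_two_pow (x y w : ℕ) : (x ^^^ y) / 2 ^ w = x / 2 ^ w ^^^ y / 2 ^ w := by
  apply Nat.eq_of_testBit_eq
  intro i
  simp only [Nat.testBit_xor, Nat.testBit_div_two_pow]

/-- The element number `i` of the packed sequence `a` of length `m`, continued by `V`. -/
def element (Λ m V a i : ℕ) : ℕ := if i < m then field (fun _ => Λ) a i else V

theorem element_of_lt {Λ m V a i : ℕ} (h : i < m) : element Λ m V a i = field (fun _ => Λ) a i :=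
  if_pos h

theorem element_self (Λ m V a : ℕ) : element Λ m V a m = V := if_neg (lt_irrefl m)

theorem element_xor_xor (Λ m V a₁ a₂ a₃ i : ℕ) : element Λ m V (a₁ ^^^ a₂ ^^^ a₃) i =
    element Λ m V a₁ i ^^^ element Λ m V a₂ i ^^^ element Λ m V a₃ i := by
  unfold element
  split_ifs
  · rw [field_xor, field_xor]
  · rw [Nat.xor_self, Nat.zero_xor]

theorem element_xor (Λ m V a y i : ℕ) : element Λ m V (a ^^^ y) i =
    element Λ m V a i ^^^ element Λ m 0 y i := by
  unfold element
  split_ifs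
  · rw [field_xor]
  · rw [Nat.xor_zero]

open Classical in
/-- The packed sequences of `m` elements below `2 ^ r`, of which the first `k` split from their
successors at the positions `d i`, followed by `G` fields that agree with `g` from the bit `w` on. -/
noncomputable def splitClass (Λ m G V r k : ℕ) (d : ℕ → ℕ) (w : ℕ) (g : ℕ → ℕ) : Finset ℕ :=
  (Finset.range (2 ^ offset (fun _ => Λ) (m + G))).filter fun a =>
    (∀ i < m, field (fun _ => Λ) a i < 2 ^ r) ∧
      (∀ i < k, SplitAt (element Λ m V a i) (element Λ m V a (i + 1)) (d i)) ∧
      ∀ γ < G, field (fun _ => Λ) a (m + γ) / 2 ^ w = g γ / 2 ^ w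

/-- The number of low bits of the element number `i` that the splitting position restricts. -/
def splitWidth (m r k : ℕ) (d : ℕ → ℕ) (w i : ℕ) : ℕ :=
  if i < m then (if i < k then d i else r) else w

/-- The number of low bits of the element number `i` that are free. -/
def freeWidth (m r k : ℕ) (d : ℕ → ℕ) (w : ℕ) : ℕ → ℕ
  | 0 => splitWidth m r k d w 0
  | i + 1 => if i + 1 < m then
      min (splitWidth m r k d w (i + 1)) (splitWidth m r k d w i) else w

section SplitClass

variable {Λ m G V r k w : ℕ} {d g : ℕ → ℕ}

theorem mem_splitClass {a : ℕ} : a ∈ splitClass Λ m G V r k d w g ↔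
    a < 2 ^ offset (fun _ => Λ) (m + G) ∧ (∀ i < m, field (fun _ => Λ) a i < 2 ^ r) ∧
      (∀ i < k, SplitAt (element Λ m V a i) (element Λ m V a (i + 1)) (d i)) ∧
      ∀ γ < G, field (fun _ => Λ) a (m + γ) / 2 ^ w = g γ / 2 ^ w := by
  simp only [splitClass, Finset.mem_filter, Finset.mem_range]

theorem splitWidth_add {γ : ℕ} : splitWidth m r k d w (m + γ) = w := if_neg (by omega)

theorem splitWidth_le (hd : ∀ i < k, d i < r) {i : ℕ} (hi : i < m) :
    splitWidth m r k d w i ≤ r := by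
  rw [splitWidth, if_pos hi]
  split_ifs with h
  · exact (hd i h).le
  · exact le_rfl

theorem freeWidth_le (i : ℕ) : freeWidth m r k d w i ≤ splitWidth m r k d w i := by
  cases i with
  | zero => exact le_rfl
  | succ i =>
    rw [freeWidth]
    split_ifs with h
    · exact min_le_left _ _
    · rw [splitWidth, if_neg h]

theorem freeWidth_succ_le {i : ℕ} (hi : i + 1 < m) :
    freeWidth m r k d w (i + 1) ≤ splitWidth m r k d w i := by
  rw [freeWidth, if_pos hi]
  exact min_le_right _ _

/-- The bits of an element are free when they lie below its own splitting position and below that of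
its predecessor. As all widths are at most `r`, the second restriction costs at most the saving `r -
d i` of the predecessor. -/
theorem offset_splitWidth_le (hd : ∀ i < k, d i < r) (n : ℕ) :
    offset (splitWidth m r k d w) (n + 1) ≤
      offset (freeWidth m r k d w) (n + 1) + ∑ i ∈ Finset.range n, if i < k then r - d i else 0 := by
  induction n with
  | zero => simp [offset, freeWidth]
  | succ n ih =>
    rw [offset_succ, offset_succ _ (n + 1), Finset.sum_range_succ]
    have : splitWidth m r k d w (n + 1) ≤
        freeWidth m r k d w (n + 1) + if n < k then r - d n else 0 := by
      rw [freeWidth]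
      by_cases h : n + 1 < m
      · have h1 := splitWidth_le (w := w) hd h
        rw [if_pos h]
        by_cases hk : n < k
        · have := hd n hk
          rw [if_pos hk, show splitWidth m r k d w n = d n by
            rw [splitWidth, if_pos (by omega), if_pos hk]]
          omega
        · rw [if_neg hk, show splitWidth m r k d w n = r by
            rw [splitWidth, if_pos (by omega), if_neg hk]]
          omega
      · rw [if_neg h, splitWidth, if_neg h]
        omega
    omega

/-- The sequence is rebuilt from its end: `V` is known, and the successor together with the bits
below the splitting position determines an element. -/
theorem card_splitClass_le : (splitClass Λ m G V r k d w g).card ≤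
    2 ^ offset (splitWidth m r k d w) (m + G) := by
  refine card_le_of_field_mod (b := fun _ => Λ) (fun a ha => (mem_splitClass.1 ha).1) ?_
  intro a ha a' ha' h
  rw [mem_splitClass] at ha ha'
  have hel : ∀ n i, i + n = m → element Λ m V a i = element Λ m V a' i := by
    intro n
    induction n with
    | zero =>
      intro i hi
      rw [show i = m by omega, element_self, element_self]
    | succ n ih =>
      intro i hi
      have hm : i < m := by omega
      have hmod := h i (by omega)
      by_cases hik : i < k
      · have h1 := ha.2.2.1 i hik
        have h2 := ha'.2.2.1 i hik
        rw [← ih (i + 1) (by omega)] at h2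
        refine h1.eq_of_mod_eq h2 ?_
        rw [splitWidth, if_pos hm, if_pos hik] at hmod
        rwa [element_of_lt hm, element_of_lt hm]
      · rw [splitWidth, if_pos hm, if_neg hik, Nat.mod_eq_of_lt (ha.2.1 i hm),
          Nat.mod_eq_of_lt (ha'.2.1 i hm)] at hmod
        rwa [element_of_lt hm, element_of_lt hm]
  intro i hi
  by_cases him : i < m
  · have := hel (m - i) i (by omega)
    rwa [element_of_lt him, element_of_lt him] at this
  · obtain ⟨γ, rfl⟩ : ∃ γ, i = m + γ := ⟨i - m, by omega⟩
    have h1 := h (m + γ) hi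
    rw [splitWidth_add] at h1
    rw [← Nat.mod_add_div (field _ a (m + γ)) (2 ^ w), ← Nat.mod_add_div (field _ a' (m + γ)) (2 ^ w),
      h1, ha.2.2.2 γ (by omega), ha'.2.2.2 γ (by omega)]

/-- The header bound `H` only has to cover the total saving, since the bits that are determined
freely from the end exceed the bits that may be changed independently by at most that amount. -/
theorem isXorClass_splitClass {H : ℕ} (hk : k ≤ m) (hd : ∀ i < k, d i < r) (hr : r ≤ Λ) (hw : w ≤ Λ)
    (hH : ∑ i ∈ Finset.range k, (r - d i) ≤ H) (hne : (splitClass Λ m G V r k d w g).Nonempty) :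
    IsXorClass Λ (m + G) H (splitClass Λ m G V r k d w g) (freeWidth m r k d w) := by
  refine ⟨hne, fun a ha => (mem_splitClass.1 ha).1, ?_, ?_, fun i hi => ?_, ?_⟩
  · intro a₁ h₁ a₂ h₂ a₃ h₃
    rw [mem_splitClass] at *
    refine ⟨Nat.xor_lt_two_pow (Nat.xor_lt_two_pow h₁.1 h₂.1) h₃.1, fun i hi => ?_, fun i hi => ?_,
      fun γ hγ => ?_⟩
    · rw [field_xor, field_xor]
      exact Nat.xor_lt_two_pow (Nat.xor_lt_two_pow (h₁.2.1 i hi) (h₂.2.1 i hi)) (h₃.2.1 i hi)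
    · rw [element_xor_xor, element_xor_xor]
      exact (h₁.2.2.1 i hi).xor_xor (h₂.2.2.1 i hi) (h₃.2.2.1 i hi)
    · rw [field_xor, field_xor, xor_div_two_pow, xor_div_two_pow, h₁.2.2.2 γ hγ, h₂.2.2.2 γ hγ,
        h₃.2.2.2 γ hγ, Nat.xor_self, Nat.zero_xor]
  · intro a ha y hy hyb
    rw [mem_splitClass] at *
    have hlow : ∀ {n i : ℕ}, i < m → freeWidth m r k d w i ≤ n → field (fun _ => Λ) y i < 2 ^ n :=
      fun hi h => (hyb _ (by omega)).trans_le (Nat.pow_le_pow_right (by norm_num) h)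
    refine ⟨Nat.xor_lt_two_pow ha.1 hy, fun i hi => ?_, fun i hi => ?_, fun γ hγ => ?_⟩
    · rw [field_xor]
      exact Nat.xor_lt_two_pow (ha.2.1 i hi)
        (hlow hi ((freeWidth_le i).trans (splitWidth_le hd hi)))
    · have hs : splitWidth m r k d w i = d i := by
        rw [splitWidth, if_pos (by omega), if_pos hi]
      rw [element_xor, element_xor]
      refine (ha.2.2.1 i hi).xor_low ?_ ?_
      · rw [element_of_lt (by omega)]
        exact hlow (by omega) (hs ▸ freeWidth_le i)
      · by_cases him : i + 1 < m
        · rw [element_of_lt him]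
          exact hlow him (hs ▸ freeWidth_succ_le him)
        · rw [element, if_neg him]
          exact Nat.two_pow_pos _
    · rw [field_xor, xor_div_two_pow, ha.2.2.2 γ hγ, Nat.div_eq_of_lt (a := field _ y _),
        Nat.xor_zero]
      refine (hyb (m + γ) (by omega)).trans_le (Nat.pow_le_pow_right (by norm_num) ?_)
      exact (freeWidth_le _).trans splitWidth_add.le
  · refine (freeWidth_le i).trans ?_
    by_cases him : i < m
    · exact (splitWidth_le hd him).trans hr
    · rw [splitWidth, if_neg him]; exact hw
  · refine card_splitClass_le.trans (Nat.pow_le_pow_right (by norm_num) ?_)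
    cases hmG : m + G with
    | zero => simp [offset]
    | succ n =>
      refine (offset_splitWidth_le hd n).trans (Nat.add_le_add_left (le_trans ?_ hH) _)
      rw [← Finset.sum_filter]
      refine Finset.sum_le_sum_of_subset fun i hi => ?_
      exact Finset.mem_range.2 (Finset.mem_filter.1 hi).2

theorem offset_splitWidth_add (hk : k ≤ m) (hd : ∀ i < k, d i < r) :
    offset (splitWidth m r k d w) (m + G) + ∑ i ∈ Finset.range k, (r - d i) = m * r + G * w := by
  have h1 : ∀ n ≤ k, offset (splitWidth m r k d w) n + ∑ i ∈ Finset.range n, (r - d i) = n * r := by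
    intro n hn
    induction n with
    | zero => simp [offset]
    | succ n ih =>
      have := ih (by omega)
      have := hd n (by omega)
      rw [offset_succ, Finset.sum_range_succ, Nat.succ_mul,
        show splitWidth m r k d w n = d n by rw [splitWidth, if_pos (by omega), if_pos (by omega)]]
      omega
  have h2 : ∀ n, k + n ≤ m → offset (splitWidth m r k d w) (k + n) =
      offset (splitWidth m r k d w) k + n * r := by
    intro n hn
    induction n with
    | zero => simp
    | succ n ih =>
      rw [← Nat.add_assoc, offset_succ, ih (by omega), splitWidth, if_pos (by omega),
        if_neg (by omega), Nat.succ_mul, Nat.add_assoc]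
  have h3 : ∀ n, offset (splitWidth m r k d w) (m + n) =
      offset (splitWidth m r k d w) m + n * w := by
    intro n
    induction n with
    | zero => simp
    | succ n ih => rw [← Nat.add_assoc, offset_succ, ih, splitWidth_add, Nat.succ_mul, Nat.add_assoc]
  have h4 := h2 (m - k) (by omega)
  rw [Nat.add_sub_cancel' hk] at h4
  have h5 := h1 k le_rfl
  rw [h3, h4]
  have : m * r = k * r + (m - k) * r := by rw [← Nat.add_mul, Nat.add_sub_cancel' hk]
  omega

end SplitClass

end RankDS

/-! ## Types of sets -/

namespace RankDS

/-- The lists of at most `k` numbers of sum at most `B`. -/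
def boundedLists : ℕ → ℕ → Finset (List ℕ)
  | 0, _ => {[]}
  | k + 1, B => {[]} ∪ (Finset.range (B + 1)).biUnion fun u =>
      (boundedLists k (B - u)).image (u :: ·)

theorem mem_boundedLists : ∀ {k B : ℕ} {l : List ℕ}, l.length ≤ k → l.sum ≤ B →
    l ∈ boundedLists k B
  | 0, _, l, h, _ => by
    rw [boundedLists, Finset.mem_singleton]
    exact List.length_eq_zero_iff.1 (by omega)
  | k + 1, B, [], _, _ => by simp [boundedLists]
  | k + 1, B, u :: l, h, hs => by
    rw [List.sum_cons] at hs
    rw [List.length_cons] at h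
    rw [boundedLists, Finset.mem_union, Finset.mem_biUnion]
    exact Or.inr ⟨u, Finset.mem_range.2 (by omega), Finset.mem_image.2
      ⟨l, mem_boundedLists (by omega) (by omega), rfl⟩⟩

/-- Induction on `k` by the first entry. The geometric sum over it equals `(n + 1) * (1 + 1 / n) ^ B
- n`, and the subtracted term pays for the empty list. -/
theorem card_boundedLists_le {n : ℝ} (hn : 0 < n) (hn1 : 1 ≤ n) :
    ∀ k B : ℕ, ((boundedLists k B).card : ℝ) ≤ (n + 1) ^ k * (1 + 1 / n) ^ B := by
  have hgeom : ∀ B : ℕ, ∑ u ∈ Finset.range (B + 1), (1 + 1 / n) ^ (B - u) =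
      (n + 1) * (1 + 1 / n) ^ B - n := by
    intro B
    rw [show ∑ u ∈ Finset.range (B + 1), (1 + 1 / n) ^ (B - u) =
      ∑ u ∈ Finset.range (B + 1), (1 + 1 / n) ^ u from
        Finset.sum_range_reflect (fun u => (1 + 1 / n) ^ u) (B + 1)]
    induction B with
    | zero => simp
    | succ B ih =>
      rw [Finset.sum_range_succ, ih, pow_succ]
      field_simp
      ring
  intro k
  induction k with
  | zero =>
    intro B
    simp only [boundedLists, Finset.card_singleton, pow_zero, one_mul, Nat.cast_one]
    exact one_le_pow₀ (by have := div_pos one_pos hn; linarith)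
  | succ k ih =>
    intro B
    have h1 : (boundedLists (k + 1) B).card ≤
        1 + ∑ u ∈ Finset.range (B + 1), (boundedLists k (B - u)).card := by
      rw [boundedLists]
      refine (Finset.card_union_le _ _).trans (Nat.add_le_add (by simp) ?_)
      exact Finset.card_biUnion_le.trans (Finset.sum_le_sum fun u _ => Finset.card_image_le)
    have h2 : ((boundedLists (k + 1) B).card : ℝ) ≤
        1 + ∑ u ∈ Finset.range (B + 1), (n + 1) ^ k * (1 + 1 / n) ^ (B - u) := by
      refine (Nat.cast_le.2 h1).trans ?_
      push_cast
      exact add_le_add le_rfl (Finset.sum_le_sum fun u _ => ih _)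
    rw [← Finset.mul_sum, hgeom] at h2
    have h3 : 1 ≤ (n + 1) ^ k * n := one_le_mul_of_one_le_of_one_le (one_le_pow₀ (by linarith)) hn1
    rw [pow_succ]
    nlinarith

theorem two_pow_one_add_inv_le (n : ℕ) (hn : 0 < n) : (1 + 1 / (n : ℝ)) ^ n ≤ 4 := by
  have hn' : (0 : ℝ) < n := Nat.cast_pos.2 hn
  have h1 : (1 + 1 / (n : ℝ)) ^ n ≤ Real.exp (1 / n) ^ n := by
    refine pow_le_pow_left₀ (by positivity) ?_ n
    have := Real.add_one_le_exp (1 / (n : ℝ))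
    linarith
  rw [← Real.exp_nat_mul, mul_one_div_cancel hn'.ne'] at h1
  linarith [Real.exp_one_lt_d9]

theorem card_boundedLists_le_two_pow {n j k B C : ℕ} (hn : 0 < n) (hj : n + 1 ≤ 2 ^ j)
    (hC : B ≤ n * C) : (boundedLists k B).card ≤ 2 ^ (j * k + 2 * C) := by
  have hn' : (1 : ℝ) ≤ n := Nat.one_le_cast.2 hn
  have h1 := card_boundedLists_le (n := n) (by linarith) hn' k B
  have h2 : ((n : ℝ) + 1) ^ k ≤ (2 ^ j) ^ k :=
    pow_le_pow_left₀ (by positivity) (by exact_mod_cast hj) k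
  have h3 : (1 + 1 / (n : ℝ)) ^ B ≤ 4 ^ C := by
    calc (1 + 1 / (n : ℝ)) ^ B ≤ (1 + 1 / (n : ℝ)) ^ (n * C) :=
          pow_le_pow_right₀ (by simp) hC
      _ = ((1 + 1 / (n : ℝ)) ^ n) ^ C := pow_mul _ _ _
      _ ≤ 4 ^ C := pow_le_pow_left₀ (by positivity) (two_pow_one_add_inv_le n hn) C
  have h4 : ((boundedLists k B).card : ℝ) ≤ 2 ^ (j * k + 2 * C) := by
    calc _ ≤ _ := h1
      _ ≤ (2 ^ j) ^ k * 4 ^ C := by gcongr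
      _ = 2 ^ (j * k + 2 * C) := by
        rw [pow_add, pow_mul, pow_mul]; norm_num
  exact_mod_cast h4

theorem sum_range_getD : ∀ l : List ℕ, ∑ i ∈ Finset.range l.length, l.getD i 0 = l.sum
  | [] => by simp
  | u :: l => by
    rw [List.length_cons, Finset.sum_range_succ', List.sum_cons, Nat.add_comm]
    simpa using sum_range_getD l

/-- The element number `i` is recognized as the one with exactly `i` smaller elements in the image.
-/
theorem image_range_injOn {f g : ℕ → ℕ} {m : ℕ} (hf : ∀ l, l + 1 < m → f l < f (l + 1))
    (hg : ∀ l, l + 1 < m → g l < g (l + 1))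
    (h : (Finset.range m).image f = (Finset.range m).image g) : ∀ i < m, f i = g i := by
  have hmono : ∀ {f : ℕ → ℕ}, (∀ l, l + 1 < m → f l < f (l + 1)) → ∀ i j, i < j → j < m →
      f i < f j := by
    intro f hf i j hij hj
    induction j, hij using Nat.le_induction with
    | base => exact hf i hj
    | succ j hij ih => exact (ih (by omega)).trans (hf j hj)
  have hcount : ∀ {f : ℕ → ℕ}, (∀ l, l + 1 < m → f l < f (l + 1)) → ∀ i < m,
      (((Finset.range m).image f).filter (· < f i)).card = i := by
    intro f hf i hi
    have : ((Finset.range m).image f).filter (· < f i) = (Finset.range i).image f := by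
      ext y
      simp only [Finset.mem_filter, Finset.mem_image, Finset.mem_range]
      constructor
      · rintro ⟨⟨j, hj, rfl⟩, hlt⟩
        refine ⟨j, ?_, rfl⟩
        by_contra hij
        rcases Nat.eq_or_lt_of_le (not_lt.1 hij) with rfl | hij
        · exact lt_irrefl _ hlt
        · exact absurd (hmono hf i j hij hj) (by omega)
      · rintro ⟨j, hj, rfl⟩
        exact ⟨⟨j, by omega, rfl⟩, hmono hf j i hj hi⟩
    rw [this, Finset.card_image_of_injOn, Finset.card_range]
    intro a ha b hb hab
    simp only [Finset.coe_range, Set.mem_Iio] at ha hb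
    by_contra hne
    rcases Nat.lt_or_gt_of_ne hne with hlt | hlt
    · have := hmono hf a b hlt (by omega); omega
    · have := hmono hf b a hlt (by omega); omega
  intro i hi
  have hmem : f i ∈ (Finset.range m).image g := by
    rw [← h]; exact Finset.mem_image_of_mem f (Finset.mem_range.2 hi)
  obtain ⟨j, hj, hji⟩ := Finset.mem_image.1 hmem
  rw [Finset.mem_range] at hj
  have h1 := hcount hf i hi
  rw [h, ← hji, hcount hg j hj] at h1
  rw [← hji, h1]

theorem exists_groupCode {z b q r : ℕ} (hzb : z * b ≤ q) (hr : r < 2 ^ z) (d : ℕ → ℕ) (lo : ℕ) :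
    ∃ g < 2 ^ q, ∀ l, lo ≤ l → l < lo + b → d l < r → codeDigit z g (l - lo) = d l + 1 := by
  have hoff : ∀ n, offset (fun _ => z) n = z * n := fun n => by
    simp [offset, Nat.mul_comm]
  obtain ⟨g, hg, hv⟩ := exists_field_eq (fun _ => z)
    (fun i => if d (lo + i) < r then d (lo + i) + 1 else 0) b
    (fun i _ => by split_ifs <;> omega)
  refine ⟨g, hg.trans_le (Nat.pow_le_pow_right (by norm_num) (by rwa [hoff])), fun l h1 h2 hl => ?_⟩
  have := hv (l - lo) (by omega)
  rw [Nat.add_sub_cancel' h1, if_pos hl, field, hoff] at this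
  exact this

/-- The splitting positions that a type prescribes. -/
def typeSplit (r : ℕ) (l : List ℕ) (i : ℕ) : ℕ := r - l.getD i 0

/-- The sequences of type `l`. If the splits save many bits, the codes are arbitrary. -/
noncomputable def typeClass (Λ m G V r S q : ℕ) (code : (ℕ → ℕ) → ℕ → ℕ) (l : List ℕ) :
    Finset ℕ :=
  if S ≤ l.sum then splitClass Λ m G V r l.length (typeSplit r l) q fun _ => 0
  else splitClass Λ m G V r l.length (typeSplit r l) 0 (code (typeSplit r l))

/-- A type is a list of bit savings, which is cut when its sum reaches `S`. -/
structure IsType (m r S : ℕ) (l : List ℕ) : Prop where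
  length_le : l.length ≤ m
  pos : ∀ i < l.length, 1 ≤ l.getD i 0 ∧ l.getD i 0 ≤ r
  sum_le : l.sum ≤ S + r
  length_eq : l.sum < S → l.length = m

section Types

variable {Λ m G V r S q : ℕ} {code : (ℕ → ℕ) → ℕ → ℕ} {l : List ℕ}

theorem IsType.typeSplit_lt (h : IsType m r S l) : ∀ i < l.length, typeSplit r l i < r := by
  intro i hi
  have := h.pos i hi
  rw [typeSplit]; omega

theorem IsType.sum_typeSplit (h : IsType m r S l) :
    ∑ i ∈ Finset.range l.length, (r - typeSplit r l i) = l.sum := by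
  rw [← sum_range_getD]
  refine Finset.sum_congr rfl fun i hi => ?_
  have := h.pos i (Finset.mem_range.1 hi)
  rw [typeSplit]; omega

theorem IsType.isXorClass (h : IsType m r S l) {H : ℕ} (hr : r ≤ Λ) (hq : q ≤ Λ) (hH : S + r ≤ H)
    (hne : (typeClass Λ m G V r S q code l).Nonempty) :
    ∃ b, IsXorClass Λ (m + G) H (typeClass Λ m G V r S q code l) b := by
  have hsum : ∑ i ∈ Finset.range l.length, (r - typeSplit r l i) ≤ H := by
    rw [h.sum_typeSplit]; exact h.sum_le.trans hH
  unfold typeClass at *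
  split_ifs at * with hS
  · exact ⟨_, isXorClass_splitClass h.length_le h.typeSplit_lt hr hq hsum hne⟩
  · exact ⟨_, isXorClass_splitClass h.length_le h.typeSplit_lt hr (Nat.zero_le _) hsum hne⟩

/-- A cut type gains `S` bits from its splits; the only additional freedom is that of the `G` code
words of `q` bits. -/
theorem IsType.card_mul_le (h : IsType m r S l) (hS : S ≤ l.sum) :
    (typeClass Λ m G V r S q code l).card * 2 ^ S ≤ 2 ^ (m * r + G * q) := by
  rw [typeClass, if_pos hS]
  calc _ ≤ 2 ^ offset (splitWidth m r l.length (typeSplit r l) q) (m + G) * 2 ^ l.sum :=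
        Nat.mul_le_mul card_splitClass_le (Nat.pow_le_pow_right (by norm_num) hS)
    _ = 2 ^ (m * r + G * q) := by
      rw [← pow_add, ← offset_splitWidth_add (G := G) (w := q) h.length_le h.typeSplit_lt,
        h.sum_typeSplit]

theorem element_lt_succ {d g : ℕ → ℕ} {w a : ℕ} (ha : a ∈ splitClass Λ m G V r m d w g) {i : ℕ}
    (hi : i < m) : element Λ m V a i < element Λ m V a (i + 1) :=
  ((mem_splitClass.1 ha).2.2.1 i hi).lt

/-- In an uncut type all elements are below `V` because the sequence increases up to `V`. The set
determines the elements, these determine the splitting positions and so the type, and the type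
determines the codes. Hence the pairs of type and member inject into the `m`-subsets. -/
theorem sum_card_typeClass_le (T : Finset (List ℕ)) (hT : ∀ l ∈ T, IsType m r S l ∧ l.sum < S) :
    ∑ l ∈ T, (typeClass Λ m G V r S q code l).card ≤ V.choose m := by
  classical
  have hcard : V.choose m = (Finset.powersetCard m (Finset.range V)).card := by simp
  rw [← Finset.card_sigma, hcard]
  have hspec : ∀ l ∈ T, ∀ a ∈ typeClass Λ m G V r S q code l,
      a ∈ splitClass Λ m G V r m (typeSplit r l) 0 (code (typeSplit r l)) := by
    intro l hl a ha
    obtain ⟨h1, h2⟩ := hT l hl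
    rwa [typeClass, if_neg (by omega), h1.length_eq h2] at ha
  refine Finset.card_le_card_of_injOn
    (fun x => (Finset.range m).image (element Λ m V x.2)) ?_ ?_
  · rintro ⟨l, a⟩ hx
    rw [Finset.mem_coe, Finset.mem_sigma] at hx
    have ha := hspec l hx.1 a hx.2
    have hlt : ∀ n i, i + n = m → element Λ m V a i ≤ V ∧ (0 < n → element Λ m V a i < V) := by
      intro n
      induction n with
      | zero => intro i hi; rw [show i = m by omega, element_self]; simp
      | succ n ih =>
        intro i hi
        have h1 := element_lt_succ ha (show i < m by omega)
        have h2 := (ih (i + 1) (by omega)).1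
        exact ⟨by omega, fun _ => by omega⟩
    have hmono : ∀ i j, i < j → j < m → element Λ m V a i < element Λ m V a j := by
      intro i j hij hj
      induction j, hij using Nat.le_induction with
      | base => exact element_lt_succ ha (by omega)
      | succ j hij ih => exact (ih (by omega)).trans (element_lt_succ ha (by omega))
    rw [Finset.mem_coe, Finset.mem_powersetCard]
    refine ⟨fun y hy => ?_, ?_⟩
    · obtain ⟨i, hi, rfl⟩ := Finset.mem_image.1 hy
      rw [Finset.mem_range] at hi ⊢
      exact (hlt (m - i) i (by omega)).2 (by omega)
    · rw [Finset.card_image_of_injOn, Finset.card_range]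
      intro i hi j hj hij
      simp only [Finset.coe_range, Set.mem_Iio] at hi hj
      by_contra hne
      rcases Nat.lt_or_gt_of_ne hne with h | h
      · have := hmono i j h hj; simp only at hij; omega
      · have := hmono j i h hi; simp only at hij; omega
  · rintro ⟨l, a⟩ hx ⟨l', a'⟩ hx' heq
    rw [Finset.mem_coe, Finset.mem_sigma] at hx hx'
    have ha := hspec l hx.1 a hx.2
    have ha' := hspec l' hx'.1 a' hx'.2
    have hel : ∀ i ≤ m, element Λ m V a i = element Λ m V a' i := by
      intro i hi
      rcases Nat.eq_or_lt_of_le hi with rfl | hi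
      · rw [element_self, element_self]
      · exact image_range_injOn (f := element Λ m V a) (g := element Λ m V a')
          (fun l hl => element_lt_succ ha (by omega))
          (fun l hl => element_lt_succ ha' (by omega)) heq i hi
    obtain ⟨h1, h2⟩ := hT l hx.1
    obtain ⟨h1', h2'⟩ := hT l' hx'.1
    have hsplit : ∀ i < m, typeSplit r l i = typeSplit r l' i := by
      intro i hi
      have e := ((mem_splitClass.1 ha).2.2.1 i hi).size
      have e' := ((mem_splitClass.1 ha').2.2.1 i hi).size
      rw [hel i hi.le, hel (i + 1) hi, e'] at e
      omega
    have hl : l = l' := by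
      refine List.ext_getElem (by rw [h1.length_eq h2, h1'.length_eq h2']) fun i hi hi' => ?_
      have e := hsplit i (by rw [← h1.length_eq h2]; exact hi)
      have p := h1.pos i hi
      have p' := h1'.pos i hi'
      rw [typeSplit, typeSplit] at e
      rw [← List.getD_eq_getElem l 0 hi, ← List.getD_eq_getElem l' 0 hi']
      omega
    subst hl
    rw [mem_splitClass] at ha ha'
    have haa : a = a' := by
      refine eq_of_field_eq ha.1 ha'.1 fun i hi => ?_
      by_cases him : i < m
      · have := hel i him.le
        rwa [element_of_lt him, element_of_lt him] at this
      · obtain ⟨γ, rfl⟩ : ∃ γ, i = m + γ := ⟨i - m, by omega⟩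
        have e := ha.2.2.2 γ (by omega)
        rw [← ha'.2.2.2 γ (by omega)] at e
        simpa using e
    rw [haa]

/-- The list is cut at the first length where the savings reach `S`, or runs to `m`. Before the last
entry the sum is below `S`, and one entry adds at most `r`. -/
theorem exists_isType {d : ℕ → ℕ} (hd : ∀ i < m, d i < r) :
    ∃ k ≤ m, IsType m r S ((List.range k).map fun i => r - d i) := by
  classical
  have hsum : ∀ k, ((List.range k).map fun i => r - d i).sum = ∑ i ∈ Finset.range k, (r - d i) := by
    intro k
    induction k with
    | zero => simp
    | succ k ih => rw [List.range_succ, List.map_append, List.sum_append, ih, Finset.sum_range_succ]; simp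
  have hex : ∃ k, k = m ∨ S ≤ ∑ i ∈ Finset.range k, (r - d i) := ⟨m, Or.inl rfl⟩
  have hk := Nat.find_spec hex
  have hmin := fun j => Nat.find_min (m := j) hex
  have hle : Nat.find hex ≤ m := Nat.find_min' hex (Or.inl rfl)
  generalize Nat.find hex = k at hk hmin hle
  refine ⟨k, hle, by simpa using hle, fun i hi => ?_, ?_, fun h => ?_⟩
  · simp only [List.length_map, List.length_range] at hi
    have := hd i (by omega)
    rw [List.getD_eq_getElem _ _ (by simpa using hi)]
    simp only [List.getElem_map, List.getElem_range]
    omega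
  · rw [hsum]
    cases k with
    | zero => simp
    | succ k =>
      have := hmin k (by omega)
      rw [Finset.sum_range_succ]
      omega
  · rw [hsum] at h
    rcases hk with hk | hk
    · simpa using hk
    · omega

end Types

end RankDS

/-! ## Encoding sets by types and payloads -/

namespace RankDS

/-- Every set of `m` elements below `V` has a type `t < τ` and a payload `p < c t` from which its
elements and group codes can be read, for each length `ℓ` of the memory. -/
def HasScheme (q J H Λ m G V z b κ τ : ℕ) (c : ℕ → ℕ) : Prop :=
  ∀ ℓ, (∀ t < τ, c t ≤ 2 ^ (ℓ + κ + 1)) → ∃ L : Layout q J H Λ (m + G) ℓ τ c, ∀ s : ℕ → ℕ,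
    (∀ l, l + 1 < m → s l < s (l + 1)) → (∀ i < m, s i < V) →
      ∃ t < τ, ∃ p < c t, (∀ i < m, L.comp t p i = s i) ∧ ∀ γ < G, L.comp t p (m + γ) < 2 ^ q ∧
        IsGroupCode z (γ * b) (min m ((γ + 1) * b)) s (L.comp t p (m + γ))

/-- `code d γ` codes the numbers `d l + 1` for the group number `γ`. -/
def IsCoder (z b q r : ℕ) (code : (ℕ → ℕ) → ℕ → ℕ) : Prop :=
  ∀ d γ, code d γ < 2 ^ q ∧ ∀ l, γ * b ≤ l → l < γ * b + b → d l < r →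
    codeDigit z (code d γ) (l - γ * b) = d l + 1

theorem exists_isCoder {z b q r : ℕ} (hzb : z * b ≤ q) (hr : r < 2 ^ z) :
    ∃ code, IsCoder z b q r code := by
  choose code h1 h2 using fun d γ => exists_groupCode hzb hr d (γ * b)
  exact ⟨code, fun d γ => ⟨h1 d γ, h2 d γ⟩⟩

/-- Continuing the sequence by `V` gives every element a successor to split from. The type is then
read off the splitting positions. -/
theorem exists_mem_typeClass {Λ m G V r S q z b : ℕ} {code : (ℕ → ℕ) → ℕ → ℕ}
    (hcode : IsCoder z b q r code) (hV : V < 2 ^ r) (hr : r ≤ Λ) (hq : q ≤ Λ) {s : ℕ → ℕ}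
    (hs : ∀ l, l + 1 < m → s l < s (l + 1)) (hsV : ∀ i < m, s i < V) :
    ∃ l, IsType m r S l ∧ ∃ a ∈ typeClass Λ m G V r S q code l,
      (∀ i < m, field (fun _ => Λ) a i = s i) ∧ ∀ γ < G, field (fun _ => Λ) a (m + γ) < 2 ^ q ∧
        IsGroupCode z (γ * b) (min m ((γ + 1) * b)) s (field (fun _ => Λ) a (m + γ)) := by
  set s' : ℕ → ℕ := fun i => if i < m then s i else V with hs'
  have hlt : ∀ i < m, s' i < s' (i + 1) := by
    intro i hi
    simp only [hs', if_pos hi]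
    split_ifs with h
    · exact hs i h
    · exact hsV i hi
  have hs'r : ∀ i, s' i < 2 ^ r := by
    intro i
    simp only [hs']
    split_ifs with h
    · exact (hsV i h).trans hV
    · exact hV
  set d : ℕ → ℕ := fun i => (s' i ^^^ s' (i + 1)).size - 1 with hd
  have hpos : ∀ i < m, 0 < (s' i ^^^ s' (i + 1)).size := fun i hi =>
    Nat.size_pos.2 (Nat.pos_of_ne_zero (xor_ne_zero (hlt i hi).ne))
  have hdr : ∀ i < m, d i < r := by
    intro i hi
    have h1 := hpos i hi
    have h2 : (s' i ^^^ s' (i + 1)).size ≤ r := Nat.size_le.2 (Nat.xor_lt_two_pow (hs'r _) (hs'r _))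
    show (s' i ^^^ s' (i + 1)).size - 1 < r
    omega
  obtain ⟨k, hk, hl⟩ := exists_isType (S := S) hdr
  set l := (List.range k).map fun i => r - d i with hldef
  have hlen : l.length = k := by simp [hldef]
  have hsplit : ∀ i < k, typeSplit r l i = d i := by
    intro i hi
    have := hdr i (by omega)
    rw [typeSplit, List.getD_eq_getElem _ _ (by omega)]
    simp only [hldef, List.getElem_map, List.getElem_range]
    omega
  refine ⟨l, hl, ?_⟩
  -- A cut type knows only an initial part of the positions, so its codes are made from the true
  -- ones and stored. An uncut type knows them all, and its codes are those that the class
  -- prescribes.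
  set g : ℕ → ℕ := fun γ => if S ≤ l.sum then code d γ else code (typeSplit r l) γ with hg
  have hgq : ∀ γ, g γ < 2 ^ q := by
    intro γ
    simp only [hg]
    split_ifs
    · exact (hcode _ γ).1
    · exact (hcode _ γ).1
  have hΛ : ∀ {n}, n ≤ Λ → 2 ^ n ≤ 2 ^ Λ := fun h => Nat.pow_le_pow_right (by norm_num) h
  obtain ⟨a, ha, hav⟩ := exists_field_eq (fun _ => Λ) (fun i => if i < m then s i else g (i - m))
    (m + G) (fun i _ => by
      split_ifs with h
      · have h1 := hs'r i
        simp only [hs', if_pos h] at h1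
        exact h1.trans_le (hΛ hr)
      · exact (hgq _).trans_le (hΛ hq))
  have has : ∀ i < m, field (fun _ => Λ) a i = s i := fun i hi => by
    rw [hav i (by omega), if_pos hi]
  have hag : ∀ γ < G, field (fun _ => Λ) a (m + γ) = g γ := fun γ hγ => by
    rw [hav _ (by omega), if_neg (by omega), Nat.add_sub_cancel_left]
  have hel : ∀ i ≤ m, element Λ m V a i = s' i := by
    intro i _
    simp only [hs', element]
    split_ifs with h
    · exact has i h
    · rfl
  have hmem : ∀ w g', (∀ γ < G, g γ / 2 ^ w = g' γ / 2 ^ w) →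
      a ∈ splitClass Λ m G V r l.length (typeSplit r l) w g' := by
    intro w g' hg'
    rw [mem_splitClass]
    refine ⟨ha, fun i hi => ?_, fun i hi => ?_, fun γ hγ => by rw [hag γ hγ, hg' γ hγ]⟩
    · rw [has i hi]; exact (hsV i hi).trans hV
    · rw [hlen] at hi
      rw [hel i (by omega), hel (i + 1) (by omega), hsplit i hi]
      exact splitAt_of_lt (hlt i (by omega))
  refine ⟨a, ?_, has, fun γ hγ => ⟨by rw [hag γ hγ]; exact hgq γ, fun n h1 h2 => ?_⟩⟩
  · rw [typeClass]
    split_ifs with h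
    · exact hmem _ _ fun γ _ => by rw [Nat.div_eq_of_lt (hgq γ), Nat.zero_div]
    · exact hmem _ _ fun γ _ => by simp only [hg, if_neg h]
  · rw [Nat.succ_mul] at h2
    have hdn : d n + 1 = (s n ^^^ s (n + 1)).size := by
      have h3 := hpos n (by omega)
      simp only [hs', if_pos (show n < m by omega), if_pos (show n + 1 < m by omega)] at h3
      simp only [hd, hs', if_pos (show n < m by omega), if_pos (show n + 1 < m by omega)]
      omega
    rw [hag γ hγ, ← hdn]
    simp only [hg]
    split_ifs with h
    · exact (hcode d γ).2 n h1 (by omega) (hdr n (by omega))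
    · have hkm : k = m := by rw [← hlen]; exact hl.length_eq (by omega)
      have h4 := (hcode (typeSplit r l) γ).2 n h1 (by omega)
      rw [hsplit n (by omega)] at h4
      exact h4 (hdr n (by omega))

theorem sum_getD_toList {α : Type*} (T : Finset α) (f : α → ℕ) (x : α) :
    ∑ t ∈ Finset.range T.card, f (T.toList.getD t x) = ∑ a ∈ T, f a := by
  rw [← Finset.sum_map_toList T f, ← sum_range_getD, List.length_map, Finset.length_toList]
  refine Finset.sum_congr rfl fun t ht => ?_
  rw [Finset.mem_range, ← Finset.length_toList] at ht
  rw [List.getD_eq_getElem _ _ ht, List.getD_eq_getElem _ _ (by simpa using ht), List.getElem_map]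

/-- For large `κ`, the sets are divided into few types. -/
theorem exists_scheme {Λ m G V r S q z b H J κ : ℕ} (hzb : z * b ≤ q) (hrz : r < 2 ^ z)
    (hV : V < 2 ^ r) (hr : r ≤ Λ) (hq : q ≤ Λ) (hHJ : H ≤ q * J) (hJ : 1 ≤ J) (hκ : κ + 1 ≤ H)
    (hSH : S + r ≤ H)
    (hrare : (boundedLists m (S + r)).card * 2 ^ (m * r + G * q + κ) ≤ V.choose m * 2 ^ S) :
    ∃ τ c, τ ≤ (boundedLists m (S + r)).card ∧ (∀ t < τ, 0 < c t) ∧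
      (∑ t ∈ Finset.range τ, c t) * 2 ^ κ ≤ V.choose m * (2 ^ κ + 1) ∧
      HasScheme q J H Λ m G V z b κ τ c := by
  classical
  obtain ⟨code, hcode⟩ := exists_isCoder hzb hrz
  set C := typeClass Λ m G V r S q code with hC
  set T := (boundedLists m (S + r)).filter fun l => IsType m r S l ∧ (C l).Nonempty with hT
  have hTmem : ∀ l ∈ T, IsType m r S l ∧ (C l).Nonempty := fun l hl => (Finset.mem_filter.1 hl).2
  have hget : ∀ t < T.card, T.toList.getD t [] ∈ T := by
    intro t ht
    rw [← Finset.length_toList] at ht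
    rw [List.getD_eq_getElem _ _ ht, ← Finset.mem_toList]
    exact List.getElem_mem ht
  refine ⟨T.card, fun t => (C (T.toList.getD t [])).card, Finset.card_filter_le _ _,
    fun t ht => Finset.card_pos.2 (hTmem _ (hget t ht)).2, ?_, ?_⟩
  · rw [sum_getD_toList T (fun l => (C l).card), ← Finset.sum_filter_add_sum_filter_not T (·.sum < S)]
    have h1 : ∑ l ∈ T.filter (·.sum < S), (C l).card ≤ V.choose m :=
      sum_card_typeClass_le _ fun l hl =>
        ⟨(hTmem l (Finset.mem_filter.1 hl).1).1, (Finset.mem_filter.1 hl).2⟩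
    -- Each cut class has at most `2 ^ (m * r + G * q - S)` members. By `hrare` the saving `S` also
    -- pays for the number of types and for a factor `2 ^ κ`.
    have h2 : (∑ l ∈ T.filter (¬ ·.sum < S), (C l).card) * 2 ^ κ ≤ V.choose m := by
      have h3 : (∑ l ∈ T.filter (¬ ·.sum < S), (C l).card) * 2 ^ S ≤
          (boundedLists m (S + r)).card * 2 ^ (m * r + G * q) := by
        rw [Finset.sum_mul]
        refine (Finset.sum_le_card_nsmul _ _ (2 ^ (m * r + G * q)) fun l hl => ?_).trans ?_
        · rw [Finset.mem_filter] at hl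
          exact (hTmem l hl.1).1.card_mul_le (not_lt.1 hl.2)
        · rw [smul_eq_mul]
          exact Nat.mul_le_mul_right _ ((Finset.card_filter_le _ _).trans (Finset.card_filter_le _ _))
      refine Nat.le_of_mul_le_mul_right ?_ (Nat.two_pow_pos S)
      calc _ = (∑ l ∈ T.filter (¬ ·.sum < S), (C l).card) * 2 ^ S * 2 ^ κ := by ring
        _ ≤ (boundedLists m (S + r)).card * 2 ^ (m * r + G * q) * 2 ^ κ := Nat.mul_le_mul_right _ h3
        _ = (boundedLists m (S + r)).card * 2 ^ (m * r + G * q + κ) := by rw [pow_add _ _ κ]; ring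
        _ ≤ _ := hrare
    calc _ ≤ V.choose m * 2 ^ κ + (∑ l ∈ T.filter (¬ ·.sum < S), (C l).card) * 2 ^ κ := by
          rw [Nat.add_mul]; gcongr
      _ ≤ V.choose m * 2 ^ κ + V.choose m := by gcongr
      _ = _ := by ring
  · intro ℓ hℓ
    have hclass : ∀ t, ∃ b, t < T.card → IsXorClass Λ (m + G) H (C (T.toList.getD t [])) b := by
      intro t
      by_cases ht : t < T.card
      · obtain ⟨b, hb⟩ := (hTmem _ (hget t ht)).1.isXorClass hr hq hSH (hTmem _ (hget t ht)).2
        exact ⟨b, fun _ => hb⟩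
      · exact ⟨fun _ => 0, fun h => absurd h ht⟩
    choose b' hb' using hclass
    obtain ⟨L, hL⟩ := exists_layout hb' hHJ hJ hκ hℓ
    refine ⟨L, fun s hs hsV => ?_⟩
    obtain ⟨l, hl, a, ha, h1, h2⟩ := exists_mem_typeClass (S := S) (G := G) hcode hV hr hq hs hsV
    have hlT : l ∈ T.toList := by
      rw [Finset.mem_toList, hT, Finset.mem_filter]
      exact ⟨mem_boundedLists hl.length_le hl.sum_le, hl, a, ha⟩
    obtain ⟨t, ht, htl⟩ := List.mem_iff_getElem.1 hlT
    have htl' : T.toList.getD t [] = l := by rw [List.getD_eq_getElem _ _ ht, htl]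
    rw [Finset.length_toList] at ht
    obtain ⟨p, hp, hpa⟩ := hL t ht a (by rw [htl']; exact ha)
    refine ⟨t, ht, p, hp, fun i hi => by rw [hpa i (by omega), h1 i hi], fun γ hγ => ?_⟩
    rw [hpa _ (by omega)]
    exact h2 γ hγ

/-- For bounded `κ`, the table can list all sets. -/
theorem exists_scheme_single {Λ m G V r q z b H J κ : ℕ} (hzb : z * b ≤ q) (hrz : r < 2 ^ z)
    (hV : V < 2 ^ r) (hr : r ≤ Λ) (hq : q ≤ Λ) (hJ : 1 ≤ J) (hm : m ≤ V)
    (hCq : V.choose m ≤ 2 ^ q) (hCH : V.choose m ≤ 2 ^ H) :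
    ∃ c, (∀ t < 1, 0 < c t) ∧ ∑ t ∈ Finset.range 1, c t ≤ V.choose m ∧
      HasScheme q J H Λ m G V z b κ 1 c := by
  classical
  obtain ⟨code, hcode⟩ := exists_isCoder hzb hrz
  -- No sum of at most `m` savings reaches this bound, so no type is cut and all codes are
  -- determined.
  set S := m * r + 1 with hS
  set C := typeClass Λ m G V r S q code with hC
  set T := (boundedLists m (S + r)).filter fun l => IsType m r S l ∧ l.sum < S with hT
  set A := T.biUnion C with hA
  have hcard : A.card ≤ V.choose m := Finset.card_biUnion_le.trans
    (sum_card_typeClass_le _ fun l hl => (Finset.mem_filter.1 hl).2)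
  have hmem : ∀ s : ℕ → ℕ, (∀ l, l + 1 < m → s l < s (l + 1)) → (∀ i < m, s i < V) →
      ∃ a ∈ A, (∀ i < m, field (fun _ => Λ) a i = s i) ∧
        ∀ γ < G, field (fun _ => Λ) a (m + γ) < 2 ^ q ∧
          IsGroupCode z (γ * b) (min m ((γ + 1) * b)) s (field (fun _ => Λ) a (m + γ)) := by
    intro s hs hsV
    obtain ⟨l, hl, a, ha, h12⟩ := exists_mem_typeClass (S := S) (G := G) hcode hV hr hq hs hsV
    refine ⟨a, Finset.mem_biUnion.2 ⟨l, Finset.mem_filter.2 ⟨mem_boundedLists hl.length_le hl.sum_le,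
      hl, ?_⟩, ha⟩, h12⟩
    rw [← sum_range_getD, hS, Nat.lt_succ_iff]
    calc _ ≤ ∑ i ∈ Finset.range l.length, r :=
          Finset.sum_le_sum fun i hi => (hl.pos i (Finset.mem_range.1 hi)).2
      _ ≤ m * r := by
        rw [Finset.sum_const, Finset.card_range, smul_eq_mul]
        exact Nat.mul_le_mul_right _ hl.length_le
  obtain ⟨a₀, ha₀, -⟩ := hmem id (fun l _ => Nat.lt_succ_self l) (fun i hi => lt_of_lt_of_le hi hm)
  refine ⟨fun _ => A.card, fun _ _ => Finset.card_pos.2 ⟨a₀, ha₀⟩, by simpa using hcard,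
    fun ℓ _ => ?_⟩
  -- The body is empty and the header is an index into the list of all sequences. It is a single
  -- digit because `V.choose m ≤ 2 ^ q`, and only the digit number `0` contributes.
  refine ⟨{
    body := fun _ => 0
    acc := fun _ i j d => if j = 0 then field (fun _ => Λ) (A.toList.getD d 0) i else 0
    off := fun _ _ => 0
    width := fun _ _ => 0
    body_le := fun _ _ => Nat.zero_le _
    off_add_width_le := fun _ _ _ _ => le_rfl
    width_le := fun _ _ _ _ => Nat.zero_le _
    acc_lt := fun t _ i _ j _ d _ => by
      split_ifs
      · exact field_lt _ _ i
      · exact Nat.two_pow_pos _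
    count_le := fun _ _ => by rw [Nat.zero_add]; exact hcard.trans hCH }, fun s hs hsV => ?_⟩
  obtain ⟨a, ha, h1, h2⟩ := hmem s hs hsV
  obtain ⟨p, hp, hpa⟩ := List.mem_iff_getElem.1 (Finset.mem_toList.2 ha)
  have hpa' : A.toList.getD p 0 = a := by rw [List.getD_eq_getElem _ _ hp, hpa]
  rw [Finset.length_toList] at hp
  have hcomp : ∀ i, xorSum (fun j => if j = 0 then
      field (fun _ => Λ) (A.toList.getD (p / 2 ^ 0 / (2 ^ q) ^ j % 2 ^ q) 0) i else 0) J ^^^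
        (p / 2 ^ 0 % 2 ^ 0) = field (fun _ => Λ) a i := by
    intro i
    obtain ⟨J, rfl⟩ : ∃ J', J = J' + 1 := ⟨J - 1, by omega⟩
    rw [xorSum_congr (g := fun j => if j = 0 then field (fun _ => Λ) a i else 0) fun j _ => ?_,
      xorSum_single, pow_zero, Nat.mod_one, Nat.xor_zero]
    split_ifs with hj
    · rw [hj, pow_zero, pow_zero, Nat.div_one, Nat.div_one,
        Nat.mod_eq_of_lt (hp.trans_le (hcard.trans hCq)), hpa']
    · rfl
  refine ⟨0, by norm_num, p, hp, fun i hi => (hcomp i).trans (h1 i hi), fun γ hγ => ?_⟩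
  have h3 := h2 γ hγ
  rw [← hcomp] at h3
  exact h3

end RankDS

/-! ## Choosing the shape -/

namespace RankDS

/-- Type `t` gets enough consecutive values of `K` for the high parts of its payloads. The least `ℓ`
for which the total is below `2 ^ (κ + 1)` is taken; passing from `ℓ + 1` to `ℓ` at most doubles the
total, so it is at least `2 ^ κ` unless `ℓ = 0`. In that case rounding up costs at most `2 ^ ℓ` per
type, a fraction `2 ^ (-κ)` of the capacity; for `ℓ = 0` nothing is rounded. -/
theorem exists_shape {τ κ : ℕ} {c : ℕ → ℕ} (hτ : 1 ≤ τ) (hτκ : τ < 2 ^ (κ + 1))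
    (hc : ∀ t < τ, 0 < c t) :
    ∃ (ℓ : ℕ) (start : ℕ → ℕ), start 0 = 0 ∧ StrictMono start ∧
      (∀ t < τ, ∀ p < c t, start t + p / 2 ^ ℓ < start (t + 1)) ∧
      (∀ t < τ, c t ≤ 2 ^ (ℓ + κ + 1)) ∧ start τ < 2 ^ (κ + 1) ∧ 1 ≤ start τ ∧
      (ℓ = 0 ∨ 2 ^ κ ≤ start τ) ∧
      start τ * 2 ^ ℓ * (2 ^ κ - τ) ≤ 2 ^ κ * ∑ t ∈ Finset.range τ, c t := by
  set R : ℕ → ℕ → ℕ := fun ℓ n => ∑ t ∈ Finset.range n, ((c t - 1) / 2 ^ ℓ + 1) with hR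
  have hR0 : ∀ n ≤ τ, R 0 n = ∑ t ∈ Finset.range n, c t := by
    intro n hn
    refine Finset.sum_congr rfl fun t ht => ?_
    have := hc t (by rw [Finset.mem_range] at ht; omega)
    rw [pow_zero, Nat.div_one]; omega
  have hex : ∃ ℓ, R ℓ τ < 2 ^ (κ + 1) := by
    refine ⟨∑ t ∈ Finset.range τ, c t, lt_of_le_of_lt (le_of_eq ?_) hτκ⟩
    rw [hR]
    calc _ = ∑ t ∈ Finset.range τ, 1 := Finset.sum_congr rfl fun t ht => by
          have h1 : c t ≤ ∑ t ∈ Finset.range τ, c t :=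
            Finset.single_le_sum (fun _ _ => Nat.zero_le _) ht
          have h2 : ∑ t ∈ Finset.range τ, c t < 2 ^ (∑ t ∈ Finset.range τ, c t) :=
            Nat.lt_two_pow_self
          rw [Nat.div_eq_of_lt (by omega)]
      _ = τ := by simp
  have hspec := Nat.find_spec hex
  have hmin := fun j => Nat.find_min (m := j) hex
  generalize Nat.find hex = ℓ at hspec hmin
  have hmono : StrictMono (R ℓ) := strictMono_nat_of_lt_succ fun n => by
    simp only [hR, Finset.sum_range_succ]; exact Nat.lt_add_of_pos_right (Nat.succ_pos _)
  have hstep : ∀ t, R ℓ (t + 1) = R ℓ t + ((c t - 1) / 2 ^ ℓ + 1) := fun t => by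
    simp only [hR, Finset.sum_range_succ]
  have hlarge : ℓ = 0 ∨ 2 ^ κ ≤ R ℓ τ := by
    cases ℓ with
    | zero => exact Or.inl rfl
    | succ ℓ =>
      right
      have h1 := hmin ℓ (by omega)
      have h2 : R ℓ τ ≤ 2 * R (ℓ + 1) τ := by
        simp only [hR, Finset.mul_sum]
        refine Finset.sum_le_sum fun t _ => ?_
        rw [pow_succ, ← Nat.div_div_eq_div_mul]
        omega
      rw [pow_succ] at h1
      omega
  refine ⟨ℓ, R ℓ, rfl, hmono, fun t ht p hp => ?_, fun t ht => ?_, hspec, ?_, hlarge, ?_⟩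
  · rw [hstep]
    have : p / 2 ^ ℓ ≤ (c t - 1) / 2 ^ ℓ := Nat.div_le_div_right (by omega)
    omega
  · have h1 : (c t - 1) / 2 ^ ℓ + 1 ≤ R ℓ τ :=
      Finset.single_le_sum (f := fun t => (c t - 1) / 2 ^ ℓ + 1) (fun _ _ => Nat.zero_le _)
        (Finset.mem_range.2 ht)
    have h2 : c t - 1 < 2 ^ ℓ * 2 ^ (κ + 1) := by
      rw [Nat.mul_comm, ← Nat.div_lt_iff_lt_mul (Nat.two_pow_pos ℓ)]
      omega
    rw [Nat.add_assoc, pow_add]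
    omega
  · have := hmono.le_apply (x := τ)
    omega
  · rcases hlarge with h0 | h0
    · subst h0
      rw [hR0 τ le_rfl, pow_zero, Nat.mul_one, Nat.mul_comm]
      exact Nat.mul_le_mul_right _ (Nat.sub_le _ _)
    · have h1 : R ℓ τ * 2 ^ ℓ ≤ (∑ t ∈ Finset.range τ, c t) + τ * 2 ^ ℓ := by
        simp only [hR, Finset.sum_mul]
        calc _ ≤ ∑ t ∈ Finset.range τ, (c t + 2 ^ ℓ) := Finset.sum_le_sum fun t _ => by
              have := Nat.div_mul_le_self (c t - 1) (2 ^ ℓ)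
              rw [Nat.succ_mul]; omega
          _ = _ := by rw [Finset.sum_add_distrib]; simp
      rw [Nat.mul_sub, Nat.sub_le_iff_le_add]
      calc R ℓ τ * 2 ^ ℓ * 2 ^ κ ≤ ((∑ t ∈ Finset.range τ, c t) + τ * 2 ^ ℓ) * 2 ^ κ :=
            Nat.mul_le_mul_right _ h1
        _ = 2 ^ κ * (∑ t ∈ Finset.range τ, c t) + 2 ^ κ * 2 ^ ℓ * τ := by ring
        _ ≤ 2 ^ κ * (∑ t ∈ Finset.range τ, c t) + R ℓ τ * 2 ^ ℓ * τ := by gcongr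

/-- The overcount `δ` of the sequences and the rounding for `τ` types combine to a relative excess
of at most `(δ + τ) / (D - τ)`, where `D` stands for `2 ^ κ`. -/
theorem redundancy_le {n C τ δ D T : ℕ} (h : n * (D - τ) ≤ D * T) (hT : T * D ≤ C * (D + δ))
    (hτ : τ < D) (hδ : 9 * D * (δ + τ) ^ 2 ≤ 4 * (D - τ) ^ 2) :
    9 * (n - C) ^ 2 * D ≤ 4 * C ^ 2 := by
  obtain ⟨P, rfl⟩ : ∃ P, D = P + τ := ⟨D - τ, by omega⟩
  rw [Nat.add_sub_cancel] at *
  have h1 : (n - C) * P ≤ C * (δ + τ) := by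
    rw [Nat.sub_mul, Nat.sub_le_iff_le_add]
    calc n * P ≤ (P + τ) * T := h
      _ = T * (P + τ) := Nat.mul_comm _ _
      _ ≤ C * (P + τ + δ) := hT
      _ = C * (δ + τ) + C * P := by ring
  refine Nat.le_of_mul_le_mul_right (c := P ^ 2) ?_ (by have : 0 < P := by omega
                                                        positivity)
  calc 9 * (n - C) ^ 2 * (P + τ) * P ^ 2 = 9 * (P + τ) * ((n - C) * P) ^ 2 := by ring
    _ ≤ 9 * (P + τ) * (C * (δ + τ)) ^ 2 := by gcongr
    _ = 9 * (P + τ) * (δ + τ) ^ 2 * C ^ 2 := by ring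
    _ ≤ 4 * P ^ 2 * C ^ 2 := by gcongr
    _ = 4 * C ^ 2 * P ^ 2 := by ring

theorem listRank_eq_card (L : List ℕ) (x : ℕ) : listRank L x =
    ((Finset.range L.length).filter fun k => L.getD k 0 ≤ x).card := by
  induction L using List.reverseRecOn with
  | nil => simp [listRank]
  | append_singleton L a ih =>
    have h1 : (Finset.range L.length).filter (fun k => (L ++ [a]).getD k 0 ≤ x) =
        (Finset.range L.length).filter fun k => L.getD k 0 ≤ x := by
      refine Finset.filter_congr fun k hk => ?_
      rw [List.getD_append _ _ _ _ (Finset.mem_range.1 hk)]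
    have h2 : (L ++ [a]).getD L.length 0 = a := by simp [List.getD]
    have h3 : listRank (L ++ [a]) x = listRank L x + if a ≤ x then 1 else 0 := by
      rw [listRank, List.filter_append, List.length_append, listRank]
      split_ifs with h <;> simp [h]
    rw [h3, ih, List.length_append, List.length_singleton, Finset.range_add_one,
      Finset.filter_insert, h1, h2]
    split_ifs with h
    · rw [Finset.card_insert_of_notMem (by simp)]
    · rfl

theorem setList_spec (V n : ℕ) :
    (∀ l, l + 1 < (setList V n).length → (setList V n).getD l 0 < (setList V n).getD (l + 1) 0) ∧
      ∀ i < (setList V n).length, (setList V n).getD i 0 < V := by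
  have hsort : (setList V n).Pairwise (· < ·) :=
    List.pairwise_lt_range.sublist List.filter_sublist
  refine ⟨fun l hl => ?_, fun i hi => ?_⟩
  · rw [List.getD_eq_getElem _ _ hl, List.getD_eq_getElem _ _ (by omega)]
    exact List.pairwise_iff_getElem.1 hsort l (l + 1) (by omega) hl (by omega)
  · rw [List.getD_eq_getElem _ _ hi]
    exact List.mem_range.1 (List.mem_filter.1 (List.getElem_mem hi)).1

theorem good_of_scheme {q J H Λ m G V z d κ τ u b A N δ : ℕ} {c : ℕ → ℕ}
    (hsch : HasScheme q J H Λ m G V z d κ τ c) (hc : ∀ t < τ, 0 < c t)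
    (hsum : (∑ t ∈ Finset.range τ, c t) * 2 ^ κ ≤ V.choose m * (2 ^ κ + δ)) (hτκ : τ < 2 ^ κ)
    (hδ : 9 * 2 ^ κ * (δ + τ) ^ 2 ≤ 4 * (2 ^ κ - τ) ^ 2) (hδκ : δ ≤ 2 ^ κ)
    (hlen : 14 * (2 ^ q) ^ 4 ≤ A * 2 ^ (4 * (κ / N)))
    (hlen' : 14 * (2 ^ q) ^ 4 * (u * κ) < 2 ^ (b * κ)) (hub : u ≤ b)
    (hqW : q < u * κ) (hHW : H ≤ u * κ) (hΛW : Λ < u * κ) (hκW : κ + 1 < u * κ)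
    (hκq : κ + 1 ≤ q * J) (hΛq : Λ ≤ q * J) (hJ : J ≤ 2 ^ q)
    (hI : m + G < 2 ^ q) (hτ : 2 * τ + 2 ≤ 2 ^ q) (hΛ : 2 * Λ + 2 ≤ 2 ^ q) (hκΛ : κ ≤ Λ)
    (hG : 0 < G) (hV : V ≤ 2 ^ κ) (hd : d ≤ q) (hmd : m ≤ G * d) (hm : m ≤ V) :
    ∃ (ℓ R : ℕ) (tab : List ℕ), Good (Expr.rankQuery J G) u b A N κ V m ℓ R tab := by
  have hκκ : 2 ^ κ < 2 ^ (κ + 1) := Nat.pow_lt_pow_right (by norm_num) (by omega)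
  -- Some set has a type: the scheme is applied to the set `{0, ..., m - 1}`.
  have hτ1 : 1 ≤ τ := by
    obtain ⟨L, hL⟩ := hsch (∑ t ∈ Finset.range τ, c t) fun t ht => by
      have h1 : c t ≤ ∑ t ∈ Finset.range τ, c t :=
        Finset.single_le_sum (fun _ _ => Nat.zero_le _) (Finset.mem_range.2 ht)
      exact (h1.trans Nat.lt_two_pow_self.le).trans (Nat.pow_le_pow_right (by norm_num) (by omega))
    obtain ⟨t, ht, -⟩ := hL id (fun l _ => Nat.lt_succ_self l) fun i hi => lt_of_lt_of_le hi hm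
    omega
  obtain ⟨ℓ, start, h0, hmono, hp, hcℓ, hR, hR1, hRκ, hred⟩ := exists_shape hτ1 (hτκ.trans hκκ) hc
  obtain ⟨L, hL⟩ := hsch ℓ hcℓ
  have hBW : 2 ^ (u * κ) ≤ 2 ^ (b * κ) :=
    Nat.pow_le_pow_right (by norm_num) (Nat.mul_le_mul_right _ hub)
  -- Bit offsets in `M` must fit into table entries. If `ℓ` is not `0`, the capacity forces `2 ^ ℓ`
  -- to be at most `2 * V.choose m`, so `ℓ ≤ V + 1`.
  have hℓ : ℓ < 2 ^ (u * κ) := by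
    have hκu : 2 ^ (κ + 1) < 2 ^ (u * κ) := Nat.pow_lt_pow_right (by norm_num) (by omega)
    rcases hRκ with rfl | hRκ
    · exact Nat.two_pow_pos _
    · have h1 : 2 ^ ℓ ≤ ∑ t ∈ Finset.range τ, c t := by
        refine Nat.le_of_mul_le_mul_left (le_trans ?_ hred) (Nat.two_pow_pos κ)
        calc 2 ^ κ * 2 ^ ℓ ≤ start τ * 2 ^ ℓ * 1 := by rw [Nat.mul_one]; gcongr
          _ ≤ _ := Nat.mul_le_mul_left _ (by omega)
      have h2 : ∑ t ∈ Finset.range τ, c t ≤ 2 * V.choose m := by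
        refine Nat.le_of_mul_le_mul_right (hsum.trans ?_) (Nat.two_pow_pos κ)
        calc _ ≤ V.choose m * (2 ^ κ + 2 ^ κ) := by gcongr
          _ = _ := by ring
      have h3 : 2 ^ ℓ ≤ 2 ^ (V + 1) := by
        have := Nat.choose_le_two_pow V m
        rw [pow_succ]; omega
      have h4 := (Nat.pow_le_pow_iff_right (by norm_num : 1 < 2)).1 h3
      omega
  refine ⟨ℓ, start τ, mkTable 14 (2 ^ q) (rankTable z d m start L), ?_, ?_, ?_, ?_, ?_⟩
  · rwa [length_mkTable]
  · rwa [length_mkTable]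
  · omega
  · exact redundancy_le hred hsum hτκ hδ
  · intro n _
    rw [or_iff_not_imp_left, not_not]
    intro hnm
    obtain ⟨hs, hsV⟩ := setList_spec V n
    rw [hnm] at hs hsV
    obtain ⟨t, ht, p, hpc, hcomp, hcode⟩ := hL (fun i => (setList V n).getD i 0) hs hsV
    have hpt := hp t ht p hpc
    have hlow : p % 2 ^ ℓ < 2 ^ ℓ := Nat.mod_lt _ (Nat.two_pow_pos ℓ)
    have hK : start t + p / 2 ^ ℓ < start τ := hpt.trans_le (hmono.monotone ht)
    refine ⟨(start t + p / 2 ^ ℓ) * 2 ^ ℓ + p % 2 ^ ℓ, snoc_lt hK hlow, fun x hx => ?_⟩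
    rw [(snoc_div_mod hlow).1, (snoc_div_mod hlow).2, listRank_eq_card, hnm]
    refine eval_rankQuery L hBW ?_ hqW hHW hΛW hκW hκq hΛq hJ hI hτ hΛ hκΛ hG
      (fun t ht => lt_of_le_of_lt (L.body_le t ht) hℓ) hV hd hmd h0 hmono hR.le hs ht hpc hpt hx
      hcomp hcode rfl
    have : 14 * (2 ^ q) ^ 4 * 1 ≤ 14 * (2 ^ q) ^ 4 * (u * κ) := Nat.mul_le_mul_left _ (by omega)
    omega

end RankDS

/-! ## The choice of the constants -/

namespace RankDS

/-- Factor by factor, `V * (m - i) ≤ m * (V - i)`. The resulting loss `m ^ m` is only `2 ^ O(κ)` for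
the `m` in question. -/
theorem pow_le_pow_mul_choose {V m : ℕ} (h : m ≤ V) : V ^ m ≤ m ^ m * V.choose m := by
  refine Nat.le_of_mul_le_mul_right (c := m.factorial) ?_ m.factorial_pos
  rw [Nat.mul_assoc, Nat.mul_comm (V.choose m), ← Nat.descFactorial_eq_factorial_mul_choose]
  rw [← Nat.descFactorial_self m, Nat.descFactorial_eq_prod_range, Nat.descFactorial_eq_prod_range]
  have hpow : ∀ x : ℕ, x ^ m = ∏ _i ∈ Finset.range m, x := fun x => by simp
  rw [hpow V, hpow m, ← Finset.prod_mul_distrib, ← Finset.prod_mul_distrib]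
  refine Finset.prod_le_prod' fun i hi => ?_
  rw [Finset.mem_range] at hi
  obtain ⟨a, rfl⟩ := Nat.exists_eq_add_of_lt hi
  obtain ⟨b, rfl⟩ := Nat.exists_eq_add_of_le h
  rw [show i + a + 1 - i = a + 1 by omega, show i + a + 1 + b - i = a + 1 + b by omega]
  nlinarith

theorem two_pow_mul_size_le (V m : ℕ) (h : m ≤ V) : 2 ^ (m * V.size) ≤ 2 ^ m * V ^ m := by
  rcases Nat.eq_zero_or_pos V with rfl | hV
  · simp [show m = 0 by omega]
  · have h1 : 2 ^ (V.size - 1) ≤ V := Nat.lt_size.1 (by have := Nat.size_pos.2 hV; omega)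
    have h2 : 2 ^ V.size ≤ 2 * V := by
      have := Nat.size_pos.2 hV
      calc 2 ^ V.size = 2 * 2 ^ (V.size - 1) := by rw [← pow_succ', Nat.sub_add_cancel this]
        _ ≤ 2 * V := by omega
    rw [Nat.mul_comm, pow_mul, ← Nat.mul_pow]
    exact Nat.pow_le_pow_left h2 m

theorem sq_le_two_pow {n : ℕ} (h : 4 ≤ n) : n * n ≤ 2 ^ n := by
  induction n, h using Nat.le_induction with
  | base => norm_num
  | succ n hn ih => rw [pow_succ]; nlinarith

theorem table_lt {q u b κ : ℕ} (h : 4 + 4 * q + u * κ ≤ b * κ) :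
    14 * (2 ^ q) ^ 4 * (u * κ) < 2 ^ (b * κ) := by
  calc 14 * (2 ^ q) ^ 4 * (u * κ) < 2 ^ 4 * (2 ^ q) ^ 4 * 2 ^ (u * κ) := by
        have h1 : u * κ < 2 ^ (u * κ) := Nat.lt_two_pow_self
        have h2 : 0 < (2 ^ q) ^ 4 := by positivity
        calc _ ≤ 2 ^ 4 * (2 ^ q) ^ 4 * (u * κ) := by gcongr; norm_num
          _ < _ := by gcongr
    _ = 2 ^ (4 + 4 * q + u * κ) := by rw [← pow_mul, ← pow_add, ← pow_add, Nat.mul_comm q 4]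
    _ ≤ 2 ^ (b * κ) := Nat.pow_le_pow_right (by norm_num) h

/-- With `κ < K` everything is bounded, so `q` is a constant larger than all quantities that must
serve as an index, and one type listing all sets suffices. -/
theorem good_of_small {c κ V m K J G q u b A N : ℕ} (h : Admissible c κ V m) (hκ : κ < K)
    (hJ : 1 ≤ J) (hG : 0 < G) (hq : q = 2 ^ K + (K + 1) * (c * K) + J + G + 3) (hqu : q < u)
    (hub : u + 4 * q + 4 ≤ b) (hA : 14 * (2 ^ q) ^ 4 ≤ A) :
    ∃ (ℓ R : ℕ) (tab : List ℕ), Good (Expr.rankQuery J G) u b A N κ V m ℓ R tab := by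
  obtain ⟨hκ2, hV, hm, hmκ⟩ := h
  have hlog : 1 ≤ Nat.log 2 κ := Nat.log_pos (by norm_num) hκ2
  have hmc : m ≤ c * K := by
    calc m ≤ m * Nat.log 2 κ := Nat.le_mul_of_pos_right m hlog
      _ ≤ c * κ := hmκ
      _ ≤ c * K := Nat.mul_le_mul_left _ hκ.le
  have hzm : (κ + 1) * m ≤ (K + 1) * (c * K) := Nat.mul_le_mul (by omega) hmc
  have hcK : c * K ≤ (K + 1) * (c * K) := Nat.le_mul_of_pos_left _ (by omega)
  have hK : K < 2 ^ K := Nat.lt_two_pow_self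
  have hκK : 2 ^ κ ≤ 2 ^ K := Nat.pow_le_pow_right (by norm_num) hκ.le
  have hsize : V.size ≤ κ + 1 := Nat.size_le.2 (lt_of_le_of_lt hV
    (Nat.pow_lt_pow_right (by norm_num) (by omega)))
  have hchoose : V.choose m ≤ 2 ^ q := (Nat.choose_le_two_pow V m).trans
    (Nat.pow_le_pow_right (by norm_num) (by omega))
  obtain ⟨C, hC0, hC, hsch⟩ := exists_scheme_single (Λ := q) (G := G) (q := q) (z := κ + 1) (b := m)
    (H := q) (J := J) (κ := κ) (r := V.size) (V := V) (m := m) (by omega)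
    (lt_of_le_of_lt hsize Nat.lt_two_pow_self) V.lt_size_self (by omega) le_rfl hJ hm hchoose hchoose
  have hq2 : q < 2 ^ q := Nat.lt_two_pow_self
  have hq3 : 2 * q + 2 ≤ 2 ^ q := by
    have h1 := sq_le_two_pow (n := q) (by omega)
    have h2 : 4 * q ≤ q * q := Nat.mul_le_mul_right _ (by omega)
    omega
  have hqJ : q ≤ q * J := Nat.le_mul_of_pos_right q hJ
  have huκ : u * 2 ≤ u * κ := Nat.mul_le_mul_left _ hκ2
  have hmG : m ≤ G * m := Nat.le_mul_of_pos_left m hG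
  have hpow : 2 ^ 2 ≤ 2 ^ κ := Nat.pow_le_pow_right (by norm_num) hκ2
  refine good_of_scheme (δ := 0) hsch hC0 (Nat.mul_le_mul hC (Nat.le_add_right _ _)) (by omega) ?_
    (Nat.zero_le _) (hA.trans (Nat.le_mul_of_pos_right A (Nat.two_pow_pos _))) (table_lt ?_)
    (by omega) (by omega) (by omega) (by omega) (by omega) (by omega) hqJ (by omega) (by omega)
    (by omega) hq3 (by omega) hG hV (by omega) hmG hm
  -- One type and no overcount: the claim is `9 * 2 ^ κ ≤ 4 * (2 ^ κ - 1) ^ 2`, with equality at `κ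
  -- = 2`.
  · obtain ⟨y, hy⟩ := Nat.exists_eq_add_of_le hpow
    rw [hy, show 2 ^ 2 + y - 1 = y + 3 by omega]
    nlinarith
  · calc 4 + 4 * q + u * κ ≤ (4 + 4 * q) * κ + u * κ := by nlinarith
      _ = (u + 4 * q + 4) * κ := by ring
      _ ≤ b * κ := Nat.mul_le_mul_right _ hub

/-- The bound `m * log κ ≤ c * κ` is used three times: codes of `m / G + 1` positions fit into `q`
bits, the number of types is at most `2 ^ (q / 4)`, and `m ^ m` is at most exponential in `κ`. -/
theorem good_of_large {c κ V m N G D J j u b A : ℕ} (h : Admissible c κ V m) (hc : 1 ≤ c)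
    (hN : 1 ≤ N) (hG : G = 16 * c * N) (hD : D = 2 * c + G + 2) (hJ : J = 2 * N * (D + 2))
    (hj : j = 16 * N * (D + 2)) (hL : c + G + J + 4 * N + 32 * j * c * N + 30 ≤ Nat.log 2 κ)
    (hu : D + 2 ≤ u) (hub : u + 6 ≤ b) (hA : 14 ≤ A) :
    ∃ (ℓ R : ℕ) (tab : List ℕ), Good (Expr.rankQuery J G) u b A N κ V m ℓ R tab := by
  obtain ⟨hκ2, hV, hm, hmκ⟩ := h
  set L := Nat.log 2 κ with hLdef
  have hLκ : 2 ^ L ≤ κ := Nat.pow_log_le_self 2 (by omega)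
  have hκL : κ < 2 ^ (L + 1) := Nat.lt_pow_succ_log_self (by norm_num) κ
  have hLL : L * L ≤ κ := (sq_le_two_pow (by omega)).trans hLκ
  set q := κ / N with hq
  have hqκ : q ≤ κ := Nat.div_le_self κ N
  have hκq : κ < N * (q + 1) := Nat.lt_mul_div_succ κ hN
  have hqL : 4 * L ≤ q := by
    have h1 : N * (4 * L) < N * (q + 1) := by
      calc N * (4 * L) = 4 * N * L := by ring
        _ ≤ L * L := Nat.mul_le_mul_right _ (by omega)
        _ < _ := by omega
    have := Nat.lt_of_mul_lt_mul_left h1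
    omega
  have hN2 : κ ≤ 2 * N * q := by
    calc κ ≤ N * (q + 1) := hκq.le
      _ ≤ N * (2 * q) := Nat.mul_le_mul_left _ (by omega)
      _ = _ := by ring
  have hpow : ∀ {x y : ℕ}, x ≤ y → 2 ^ x ≤ 2 ^ y := fun h => Nat.pow_le_pow_right (by norm_num) h
  have hsize : V.size ≤ κ + 1 := Nat.size_le.2 (lt_of_le_of_lt hV
    (Nat.pow_lt_pow_right (by norm_num) (by omega)))
  have hmc : m ≤ c * κ := (Nat.le_mul_of_pos_right m (by omega)).trans hmκ
  have hm2 : m < 2 ^ (c + L + 1) := by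
    calc m ≤ c * κ := hmc
      _ < 2 ^ c * 2 ^ (L + 1) := Nat.mul_lt_mul'' Nat.lt_two_pow_self hκL
      _ = _ := by rw [← pow_add, Nat.add_assoc]
  -- the group codes
  have hGpos : 0 < G := by rw [hG]; positivity
  -- A position takes `L + 2` bits. Since `G = 16 * c * N`, the full groups use about `3 * q / 16`
  -- bits, and the rest of `q` covers the summand `1`.
  have hcode : (L + 2) * (m / G + 1) ≤ q := by
    have h1 : (L + 2) * (m / G) * G ≤ 3 * (c * κ) := by
      calc (L + 2) * (m / G) * G = (L + 2) * (m / G * G) := by ring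
        _ ≤ (3 * L) * m := Nat.mul_le_mul (by omega) (Nat.div_mul_le_self m G)
        _ = 3 * (m * L) := by ring
        _ ≤ _ := Nat.mul_le_mul_left _ hmκ
    have h2 : c * N * (16 * ((L + 2) * (m / G))) ≤ c * N * (3 * (q + 1)) := by
      calc _ = (L + 2) * (m / G) * G := by rw [hG]; ring
        _ ≤ 3 * (c * κ) := h1
        _ ≤ 3 * (c * (N * (q + 1))) := by gcongr
        _ = _ := by ring
    have h3 := Nat.le_of_mul_le_mul_left h2 (by positivity)
    rw [Nat.mul_add, Nat.mul_one]
    omega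
  -- the types
  set B := D * κ + V.size with hB
  set T := (boundedLists m B).card with hT
  -- The count of types with `n = j`: the first term is small because `m` is of order `κ / log κ`,
  -- and `j` is chosen so large that the second is about `q / 8`.
  set E := j * m + 2 * (q / 16 + 1) with hE
  have hBκ : B ≤ (D + 2) * κ := by rw [Nat.add_mul]; omega
  have hTE : T ≤ 2 ^ E := by
    have hjpos : 0 < j := by rw [hj]; positivity
    refine card_boundedLists_le_two_pow hjpos Nat.lt_two_pow_self (hBκ.trans ?_)
    calc (D + 2) * κ ≤ (D + 2) * (N * (16 * (q / 16 + 1))) :=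
          Nat.mul_le_mul_left _ (hκq.le.trans (Nat.mul_le_mul_left _ (by omega)))
      _ = j * (q / 16 + 1) := by rw [hj]; ring
  have hE4 : 4 * E ≤ q := by
    have h1 : c * N * j * (32 * (j * m)) ≤ c * N * j * (q + 1) := by
      calc _ = j * (32 * j * c * N * m) := by ring
        _ ≤ j * (L * m) := by gcongr; omega
        _ = j * (m * L) := by ring
        _ ≤ j * (c * κ) := by gcongr
        _ ≤ j * (c * (N * (q + 1))) := by gcongr
        _ = _ := by ring
    have h2 := Nat.le_of_mul_le_mul_left h1 (by rw [hj]; positivity)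
    omega
  -- The saving `D * κ` has to cover `E` for the number of types, `m` for rounding `V` up to a power
  -- of two, `(c + L + 1) * m` for `m ^ m`, `G * q` for the codes, and the factor `2 ^ κ`.
  have hrare : T * 2 ^ (m * V.size + G * q + κ) ≤ V.choose m * 2 ^ (D * κ) := by
    have hmm : m ^ m ≤ 2 ^ ((c + L + 1) * m) := by
      rw [pow_mul]; exact Nat.pow_le_pow_left hm2.le m
    have hexp : E + (m + ((c + L + 1) * m + (G * q + κ))) ≤ D * κ := by
      have h1 : (c + 2) * m ≤ m * L := by
        rw [Nat.mul_comm]; exact Nat.mul_le_mul_left _ (by omega)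
      have h2 : G * q ≤ G * κ := Nat.mul_le_mul_left _ hqκ
      calc _ = E + ((c + 2) * m + m * L + G * q + κ) := by ring
        _ ≤ κ + (c * κ + c * κ + G * κ + κ) := by omega
        _ = D * κ := by rw [hD]; ring
    calc T * 2 ^ (m * V.size + G * q + κ) ≤ 2 ^ E * (2 ^ m * V ^ m * 2 ^ (G * q + κ)) := by
          rw [Nat.add_assoc, pow_add]
          exact Nat.mul_le_mul hTE (Nat.mul_le_mul_right _ (two_pow_mul_size_le V m hm))
      _ ≤ 2 ^ E * (2 ^ m * (2 ^ ((c + L + 1) * m) * V.choose m) * 2 ^ (G * q + κ)) := by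
          gcongr
          exact (pow_le_pow_mul_choose hm).trans (Nat.mul_le_mul_right _ hmm)
      _ = V.choose m * 2 ^ (E + (m + ((c + L + 1) * m + (G * q + κ)))) := by
          simp only [pow_add]; ring
      _ ≤ _ := Nat.mul_le_mul_left _ (hpow hexp)
  have hHJ : (D + 2) * κ ≤ q * J := by
    calc (D + 2) * κ ≤ (D + 2) * (2 * N * q) := Nat.mul_le_mul_left _ hN2
      _ = q * J := by rw [hJ]; ring
  have hJpos : 1 ≤ J := by rw [hJ]; exact Nat.succ_le_of_lt (by positivity)
  have hDκ : κ + 1 ≤ (D + 2) * κ := by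
    rw [Nat.add_mul]; have := Nat.zero_le (D * κ); omega
  have hκz : κ + 1 < 2 ^ (L + 2) := by rw [pow_succ]; omega
  obtain ⟨τ, C, hτ, hC0, hC, hsch⟩ := exists_scheme (Λ := κ + 1) (m := m) (G := G) (V := V)
    (r := V.size) (S := D * κ) (q := q) (z := L + 2) (b := m / G + 1) (H := (D + 2) * κ) (J := J)
    (κ := κ) hcode (lt_of_le_of_lt hsize hκz) V.lt_size_self hsize (by omega) hHJ hJpos hDκ hBκ hrare
  have hτE : τ ≤ 2 ^ E := hτ.trans hTE
  have hEκ : 2 ^ (E + 1) ≤ 2 ^ κ := hpow (by omega)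
  have hτ1 : 1 + τ ≤ 2 ^ (E + 1) := by
    have := Nat.one_le_two_pow (n := E)
    rw [pow_succ]; omega
  have huκ : (D + 2) * κ ≤ u * κ := Nat.mul_le_mul_right _ hu
  have hD2 : 2 * κ + 2 * κ ≤ (D + 2) * κ := by
    calc 2 * κ + 2 * κ = 4 * κ := by ring
      _ ≤ _ := Nat.mul_le_mul_right _ (by omega)
  refine good_of_scheme (δ := 1) hsch hC0 hC (by omega) ?_ Nat.one_le_two_pow ?_ (table_lt ?_)
    (by omega) (by omega) huκ (by omega) (by omega) (by omega) (by omega) ?_ ?_ ?_ ?_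
    (by omega) hGpos hV ?_ ?_ hm
  · have h1 : 2 ^ (κ - 1) ≤ 2 ^ κ - τ := by
      have h2 : 2 ^ κ = 2 ^ (κ - 1) * 2 := by rw [← pow_succ, Nat.sub_add_cancel (by omega)]
      have h3 : 2 ^ (E + 1) ≤ 2 ^ (κ - 1) := hpow (by omega)
      omega
    calc 9 * 2 ^ κ * (1 + τ) ^ 2 ≤ 2 ^ 4 * 2 ^ κ * (2 ^ (E + 1)) ^ 2 := by gcongr; norm_num
      _ = 2 ^ (4 + κ + (E + 1) * 2) := by rw [← pow_mul, ← pow_add, ← pow_add]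
      _ ≤ 2 ^ (2 + (κ - 1) * 2) := hpow (by omega)
      _ = 4 * (2 ^ (κ - 1)) ^ 2 := by rw [← pow_mul, pow_add]; norm_num
      _ ≤ _ := by gcongr
  · rw [← hq, ← pow_mul, Nat.mul_comm q 4]
    exact Nat.mul_le_mul_right _ hA
  · calc 4 + 4 * q + u * κ ≤ 6 * κ + u * κ := by omega
      _ = (u + 6) * κ := by ring
      _ ≤ b * κ := Nat.mul_le_mul_right _ hub
  · exact Nat.lt_two_pow_self.le.trans (hpow (by omega))
  · have h1 : G < 2 ^ G := Nat.lt_two_pow_self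
    have h2 : 2 ^ (c + L + 1) ≤ 2 ^ (q - 1) := hpow (by omega)
    have h3 : 2 ^ G ≤ 2 ^ (q - 1) := hpow (by omega)
    have h4 : 2 ^ q = 2 ^ (q - 1) * 2 := by rw [← pow_succ, Nat.sub_add_cancel (by omega)]
    omega
  · have h1 : 2 ^ (E + 2) ≤ 2 ^ q := hpow (by omega)
    rw [pow_succ] at h1
    omega
  · have h1 : 2 ^ (L + 3) ≤ 2 ^ q := hpow (by omega)
    rw [pow_succ] at h1
    omega
  · exact (Nat.le_mul_of_pos_left _ (by omega)).trans hcode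
  · exact (Nat.lt_mul_div_succ m hGpos).le

end RankDS

theorem mainTheorem8 (c ε : ℝ) (hc : 2 ≤ c) (hε : 0 < ε) :
    ∃ (T b A : ℕ) (qAlgRankS : WordRAM.Program)
      (prepRankS : ℕ × ℕ × ℕ × List ℕ → FracString)
      (shape : ℕ → ℕ → ℕ → FracShape)
      (tableRankS : ℕ → ℕ → ℕ → List Bool),
      Computable prepRankS ∧
      ∀ κ V m : ℕ, 2 ≤ κ → V ≤ 2 ^ κ → m ≤ V → (m : ℝ) ≤ c * κ / Real.logb 2 κ →
        ((tableRankS κ V m).length : ℝ) ≤ A * (2 : ℝ) ^ (ε * κ) ∧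
        (shape κ V m).Valid κ ∧
        (shape κ V m).length ≤ Real.logb 2 (V.choose m) + (2 : ℝ) ^ (-(κ : ℝ) / 2) ∧
        ∀ S : Finset ℕ, S ⊆ Finset.range V → S.card = m →
          FracString.HasShape (prepRankS (κ, V, m, S.sort (· ≤ ·))) (shape κ V m) ∧
          ∀ w x : ℕ, b * κ ≤ w → x < V →
            WordRAM.OutputsWithin qAlgRankS T
              (queryState w κ V m x (tableRankS κ V m) (prepRankS (κ, V, m, S.sort (· ≤ ·))))
              (rank S x) := by
  obtain ⟨n, hn⟩ := exists_nat_ge c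
  -- The table has `14 * 2 ^ (4 * q)` entries with `q = κ / N` for large `κ`, so `N ≥ 8 / ε` bounds
  -- their number by a constant times `2 ^ (ε * κ / 2)`.
  obtain ⟨N, hN⟩ := exists_nat_ge (8 / ε)
  have hn1 : 1 ≤ n := by
    have : (1 : ℝ) ≤ n := by linarith
    exact_mod_cast this
  have hN8 : 8 ≤ ε * N := by
    rw [div_le_iff₀ hε] at hN
    linarith
  have hN1 : 1 ≤ N := by
    rcases Nat.eq_zero_or_pos N with rfl | h
    · norm_num at hN8
    · exact h
  obtain ⟨G, hG⟩ : ∃ G, G = 16 * n * N := ⟨_, rfl⟩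
  obtain ⟨D, hD⟩ : ∃ D, D = 2 * n + G + 2 := ⟨_, rfl⟩
  obtain ⟨J, hJ⟩ : ∃ J, J = 2 * N * (D + 2) := ⟨_, rfl⟩
  obtain ⟨j, hj⟩ : ∃ j, j = 16 * N * (D + 2) := ⟨_, rfl⟩
  -- The threshold for `log κ` between the two regimes. The next constant `q` is the digit size used
  -- below it, and `u` is made large enough for both.
  obtain ⟨X, hX⟩ : ∃ X, X = n + G + J + 4 * N + 32 * j * n * N + 30 := ⟨_, rfl⟩
  obtain ⟨q, hq⟩ : ∃ q, q = 2 ^ 2 ^ X + (2 ^ X + 1) * (n * 2 ^ X) + J + G + 3 := ⟨_, rfl⟩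
  obtain ⟨u, hu⟩ : ∃ u, u = D + 2 + q + 1 := ⟨_, rfl⟩
  have hGpos : 0 < G := by rw [hG]; positivity
  have hJpos : 0 < J := by rw [hJ]; positivity
  refine RankDS.main_of_good hε n N hn hN1 hN8 (RankDS.Expr.rankQuery J G) u (u + 4 * q + 6)
    (14 * (2 ^ q) ^ 4) (by omega) (by omega) fun κ V m h => ?_
  by_cases hκ : X ≤ Nat.log 2 κ
  · exact RankDS.good_of_large h hn1 hN1 hG hD hJ hj (hX ▸ hκ) (by omega) (by omega)
      (Nat.le_mul_of_pos_right 14 (by positivity))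
  · have hκX : κ < 2 ^ X := Nat.lt_pow_of_log_lt (by norm_num) (not_le.1 hκ)
    exact RankDS.good_of_small h hκX hJpos hGpos hq (by omega) (by omega) le_rfl
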